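/- Conventions. Let $\mathbb R^4_1$ be $\mathbb R^4$ with $\langle u,u\rangle=(u^1)^2+(u^2)^2+(u^3)^2-(u^4)^2$; the point $(c,r)$ represents the oriented sphere of $\mathbb R^3$ with center $c$ and signed radius $r$, and a contact element $(x,n)\in\mathbb R^3\times S^2$ corresponds to the null line $[x,n]=\{(x-tn,t):t\in\mathbb R\}$. For $y,w\in\mathbb R^4_1$, $w\neq0$ null, $[y,w]$ is the line through $y$ with direction $w$. Let $M$ be a smooth surface. A Legendre immersion is a smooth map $F=(f,n):M\to\mathbb R^3\times S^2$ with $df\cdot n=0$ and $\mathrm{III}=dn\cdot dn$ positive definite ($f$ need not be an immersion). It is $L$-isothermic if, for the complex structure on $M$ given by the conformal class of $\mathrm{III}$ and an orientation (the one induced by $n$), $\mathrm{II}^{(2,0)}=\mu q$ with a real smooth function $\mu$ and a holomorphic quadratic differential $q$, where $\mathrm{II}=-df\cdot dn$. A space-like sphere congruence is a smooth immersion $S:M\to\mathbb R^4_1$ with positive definite induced metric; $F$ envelopes $S$ if $S(p)\in[f(p),n(p)]$ for all $p$. $S$ is a Darboux congruence with envelopes $F=(f,n)$ and $\hat F=(\hat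 f,\hat n)$ if $S$ is a space-like sphere congruence, $F,\hat F$ are Legendre immersions enveloping $S$ with $n\neq\hat n$ everywhere, the third fundamental forms of $F$ and $\hat F$ are conformal, and curvature lines correspond: at each point two linearly independent tangent vectors are principal for both $F$ and $\hat F$. It is nondegenerate if no connected component of $M$ is mapped by $S$ into a fixed sphere complex $\{u:\langle u,v\rangle=c\}$, $v\ne0$. A Laguerre frame is $(a_0;a_1,\dots,a_4)$ where $a_0\in\mathbb R^4_1$ and $a_1,\dots,a_4$ is a positively oriented basis of $\mathbb R^4_1$ with $\langle a_1,a_4\rangle=-1$, $\langle a_2,a_2\rangle=\langle a_3,a_3\rangle=1$, all other products zero, and $a_1+a_4$ future directed; these frames form the group $L=\mathbb R^4\rtimes SO_0(3,1)$. For a smooth map $A=(a_0,a)$ from an open set $U\subset M$ to $L$ write $A^{-1}dA=(\alpha_0,\alpha')=(a^{-1}da_0,a^{-1}da)$. $A$ is a curved flat framing on $U$ if $\alpha^1_0=\alpha^4_0=0$ and $\alpha'_{\mathfrak m}\wedge\alpha'_{\mathfrak m}=0$, where $\alpha'_{\mathfrak m}$ is the component of $\alpha'$ in $\mathfrak m$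 for $\mathfrak{so}(3,1)=\mathfrak k\oplus\mathfrak m$, with $\mathfrak k=\mathfrak{so}(2)\times\mathfrak{so}(1,1)$ preserving $\mathrm{span}\{a_2,a_3\}$ and $\mathrm{span}\{a_1,a_4\}$. Corollary 1. (a) Let $A=(a_0,a):M\to L$ be a curved flat framing such that $a_0$ is an immersion and the null directions of $a_1$ and of $a_4$ are immersions of $M$ into the 2-sphere of null directions (that is, $\alpha^2_0\wedge\alpha^3_0$, $\alpha^2_1\wedge\alpha^3_1$ and $\alpha^1_2\wedge\alpha^1_3$ have no zeros). Then $F=[a_0,a_1]$ and $\hat F=[a_0,a_4]$ are $L$-isothermic Legendre immersions, and $a_0$ is a Darboux congruence with envelopes $F$ and $\hat F$. (b) Conversely, let $S:M\to\mathbb R^4_1$ be a nondegenerate Darboux congruence with envelopes $F,\hat F$. Then every point of $M$ has an open neighbourhood $U$ on which there is a curved flat framing $(S;a_1,a_2,a_3,a_4):U\to L$ with $dS(TU)=\mathrm{span}\{a_2,a_3\}$, with $a_1,a_4$ generating the two null subbundles of the normal bundle of $S$, and with $[S,a_1]=F$, $[S,a_4]=\hat F$. Such a framing exists on every open set $U\subset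 M$ that carries a smooth tangent vector field without zeros, in particular on all of $M$ if $M$ carries one. -/

import Mathlib

open scoped Manifold ContDiff Matrix

noncomputable section

namespace Laguerre

/-! ### Minkowski space, oriented spheres and contact elements -/

/-- Euclidean 3-space, used with the dot product `⬝ᵥ` and the cross product `⨯₃`
(the norm of the function type is used only for its topology). -/
abbrev R3 : Type := Fin 3 → ℝ

/-- Minkowski 4-space, with coordinates `u^1, …, u^4` (numbered `0, …, 3`). -/
abbrev R41 : Type := Fin 4 → ℝ

/-- The Lorentz product `(u^1)² + (u^2)² + (u^3)² - (u^4)²`, polarized. -/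
def lor (x y : R41) : ℝ := x 0 * y 0 + x 1 * y 1 + x 2 * y 2 - x 3 * y 3

/-- The point of Minkowski space representing the oriented sphere of `ℝ³` with center `c` and
signed radius `r`. -/
def orientedSphere (c : R3) (r : ℝ) : R41 := ![c 0, c 1, c 2, r]

/-- The null line `[x, n]` of the contact element `(x, n)`: all oriented spheres that are in
oriented contact at the point `x` with unit normal `n`. -/
def nullLine (x n : R3) : Set R41 := {y | ∃ t : ℝ, y = orientedSphere (x - t • n) t}

/-- The line `[y, w]` through `y` with direction `w`. -/
def lineThrough (y w : R41) : Set R41 := {z | ∃ t : ℝ, z = y + t • w}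

/-! ### Differentials on a surface -/

section Surface

variable {M : Type*} [TopologicalSpace M] [ChartedSpace (EuclideanSpace ℝ (Fin 2)) M]

/-- The differential at `p` of a map from the surface `M` to a normed space. -/
def diff {V : Type*} [NormedAddCommGroup V] [NormedSpace ℝ V] (f : M → V) (p : M) :
    TangentSpace (𝓡 2) p →L[ℝ] V :=
  mfderiv (𝓡 2) 𝓘(ℝ, V) f p

/-! ### Legendre immersions and `L`-isothermic surfaces -/

/-- `F = (f, n)` is a Legendre immersion: `n` is a unit vector field, the contact condition
`df · n = 0` holds, and the third fundamental form `dn · dn` is positive definite. The Euclidean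
projection `f` itself need not be an immersion. -/
structure IsLegendreImmersion (f n : M → R3) : Prop where
  smooth_f : ContMDiff (𝓡 2) 𝓘(ℝ, R3) ∞ f
  smooth_n : ContMDiff (𝓡 2) 𝓘(ℝ, R3) ∞ n
  unit : ∀ p, n p ⬝ᵥ n p = 1
  contact : ∀ p, ∀ v : TangentSpace (𝓡 2) p, diff f p v ⬝ᵥ n p = 0
  third_pos : ∀ p, ∀ v : TangentSpace (𝓡 2) p, v ≠ 0 → 0 < diff n p v ⬝ᵥ diff n p v

/-- The third fundamental form `dn · dn`. -/
def third (n : M → R3) (p : M) (v w : TangentSpace (𝓡 2) p) : ℝ := diff n p v ⬝ᵥ diff n p w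

/-- The second fundamental form `- df · dn`. -/
def second (f n : M → R3) (p : M) (v w : TangentSpace (𝓡 2) p) : ℝ :=
  -(diff f p v ⬝ᵥ diff n p w)

/-- `w = J v`, where `J` is the complex structure on the surface given by the conformal class of
the third fundamental form and the orientation for which `n : M → S²` preserves orientation:
`dn (J v)` is `dn v` turned by a right angle in the tangent plane of `S²` at `n`.
(With the opposite orientation all `(2,0)`-forms are replaced by their complex conjugates, and
the property of being `L`-isothermic stays the same.) -/
def IsJ (n : M → R3) (p : M) (v w : TangentSpace (𝓡 2) p) : Prop :=
  diff n p w = n p ⨯₃ diff n p v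

/-- `q` is a holomorphic quadratic differential for the complex structure induced by `n`: near
each point there is a holomorphic coordinate `z` with `q = h(z) dz²` and `h` holomorphic. -/
def IsHolomorphicQuadraticDifferential (n : M → R3)
    (q : (p : M) → TangentSpace (𝓡 2) p → ℂ) : Prop :=
  ∀ p₀ : M, ∃ (U : Set M) (z : M → ℂ) (h : ℂ → ℂ), IsOpen U ∧ p₀ ∈ U ∧
    ContMDiffOn (𝓡 2) 𝓘(ℝ, ℂ) ∞ z U ∧ Set.InjOn z U ∧
    (∀ p ∈ U, ∀ v : TangentSpace (𝓡 2) p, v ≠ 0 → diff z p v ≠ 0) ∧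
    (∀ p ∈ U, ∀ v w : TangentSpace (𝓡 2) p, IsJ n p v w → diff z p w = Complex.I * diff z p v) ∧
    DifferentiableOn ℂ h (z '' U) ∧
    ∀ p ∈ U, ∀ v : TangentSpace (𝓡 2) p, q p v = h (z p) * (diff z p v) ^ 2

/-- A Legendre immersion `F = (f, n)` is `L`-isothermic if its Hopf differential, the
`(2,0)`-part `II^{(2,0)}(v) = (II(v, v) - II(Jv, Jv) - 2 i II(v, Jv)) / 4` of the second
fundamental form, is a real smooth function times a holomorphic quadratic differential. -/
def IsLIsothermic (f n : M → R3) : Prop :=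
  IsLegendreImmersion f n ∧
  ∃ q : (p : M) → TangentSpace (𝓡 2) p → ℂ, IsHolomorphicQuadraticDifferential n q ∧
  ∃ μ : M → ℝ, ContMDiff (𝓡 2) 𝓘(ℝ, ℝ) ∞ μ ∧
    ∀ p, ∀ v Jv : TangentSpace (𝓡 2) p, IsJ n p v Jv →
      (((second f n p v v - second f n p Jv Jv : ℝ) : ℂ)
        - 2 * Complex.I * (second f n p v Jv : ℂ)) / 4 = (μ p : ℂ) * q p v

/-! ### Sphere congruences -/

/-- `S` is a space-like sphere congruence: a smooth immersion into Minkowski space with positive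
definite induced metric. -/
structure IsSpacelikeCongruence (S : M → R41) : Prop where
  smooth : ContMDiff (𝓡 2) 𝓘(ℝ, R41) ∞ S
  pos : ∀ p, ∀ v : TangentSpace (𝓡 2) p, v ≠ 0 → 0 < lor (diff S p v) (diff S p v)

/-- `(f, n)` envelopes `S`: the sphere `S p` is in oriented contact with the Legendre surface at
the contact element `(f p, n p)`. -/
def Envelopes (f n : M → R3) (S : M → R41) : Prop := ∀ p, S p ∈ nullLine (f p) (n p)

/-- `v` is a principal direction (a tangent direction of a curvature line) of `(f, n)` at `p`. -/
def IsPrincipal (f n : M → R3) (p : M) (v : TangentSpace (𝓡 2) p) : Prop :=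
  v ≠ 0 ∧ ∃ k : ℝ, diff f p v = k • diff n p v

/-- `S` is a Darboux congruence with the two enveloping Legendre immersions `(f, n)` and
`(f', n')`: the correspondence between the envelopes preserves curvature lines (so `S` is
Ribaucour) and is conformal for the third fundamental forms. At an umbilic point of an envelope
every direction is principal; preservation of curvature lines means that at every point there are
two independent directions that are principal for both envelopes. -/
structure IsDarboux (S : M → R41) (f n f' n' : M → R3) : Prop where
  spacelike : IsSpacelikeCongruence S
  legendre : IsLegendreImmersion f n
  legendre' : IsLegendreImmersion f' n'
  envelopes : Envelopes f n S
  envelopes' : Envelopes f' n' S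
  distinct : ∀ p, n p ≠ n' p
  ribaucour : ∀ p, ∃ v w : TangentSpace (𝓡 2) p, LinearIndependent ℝ ![v, w] ∧
    IsPrincipal f n p v ∧ IsPrincipal f' n' p v ∧ IsPrincipal f n p w ∧ IsPrincipal f' n' p w
  conformal : ∀ p, ∃ c : ℝ, 0 < c ∧ ∀ v w : TangentSpace (𝓡 2) p,
    third n' p v w = c * third n p v w

/-- Nondegeneracy: no connected component of `S` belongs to a fixed sphere complex, that is, to
a fixed hyperplane `⟨x, v⟩ = c`, `v ≠ 0`, of Minkowski space. -/
def IsNondegenerate (S : M → R41) : Prop :=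
  ∀ p : M, ¬ ∃ (v : R41) (c : ℝ), v ≠ 0 ∧ ∀ q ∈ connectedComponent p, lor (S q) v = c

end Surface

/-! ### Laguerre frames and curved flat framings -/

/-- The Gram matrix of a Laguerre frame, i.e. of the form `-2 x^1 x^4 + (x^2)² + (x^3)²`. -/
def gram : Matrix (Fin 4) (Fin 4) ℝ :=
  !![0, 0, 0, -1; 0, 1, 0, 0; 0, 0, 1, 0; -1, 0, 0, 0]

/-- `(a_1, a_2, a_3, a_4) = (a 0, a 1, a 2, a 3)` is the linear part of a Laguerre frame: it has
the prescribed Gram matrix, is positively oriented, and `a_1 + a_4` is future directed. With an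
origin `a_0`, these are the images of a fixed frame under the group `L = ℝ⁴ ⋊ SO₀(3,1)`. -/
structure IsLaguerreFrame (a : Fin 4 → R41) : Prop where
  gram_eq : ∀ i j, lor (a i) (a j) = gram i j
  oriented : 0 < (Matrix.of a).det
  future : 0 < a 0 3 + a 3 3

/-- The part of a matrix in `𝔪`, where `𝔰𝔬(3,1) = 𝔨 ⊕ 𝔪` and `𝔨 = 𝔰𝔬(2) × 𝔰𝔬(1,1)` consists of
the elements that preserve both `span {a_2, a_3}` and `span {a_1, a_4}`. -/
def mPart (B : Matrix (Fin 4) (Fin 4) ℝ) : Matrix (Fin 4) (Fin 4) ℝ :=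
  Matrix.of fun i j => if (i = 1 ∨ i = 2) ↔ (j = 1 ∨ j = 2) then 0 else B i j

section Framing

variable {M : Type*} [TopologicalSpace M] [ChartedSpace (EuclideanSpace ℝ (Fin 2)) M]

/-- The matrix with columns `a_1, …, a_4`. -/
def frameMatrix (a : Fin 4 → M → R41) (p : M) : Matrix (Fin 4) (Fin 4) ℝ :=
  Matrix.of fun i j => a j p i

/-- The translation part `α_0 = a⁻¹ da_0` of the connection form `α = A⁻¹ dA`. -/
def connTrans (a₀ : M → R41) (a : Fin 4 → M → R41) (p : M) (v : TangentSpace (𝓡 2) p) :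
    Fin 4 → ℝ :=
  (frameMatrix a p)⁻¹ *ᵥ diff a₀ p v

/-- The linear part `α' = a⁻¹ da` of the connection form `α = A⁻¹ dA`. -/
def connLin (a : Fin 4 → M → R41) (p : M) (v : TangentSpace (𝓡 2) p) :
    Matrix (Fin 4) (Fin 4) ℝ :=
  (frameMatrix a p)⁻¹ * Matrix.of fun i j => diff (a j) p v i

/-- `A = (a_0; a_1, …, a_4) : U → L` is a curved flat framing on the open set `U`:
`α^1_0 = α^4_0 = 0` and `α'_𝔪 ∧ α'_𝔪 = 0`. -/
structure IsCurvedFlatFramingOn (U : Set M) (a₀ : M → R41) (a : Fin 4 → M → R41) : Prop where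
  smooth_origin : ContMDiffOn (𝓡 2) 𝓘(ℝ, R41) ∞ a₀ U
  smooth_frame : ∀ j, ContMDiffOn (𝓡 2) 𝓘(ℝ, R41) ∞ (a j) U
  frame : ∀ p ∈ U, IsLaguerreFrame fun j => a j p
  first_zero : ∀ p ∈ U, ∀ v : TangentSpace (𝓡 2) p, connTrans a₀ a p v 0 = 0
  fourth_zero : ∀ p ∈ U, ∀ v : TangentSpace (𝓡 2) p, connTrans a₀ a p v 3 = 0
  curved_flat : ∀ p ∈ U, ∀ v w : TangentSpace (𝓡 2) p,
    mPart (connLin a p v) * mPart (connLin a p w)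
      - mPart (connLin a p w) * mPart (connLin a p v) = 0

/-- The null direction spanned by `b` is an immersion of the surface into the conformal sphere of
null directions of Minkowski space. -/
def IsImmersedDirection (b : M → R41) : Prop :=
  ∀ p, ∀ v : TangentSpace (𝓡 2) p, v ≠ 0 → ∀ t : ℝ, diff b p v ≠ t • b p

/-- The frame vectors are adapted to the immersion `S` at `p`: `a_2, a_3` span the tangent plane,
and `a_1, a_4` generate the two null lines of the normal plane. -/
def IsAdaptedAt (S : M → R41) (a : Fin 4 → M → R41) (p : M) : Prop :=
  Set.range (diff S p) = (Submodule.span ℝ {a 1 p, a 2 p} : Set R41) ∧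
  ∀ w : R41, (lor w w = 0 ∧ ∀ v : TangentSpace (𝓡 2) p, lor w (diff S p v) = 0) ↔
    ∃ t : ℝ, w = t • a 0 p ∨ w = t • a 3 p

/-- There is a curved flat framing `(S; a_1, …, a_4)` on `U` that is adapted to `S` and satisfies
`[S, a_1] = [f, n]` and `[S, a_4] = [f', n']`. -/
def HasAdaptedCurvedFlatFraming (U : Set M) (S : M → R41) (f n f' n' : M → R3) : Prop :=
  ∃ a : Fin 4 → M → R41, IsCurvedFlatFramingOn U S a ∧
    ∀ p ∈ U, IsAdaptedAt S a p ∧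
      lineThrough (S p) (a 0 p) = nullLine (f p) (n p) ∧
      lineThrough (S p) (a 3 p) = nullLine (f' p) (n' p)

/-- `U` carries a smooth tangent vector field of `M` without zeros. -/
def HasNonvanishingField [IsManifold (𝓡 2) ∞ M] (U : Set M) : Prop :=
  ∃ X : (p : M) → TangentSpace (𝓡 2) p,
    ContMDiffOn (𝓡 2) (𝓡 2).tangent ∞ (fun p => (⟨p, X p⟩ : TangentBundle (𝓡 2) M)) U ∧
    ∀ p ∈ U, X p ≠ 0

end Framing

end Laguerre

end

namespace Laguerre

/-! ### Algebra of the Lorentz product and of Laguerre frames -/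

/-! Identify the screen plane `span {a_2, a_3}` with the complex numbers and let φ, ψ, θ be the
complex-valued 1-forms of screen components of `da_1`, `da_4`, `da_0` (`formC`; frame vectors are
indexed from 0, so `a 0` is `a_1` and `a 3` is `a_4`). The curved flat condition says exactly conj φ
∧ ψ = 0.

Part (a). Where φ is injective, flatness forces ψ = k conj φ. Differentiating ⟨da_0, a_1⟩ = ⟨da_0,
a_4⟩ = 0 makes the pairings of θ with φ and with ψ symmetric, so θ = s φ + r k conj φ with s, r real
(`exists_normal_form`). The complex structure of the Gauss map satisfies φ(Jv) = -i φ(v), so the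
quadratic differential q = conj φ · ψ = k (conj φ)² is of type (2,0), and the (2,0)-part of II is a
real multiple of r q. In the structure equations φ and ψ are rotated by the same connection form and
rescaled by opposite ones; these twists cancel in q, which is therefore holomorphic
(`differentiableOn_of_flat`) in the coordinate obtained by stereographic projection of the Gauss
map. Vectors on which k (conj φ)² is real are principal for both envelopes, and |ψ| = |k| |φ| gives
conformality. Only the first envelope needs work: reversing the frame exchanges the two.

Part (b). With N = (-n, 1) and N' = (-n', 1), a common principal direction is one where `dS`, `dN`
and `dN'` are proportional in the screen. Comparing the induced metric with the two conformal third
fundamental forms gives two proportionality factors of dN' to dN with equal squares (`dichotomy`).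
Opposite factors force the two directions to be orthogonal for III, and this is flatness of the
frame built from N and N' (`flatAt`). Equal factors make the second fundamental forms along N and N'
proportional. A Codazzi argument then shows that a certain normal has constant direction, so S lies
locally in a hyperplane (`constant_normal_of_proportional`). The sign of a product of determinants
separates the cases, so each is open and closed; the second would put a whole component in one
sphere complex, against nondegeneracy (`not_proportional`). Completing N and N' to a frame needs
only a nowhere zero tangent field to fix `a_2`. -/

lemma lor_comm (x y : R41) : lor x y = lor y x := by unfold lor; ring

lemma lor_add_left (x y z : R41) : lor (x + y) z = lor x z + lor y z := by
  simp only [lor, Pi.add_apply]; ring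

lemma lor_add_right (x y z : R41) : lor x (y + z) = lor x y + lor x z := by
  simp only [lor, Pi.add_apply]; ring

lemma lor_sub_left (x y z : R41) : lor (x - y) z = lor x z - lor y z := by
  simp only [lor, Pi.sub_apply]; ring

lemma lor_sub_right (x y z : R41) : lor x (y - z) = lor x y - lor x z := by
  simp only [lor, Pi.sub_apply]; ring

lemma lor_smul_left (t : ℝ) (x y : R41) : lor (t • x) y = t * lor x y := by
  simp only [lor, Pi.smul_apply, smul_eq_mul]; ring

lemma lor_smul_right (t : ℝ) (x y : R41) : lor x (t • y) = t * lor x y := by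
  simp only [lor, Pi.smul_apply, smul_eq_mul]; ring

lemma lor_neg_left (x y : R41) : lor (-x) y = -lor x y := by
  simp only [lor, Pi.neg_apply]; ring

lemma lor_neg_right (x y : R41) : lor x (-y) = -lor x y := by
  simp only [lor, Pi.neg_apply]; ring

lemma lor_zero_left (x : R41) : lor 0 x = 0 := by simp [lor]

lemma lor_zero_right (x : R41) : lor x 0 = 0 := by simp [lor]

/-- The Lorentz product as a continuous bilinear map. -/
noncomputable def lorL : R41 →L[ℝ] R41 →L[ℝ] ℝ :=
  (LinearMap.mk₂ ℝ lor lor_add_left lor_smul_left lor_add_right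
    lor_smul_right).toContinuousBilinearMap

lemma lorL_apply (x y : R41) : lorL x y = lor x y := rfl

/-- Turns statements about orientation into polynomial identities. -/
lemma det_rows (a b c d : R41) : (Matrix.of ![a, b, c, d]).det =
    a 0 * (b 1 * (c 2 * d 3 - c 3 * d 2) - b 2 * (c 1 * d 3 - c 3 * d 1)
      + b 3 * (c 1 * d 2 - c 2 * d 1))
    - a 1 * (b 0 * (c 2 * d 3 - c 3 * d 2) - b 2 * (c 0 * d 3 - c 3 * d 0)
      + b 3 * (c 0 * d 2 - c 2 * d 0))
    + a 2 * (b 0 * (c 1 * d 3 - c 3 * d 1) - b 1 * (c 0 * d 3 - c 3 * d 0)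
      + b 3 * (c 0 * d 1 - c 1 * d 0))
    - a 3 * (b 0 * (c 1 * d 2 - c 2 * d 1) - b 1 * (c 0 * d 2 - c 2 * d 0)
      + b 2 * (c 0 * d 1 - c 1 * d 0)) := by
  simp [Matrix.det_succ_row_zero, Fin.sum_univ_succ, Fin.succAbove, Matrix.submatrix_apply]
  ring

lemma of_eta (a : Fin 4 → R41) : (Matrix.of a) = Matrix.of ![a 0, a 1, a 2, a 3] := by
  ext i j; fin_cases i <;> rfl

namespace IsLaguerreFrame

variable {a : Fin 4 → R41} (ha : IsLaguerreFrame a)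
include ha

lemma lor00 : lor (a 0) (a 0) = 0 := by simpa [gram] using ha.gram_eq 0 0
lemma lor01 : lor (a 0) (a 1) = 0 := by simpa [gram] using ha.gram_eq 0 1
lemma lor02 : lor (a 0) (a 2) = 0 := by simpa [gram] using ha.gram_eq 0 2
lemma lor03 : lor (a 0) (a 3) = -1 := by simpa [gram] using ha.gram_eq 0 3
lemma lor11 : lor (a 1) (a 1) = 1 := by simpa [gram] using ha.gram_eq 1 1
lemma lor12 : lor (a 1) (a 2) = 0 := by simpa [gram] using ha.gram_eq 1 2
lemma lor13 : lor (a 1) (a 3) = 0 := by simpa [gram] using ha.gram_eq 1 3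
lemma lor22 : lor (a 2) (a 2) = 1 := by simpa [gram] using ha.gram_eq 2 2
lemma lor23 : lor (a 2) (a 3) = 0 := by simpa [gram] using ha.gram_eq 2 3
lemma lor33 : lor (a 3) (a 3) = 0 := by simpa [gram] using ha.gram_eq 3 3
lemma lor10 : lor (a 1) (a 0) = 0 := by rw [lor_comm, ha.lor01]
lemma lor20 : lor (a 2) (a 0) = 0 := by rw [lor_comm, ha.lor02]
lemma lor30 : lor (a 3) (a 0) = -1 := by rw [lor_comm, ha.lor03]
lemma lor21 : lor (a 2) (a 1) = 0 := by rw [lor_comm, ha.lor12]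
lemma lor31 : lor (a 3) (a 1) = 0 := by rw [lor_comm, ha.lor13]
lemma lor32 : lor (a 3) (a 2) = 0 := by rw [lor_comm, ha.lor23]

lemma eq_zero_of_lor {x : R41} (h : ∀ i, lor x (a i) = 0) : x = 0 := by
  -- Negating the time coordinate turns the four Lorentz products into one product with the matrix
  -- of rows `a i`, which is invertible by the orientation condition.
  have h1 : Matrix.of a *ᵥ ![x 0, x 1, x 2, -x 3] = 0 := by
    ext i
    have := h i
    simp [Matrix.mulVec, dotProduct, Fin.sum_univ_four, lor] at this ⊢
    linarith
  have h2 := Matrix.eq_zero_of_mulVec_eq_zero ha.oriented.ne' h1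
  ext i
  have h3 := congrFun h2 i
  fin_cases i <;> simpa using h3

/-- Expansion of a vector in a Laguerre frame. -/
lemma expand (x : R41) : x = (-lor x (a 3)) • a 0 + lor x (a 1) • a 1 + lor x (a 2) • a 2
    + (-lor x (a 0)) • a 3 := by
  rw [← sub_eq_zero]
  apply ha.eq_zero_of_lor
  intro i
  fin_cases i <;>
    simp [lor_sub_left, lor_add_left, lor_smul_left, lor_neg_left, ha.lor00, ha.lor01, ha.lor02,
      ha.lor03, ha.lor10, ha.lor11, ha.lor12, ha.lor13, ha.lor20, ha.lor21, ha.lor22, ha.lor23,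
      ha.lor30, ha.lor31, ha.lor32, ha.lor33]

/-- The Lorentz product in terms of the components in a Laguerre frame. -/
lemma lor_eq (x y : R41) : lor x y = lor x (a 1) * lor y (a 1) + lor x (a 2) * lor y (a 2)
    - lor x (a 0) * lor y (a 3) - lor x (a 3) * lor y (a 0) := by
  conv_lhs => rw [ha.expand x]
  simp only [lor_add_left, lor_smul_left]
  rw [lor_comm (a 0), lor_comm (a 1), lor_comm (a 2), lor_comm (a 3)]
  ring

/-- A vector is determined up to multiples of the first null vector. -/
lemma eq_smul_of_lor {x : R41} (h0 : lor x (a 0) = 0) (h1 : lor x (a 1) = 0)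
    (h2 : lor x (a 2) = 0) : x = (-lor x (a 3)) • a 0 := by
  conv_lhs => rw [ha.expand x]
  simp [h0, h1, h2]

/-- Only the sum of the two null vectors is assumed future directed. Null vectors in opposite
half-cones have nonnegative product by Cauchy–Schwarz, so the product -1 puts both in the future
cone. -/
lemma fst_pos : 0 < a 0 3 := by
  have h0 := ha.lor00
  have h3 := ha.lor33
  have h03 := ha.lor03
  have hf := ha.future
  unfold lor at h0 h3 h03
  by_contra hneg
  push Not at hneg
  have hb : 0 < a 3 3 := by linarith
  -- the spatial product is at least the product of the lengths, with the wrong sign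
  have hz : a 0 3 * a 3 3 ≤ 0 := mul_nonpos_of_nonpos_of_nonneg hneg hb.le
  nlinarith [sq_nonneg (a 0 0 * a 3 3 - a 3 0 * a 0 3), sq_nonneg (a 0 1 * a 3 3 - a 3 1 * a 0 3),
    sq_nonneg (a 0 2 * a 3 3 - a 3 2 * a 0 3), sq_nonneg (a 0 0 * a 3 1 - a 0 1 * a 3 0),
    sq_nonneg (a 0 0 * a 3 2 - a 0 2 * a 3 0), sq_nonneg (a 0 1 * a 3 2 - a 0 2 * a 3 1)]

/-- Reversing the order of the frame vectors exchanges the two null directions. -/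
lemma reverse : IsLaguerreFrame fun j => a (Fin.rev j) where
  gram_eq i j := by
    rw [ha.gram_eq]
    fin_cases i <;> fin_cases j <;> simp [gram, Fin.rev]
  oriented := by
    have h := ha.oriented
    rw [of_eta, det_rows] at h ⊢
    simp only [Fin.rev] at h ⊢
    simp at h ⊢
    linarith
  future := by
    have h := ha.future
    change 0 < a 3 3 + a 0 3
    linarith

lemma lst_pos : 0 < a 3 3 := ha.reverse.fst_pos

set_option maxHeartbeats 1000000 in
/-- The orientation of a Laguerre frame: for space-like vectors `X`, `Z` orthogonal to the first
null vector, the area form of the screen plane is, up to a negative factor, the triple product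
with the unit normal `n`, where `a_1 = λ (-n, 1)`. -/
lemma turn_iff {n X Z : R3} (hn : n ⬝ᵥ n = 1) {l : ℝ}
    (h0 : a 0 = l • orientedSphere (-n) 1) (hX : n ⬝ᵥ X = 0) (hZ : n ⬝ᵥ Z = 0) :
    Z = n ⨯₃ X ↔ lor (orientedSphere Z 0) (a 1) = lor (orientedSphere X 0) (a 2) ∧
      lor (orientedSphere Z 0) (a 2) = -lor (orientedSphere X 0) (a 1) := by
  have hl : 0 < l := by have := ha.fst_pos; rw [h0] at this; simpa [orientedSphere] using this
  have h3 := ha.lor33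
  have h03 := ha.lor03
  have hdet := ha.oriented
  have h3p := ha.lst_pos
  have key : ∀ X Z : R3, n ⬝ᵥ X = 0 → n ⬝ᵥ Z = 0 → Z = n ⨯₃ X →
      lor (orientedSphere Z 0) (a 1) = lor (orientedSphere X 0) (a 2) ∧
      lor (orientedSphere Z 0) (a 2) = -lor (orientedSphere X 0) (a 1) := by
    intro X Z hX hZ hZX
    set X' := orientedSphere X 0 with hX'
    set Z' := orientedSphere Z 0 with hZ'
    have lX0 : lor X' (a 0) = 0 := by
      rw [h0, hX']; simp [lor, orientedSphere, dotProduct, Fin.sum_univ_three] at hX ⊢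
      linear_combination (-l) * hX
    have lZ0 : lor Z' (a 0) = 0 := by
      rw [h0, hZ']; simp [lor, orientedSphere, dotProduct, Fin.sum_univ_three] at hZ ⊢
      linear_combination (-l) * hZ
    have hXX : lor X' X' = X ⬝ᵥ X := by
      simp [hX', lor, orientedSphere, dotProduct, Fin.sum_univ_three]
    have hZZ : lor Z' Z' = X ⬝ᵥ X := by
      simp [hZ', lor, orientedSphere, dotProduct, Fin.sum_univ_three, hZX, cross_apply] at hn hX ⊢
      linear_combination (X 0 ^ 2 + X 1 ^ 2 + X 2 ^ 2) * hn -
        (n 0 * X 0 + n 1 * X 1 + n 2 * X 2) * hX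
    have eX := ha.lor_eq X' X'
    have eZ := ha.lor_eq Z' Z'
    rw [lX0, hXX] at eX
    rw [lZ0, hZZ] at eZ
    -- Equal lengths and orthogonality determine the screen components of `Z'` up to sign. The sign
    -- comes from evaluating one determinant twice, in the frame and in coordinates.
    have d1 : (Matrix.of ![a 0, X', Z', a 3]).det
        = (lor X' (a 1) * lor Z' (a 2) - lor X' (a 2) * lor Z' (a 1)) * (Matrix.of a).det := by
      conv_lhs => rw [ha.expand X', ha.expand Z']
      rw [lX0, lZ0, of_eta a, det_rows, det_rows]
      simp only [Pi.add_apply, Pi.smul_apply, smul_eq_mul, neg_zero, zero_mul, add_zero]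
      ring
    have d2 : (Matrix.of ![a 0, X', Z', a 3]).det = -(X ⬝ᵥ X) := by
      rw [det_rows, h0]
      rw [h0] at h03
      simp [hX', hZ', lor, orientedSphere, dotProduct, Fin.sum_univ_three, hZX, cross_apply]
        at hn hX h03 ⊢
      linear_combination (X 0 ^ 2 + X 1 ^ 2 + X 2 ^ 2) * h03
        + l * (X 0 ^ 2 + X 1 ^ 2 + X 2 ^ 2) * (-a 3 3) * hn
        + l * (a 3 3 * (n 0 * X 0 + n 1 * X 1 + n 2 * X 2) + a 3 0 * X 0 + a 3 1 * X 1
          + a 3 2 * X 2) * hX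
    have hneg : (lor X' (a 1) * lor Z' (a 2) - lor X' (a 2) * lor Z' (a 1)) ≤ 0 := by
      by_contra hpos
      push Not at hpos
      have h1 := mul_pos hpos hdet
      have h2 : 0 ≤ X ⬝ᵥ X := by
        simp [dotProduct, Fin.sum_univ_three]
        nlinarith [sq_nonneg (X 0), sq_nonneg (X 1), sq_nonneg (X 2)]
      linarith
    have hXZ := ha.lor_eq X' Z'
    have hXZ0 : lor X' Z' = 0 := by
      simp [hX', hZ', lor, orientedSphere, hZX, cross_apply]; ring
    rw [lX0, lZ0, hXZ0] at hXZ
    set x1 := lor X' (a 1)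
    set x2 := lor X' (a 2)
    set z1 := lor Z' (a 1)
    set z2 := lor Z' (a 2)
    set r := X ⬝ᵥ X
    -- Lagrange's identity gives the square, the determinant the sign. The extremal value -r then
    -- makes the sum of squares below vanish.
    have hr : (x1 * z2 - x2 * z1) = -r := by
      have hsq : (x1 * z2 - x2 * z1) ^ 2 = r ^ 2 := by
        have : (x1 * z2 - x2 * z1) ^ 2
          = (x1 * x1 + x2 * x2) * (z1 * z1 + z2 * z2) - (x1 * z1 + x2 * z2) ^ 2 := by ring
        have e1 : x1 * x1 + x2 * x2 = r := by linarith
        have e2 : z1 * z1 + z2 * z2 = r := by linarith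
        have e3 : x1 * z1 + x2 * z2 = 0 := by linarith
        rw [this, e1, e2, e3]; ring
      rcases sq_eq_sq_iff_eq_or_eq_neg.mp hsq with h | h
      · have hr0 : 0 ≤ r := by nlinarith
        linarith
      · exact h
    have hs : (z1 - x2) ^ 2 + (z2 + x1) ^ 2 = 0 := by nlinarith
    constructor <;> nlinarith [sq_nonneg (z1 - x2), sq_nonneg (z2 + x1)]
  constructor
  · exact key X Z hX hZ
  · rintro ⟨e1, e2⟩
    have hc : n ⬝ᵥ (n ⨯₃ X) = 0 := by simp
    obtain ⟨f1, f2⟩ := key X _ hX hc rfl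
    -- The difference is orthogonal to `a 0`, `a 1`, `a 2`, hence a multiple of `a 0`; its time
    -- coordinate is zero and that of `a 0` is positive, so it vanishes.
    have hd : lor (orientedSphere (Z - n ⨯₃ X) 0) (a 0) = 0 := by
      rw [h0]
      have : n ⬝ᵥ (Z - n ⨯₃ X) = 0 := by rw [dotProduct_sub, hZ, hc, sub_zero]
      simp only [lor, orientedSphere, dotProduct, Fin.sum_univ_three] at this ⊢
      simp at this ⊢
      linear_combination (-l) * this
    have hsub : orientedSphere (Z - n ⨯₃ X) 0
        = orientedSphere Z 0 - orientedSphere (n ⨯₃ X) 0 := by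
      ext i; fin_cases i <;> simp [orientedSphere]
    have hE := ha.eq_smul_of_lor hd
      (by rw [hsub, lor_sub_left, e1, f1, sub_self]) (by rw [hsub, lor_sub_left, e2, f2, sub_self])
    have h33 := congrFun hE 3
    simp [orientedSphere] at h33
    have hz : -lor (orientedSphere (Z - n ⨯₃ X) 0) (a 3) = 0 := by
      rcases h33 with h | h
      · rw [neg_eq_zero]; exact h
      · exact absurd h ha.fst_pos.ne'
    rw [hz, zero_smul] at hE
    rw [← sub_eq_zero]
    ext i
    have := congrFun hE
    fin_cases i
    · simpa [orientedSphere] using this 0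
    · simpa [orientedSphere] using this 1
    · simpa [orientedSphere] using this 2

end IsLaguerreFrame
end Laguerre

namespace Laguerre

/-! ### Differentiation of maps from a surface -/

section Calculus

variable {M : Type*} [TopologicalSpace M] [ChartedSpace (EuclideanSpace ℝ (Fin 2)) M]
  {V W X : Type*} [NormedAddCommGroup V] [NormedSpace ℝ V] [NormedAddCommGroup W]
  [NormedSpace ℝ W] [NormedAddCommGroup X] [NormedSpace ℝ X]

lemma diff_comp {f : M → V} {g : V → W} {p : M} (hg : DifferentiableAt ℝ g (f p))
    (hf : MDifferentiableAt (𝓡 2) 𝓘(ℝ, V) f p) (v : TangentSpace (𝓡 2) p) :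
    diff (fun q => g (f q)) p v = fderiv ℝ g (f p) (diff f p v) := by
  have := (hg.hasFDerivAt.hasMFDerivAt.comp p hf.hasMFDerivAt).mfderiv
  exact congrArg (fun L => L v) this

lemma diff_clm (L : V →L[ℝ] W) {f : M → V} {p : M}
    (hf : MDifferentiableAt (𝓡 2) 𝓘(ℝ, V) f p) (v : TangentSpace (𝓡 2) p) :
    diff (fun q => L (f q)) p v = L (diff f p v) := by
  rw [diff_comp L.differentiableAt hf, L.fderiv]

lemma diff_bilin (B : V →L[ℝ] W →L[ℝ] X) {f : M → V} {g : M → W} {p : M}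
    (hf : MDifferentiableAt (𝓡 2) 𝓘(ℝ, V) f p) (hg : MDifferentiableAt (𝓡 2) 𝓘(ℝ, W) g p)
    (v : TangentSpace (𝓡 2) p) :
    diff (fun q => B (f q) (g q)) p v = B (diff f p v) (g p) + B (f p) (diff g p v) := by
  have h1 := hf.hasMFDerivAt.prodMk hg.hasMFDerivAt
  have h2 : HasFDerivAt (fun x : V × W => B x.1 x.2) _ (f p, g p) :=
    B.hasFDerivAt_of_bilinear hasFDerivAt_fst hasFDerivAt_snd
  have h3 := (h2.hasMFDerivAt.comp p h1).mfderiv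
  have h4 := congrArg (fun L => L v) h3
  refine Eq.trans h4 ?_
  change B (f p) (mfderiv (𝓡 2) 𝓘(ℝ, W) g p v) + B (mfderiv (𝓡 2) 𝓘(ℝ, V) f p v) (g p) = _
  rw [add_comm]; rfl

lemma diff_lor {f g : M → R41} {p : M} (hf : MDifferentiableAt (𝓡 2) 𝓘(ℝ, R41) f p)
    (hg : MDifferentiableAt (𝓡 2) 𝓘(ℝ, R41) g p) (v : TangentSpace (𝓡 2) p) :
    diff (fun q => lor (f q) (g q)) p v = lor (diff f p v) (g p) + lor (f p) (diff g p v) :=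
  diff_bilin lorL hf hg v

lemma diff_smul {c : M → ℝ} {f : M → V} {p : M} (hc : MDifferentiableAt (𝓡 2) 𝓘(ℝ, ℝ) c p)
    (hf : MDifferentiableAt (𝓡 2) 𝓘(ℝ, V) f p) (v : TangentSpace (𝓡 2) p) :
    diff (fun q => c q • f q) p v = (diff c p v : ℝ) • f p + c p • diff f p v :=
  diff_bilin (ContinuousLinearMap.lsmul ℝ ℝ) hc hf v

lemma diff_add {f g : M → V} {p : M} (hf : MDifferentiableAt (𝓡 2) 𝓘(ℝ, V) f p)
    (hg : MDifferentiableAt (𝓡 2) 𝓘(ℝ, V) g p) (v : TangentSpace (𝓡 2) p) :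
    diff (fun q => f q + g q) p v = (diff f p v + diff g p v : V) := by
  exact congrArg (fun L => L v) (hf.hasMFDerivAt.add hg.hasMFDerivAt).mfderiv

lemma diff_const (c : V) (p : M) (v : TangentSpace (𝓡 2) p) :
    diff (fun _ : M => c) p v = 0 := by
  exact congrArg (fun L : TangentSpace (𝓡 2) p →L[ℝ] V => L v) (hasMFDerivAt_const (I := 𝓡 2) (I' := 𝓘(ℝ, V)) c p).mfderiv

lemma diff_congr {f g : M → V} {p : M} (h : f =ᶠ[nhds p] g) (v : TangentSpace (𝓡 2) p) :
    diff f p v = diff g p v := by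
  exact congrArg (fun L : TangentSpace (𝓡 2) p →L[ℝ] V => L v) (h.mfderiv_eq (I := 𝓡 2) (I' := 𝓘(ℝ, V)))

end Calculus

/-! ### Local parametrizations of a surface -/

section Param

variable {M : Type*} [TopologicalSpace M] [ChartedSpace (EuclideanSpace ℝ (Fin 2)) M]
  {F G V : Type*} [NormedAddCommGroup F] [NormedSpace ℝ F] [NormedAddCommGroup G]
  [NormedSpace ℝ G] [NormedAddCommGroup V] [NormedSpace ℝ V]

/-- `Φ` is a smooth parametrization of the open set `U` of the surface `M` by the open set `Ω`,
with smooth inverse `χ`. -/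
structure IsParam (Φ : F → M) (χ : M → F) (Ω : Set F) (U : Set M) : Prop where
  isOpen_dom : IsOpen Ω
  isOpen_ran : IsOpen U
  mapsTo : ∀ x ∈ Ω, Φ x ∈ U
  mapsTo_inv : ∀ p ∈ U, χ p ∈ Ω
  left_inv : ∀ x ∈ Ω, χ (Φ x) = x
  right_inv : ∀ p ∈ U, Φ (χ p) = p
  smooth : ContMDiffOn 𝓘(ℝ, F) (𝓡 2) ∞ Φ Ω
  smooth_inv : ContMDiffOn (𝓡 2) 𝓘(ℝ, F) ∞ χ U

/-- The differential of a parametrization. -/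
noncomputable def paramDiff (Φ : F → M) (x : F) : F →L[ℝ] TangentSpace (𝓡 2) (Φ x) :=
  mfderiv 𝓘(ℝ, F) (𝓡 2) Φ x

lemma exists_isParam [IsManifold (𝓡 2) ∞ M] (p : M) :
    ∃ (Φ : EuclideanSpace ℝ (Fin 2) → M) (χ : M → EuclideanSpace ℝ (Fin 2))
      (Ω : Set (EuclideanSpace ℝ (Fin 2))) (U : Set M), IsParam Φ χ Ω U ∧ p ∈ U := by
  refine ⟨(chartAt _ p).symm, chartAt _ p, (chartAt _ p).target, (chartAt _ p).source,
    ⟨(chartAt _ p).open_target, (chartAt _ p).open_source,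
      fun x hx => (chartAt _ p).map_target hx, fun x hx => (chartAt _ p).map_source hx,
      fun x hx => (chartAt _ p).right_inv hx, fun x hx => (chartAt _ p).left_inv hx,
      contMDiffOn_chart_symm, contMDiffOn_chart⟩, mem_chart_source _ p⟩

namespace IsParam

variable {Φ : F → M} {χ : M → F} {Ω : Set F} {U : Set M} (h : IsParam Φ χ Ω U)
include h

lemma contDiffOn_comp {f : M → V} {U' : Set M} (hf : ContMDiffOn (𝓡 2) 𝓘(ℝ, V) ∞ f U')
    (hU : U ⊆ U') : ContDiffOn ℝ ∞ (fun x => f (Φ x)) Ω :=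
  (hf.comp h.smooth fun x hx => hU (h.mapsTo x hx)).contDiffOn

lemma contMDiffOn_of_comp {f : M → V} (hf : ContDiffOn ℝ ∞ (fun x => f (Φ x)) Ω) :
    ContMDiffOn (𝓡 2) 𝓘(ℝ, V) ∞ f U := by
  refine (hf.contMDiffOn.comp h.smooth_inv fun p hp => h.mapsTo_inv p hp).congr ?_
  intro p hp
  simp [h.right_inv p hp]

lemma mdifferentiableAt {x : F} (hx : x ∈ Ω) : MDifferentiableAt 𝓘(ℝ, F) (𝓡 2) Φ x :=
  (h.smooth.contMDiffAt (h.isOpen_dom.mem_nhds hx)).mdifferentiableAt (by simp)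

lemma mdifferentiableAt_inv {p : M} (hp : p ∈ U) : MDifferentiableAt (𝓡 2) 𝓘(ℝ, F) χ p :=
  (h.smooth_inv.contMDiffAt (h.isOpen_ran.mem_nhds hp)).mdifferentiableAt (by simp)

lemma fderiv_comp {f : M → V} {x : F} (hx : x ∈ Ω)
    (hf : MDifferentiableAt (𝓡 2) 𝓘(ℝ, V) f (Φ x)) (w : F) :
    fderiv ℝ (fun y => f (Φ y)) x w = diff f (Φ x) (paramDiff Φ x w) := by
  have h0 := hf.hasMFDerivAt.comp x (h.mdifferentiableAt hx).hasMFDerivAt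
  have h1 : HasFDerivAt (fun y => f (Φ y))
      (((diff f (Φ x)).comp (paramDiff Φ x) : F →L[ℝ] V)) x := hasMFDerivAt_iff_hasFDerivAt.mp h0
  rw [h1.fderiv]; rfl

lemma diff_inv_paramDiff {x : F} (hx : x ∈ Ω) (w : F) :
    diff χ (Φ x) (paramDiff Φ x w) = w := by
  rw [← h.fderiv_comp hx (h.mdifferentiableAt_inv (h.mapsTo x hx))]
  have : (fun y => χ (Φ y)) =ᶠ[nhds x] id :=
    Filter.eventuallyEq_of_mem (h.isOpen_dom.mem_nhds hx) h.left_inv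
  rw [this.fderiv_eq, fderiv_id]; rfl

lemma paramDiff_diff_inv {x : F} (hx : x ∈ Ω) (v : TangentSpace (𝓡 2) (Φ x)) :
    paramDiff Φ x (diff χ (Φ x) v) = v := by
  have hp := h.mapsTo x hx
  have e : χ (Φ x) = x := h.left_inv x hx
  have h1 : HasMFDerivAt 𝓘(ℝ, F) (𝓡 2) Φ (χ (Φ x)) (paramDiff Φ x) := by
    rw [e]; exact (h.mdifferentiableAt hx).hasMFDerivAt
  have h2 := h1.comp (Φ x) (h.mdifferentiableAt_inv hp).hasMFDerivAt
  have h3 : (Φ ∘ χ) =ᶠ[nhds (Φ x)] id :=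
    Filter.eventuallyEq_of_mem (h.isOpen_ran.mem_nhds hp) h.right_inv
  have h4 := (hasMFDerivAt_id (I := 𝓡 2) (Φ x)).congr_of_eventuallyEq h3
  have h5 := hasMFDerivAt_unique h2 h4
  exact congrArg (fun L => L v) h5

lemma paramDiff_surjective {x : F} (hx : x ∈ Ω) : Function.Surjective (paramDiff Φ x) :=
  fun v => ⟨_, h.paramDiff_diff_inv hx v⟩

lemma paramDiff_injective {x : F} (hx : x ∈ Ω) : Function.Injective (paramDiff Φ x) :=
  fun v w e => by
    rw [← h.diff_inv_paramDiff hx v, ← h.diff_inv_paramDiff hx w, e]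

lemma diff_inv_ne_zero {p : M} (hp : p ∈ U) {v : TangentSpace (𝓡 2) p} (hv : v ≠ 0) :
    diff χ p v ≠ 0 := by
  have h1 := h.mapsTo_inv p hp
  obtain ⟨x, hx, rfl⟩ : ∃ x ∈ Ω, Φ x = p := ⟨χ p, h1, h.right_inv p hp⟩
  intro h0
  apply hv
  rw [← h.paramDiff_diff_inv hx v, h0, map_zero]

/-- Change of parameter by a local diffeomorphism. -/
lemma change [CompleteSpace F] {ζ : F → G} (hζ : ContDiffOn ℝ ∞ ζ Ω) {x₀ : F} (hx₀ : x₀ ∈ Ω)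
    (hinv : ∀ x ∈ Ω, ∃ L : F ≃L[ℝ] G, fderiv ℝ ζ x = L) :
    ∃ (Ψ : G → M) (D : Set G) (U' : Set M), IsParam Ψ (fun p => ζ (χ p)) D U' ∧ Φ x₀ ∈ U' ∧
      U' ⊆ U := by
  have hc : ∀ x ∈ Ω, ContDiffAt ℝ ∞ ζ x := fun x hx =>
    hζ.contDiffAt (h.isOpen_dom.mem_nhds hx)
  have hd : ∀ x ∈ Ω, ∀ L : F ≃L[ℝ] G, fderiv ℝ ζ x = L → HasFDerivAt ζ (L : F →L[ℝ] G) x := by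
    intro x hx L hL
    rw [← hL]; exact ((hc x hx).differentiableAt (by simp)).hasFDerivAt
  obtain ⟨L₀, hL₀⟩ := hinv x₀ hx₀
  let e₀ := (hc x₀ hx₀).toOpenPartialHomeomorph ζ (hd x₀ hx₀ L₀ hL₀) (by simp)
  have he₀ : (e₀ : F → G) = ζ := rfl
  let e := e₀.restrOpen Ω h.isOpen_dom
  have hes : e.source = e₀.source ∩ Ω := e₀.restrOpen_source Ω h.isOpen_dom
  have hee : ∀ x, e x = ζ x := fun x => rfl
  have hmem : x₀ ∈ e.source := by
    rw [hes]
    exact ⟨(hc x₀ hx₀).mem_toOpenPartialHomeomorph_source (hd x₀ hx₀ L₀ hL₀) (by simp), hx₀⟩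
  -- The derivative is invertible on all of `Ω`, not only at `x₀`, so the inverse is smooth on the
  -- whole target of `e`.
  have hsymm : ContDiffOn ℝ ∞ e.symm e.target := by
    intro y hy
    have hy' := e.map_target hy
    rw [hes] at hy'
    obtain ⟨L, hL⟩ := hinv _ hy'.2
    exact (e.contDiffAt_symm hy (hd _ hy'.2 L hL) (hc _ hy'.2)).contDiffWithinAt
  have hsub : ∀ x ∈ e.source, x ∈ Ω := fun x hx => by rw [hes] at hx; exact hx.2
  refine ⟨fun y => Φ (e.symm y), e.target, U ∩ χ ⁻¹' e.source,
    ⟨e.open_target, ?_, ?_, ?_, ?_, ?_, ?_, ?_⟩, ?_, Set.inter_subset_left⟩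
  · exact h.smooth_inv.continuousOn.isOpen_inter_preimage h.isOpen_ran e.open_source
  · intro y hy
    have hy' := e.map_target hy
    refine ⟨h.mapsTo _ (hsub _ hy'), ?_⟩
    simp only [Set.mem_preimage]
    rwa [h.left_inv _ (hsub _ hy')]
  · rintro p ⟨hp, hp'⟩
    exact e.map_source hp'
  · intro y hy
    rw [h.left_inv _ (hsub _ (e.map_target hy))]
    exact e.right_inv hy
  · rintro p ⟨hp, hp'⟩
    have := e.left_inv hp'
    rw [hee] at this
    rw [this, h.right_inv p hp]
  · exact h.smooth.comp hsymm.contMDiffOn fun y hy => hsub _ (e.map_target hy)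
  · exact hζ.contMDiffOn.comp (h.smooth_inv.mono Set.inter_subset_left)
      fun p hp => h.mapsTo_inv p hp.1
  · refine ⟨h.mapsTo _ hx₀, ?_⟩
    simp only [Set.mem_preimage]
    rwa [h.left_inv _ hx₀]

end IsParam
end Param

/-! ### Calculus in a parameter domain -/

section Flat

variable {F V : Type*} [NormedAddCommGroup F] [NormedSpace ℝ F] [NormedAddCommGroup V]
  [NormedSpace ℝ V] {Ω : Set F}

lemma contDiffOn_fderiv_apply {f : F → V} (hΩ : IsOpen Ω) (hf : ContDiffOn ℝ ∞ f Ω) (v : F) :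
    ContDiffOn ℝ ∞ (fun x => fderiv ℝ f x v) Ω :=
  (hf.fderiv_of_isOpen hΩ (m := ∞) (by simp)).clm_apply contDiffOn_const

lemma differentiableAt_of_contDiffOn {f : F → V} (hΩ : IsOpen Ω) (hf : ContDiffOn ℝ ∞ f Ω)
    {x : F} (hx : x ∈ Ω) : DifferentiableAt ℝ f x :=
  (hf.contDiffAt (hΩ.mem_nhds hx)).differentiableAt (by simp)

lemma fderiv_fderiv_comm {f : F → V} (hΩ : IsOpen Ω) (hf : ContDiffOn ℝ ∞ f Ω)
    {x : F} (hx : x ∈ Ω) (v w : F) :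
    fderiv ℝ (fun y => fderiv ℝ f y v) x w = fderiv ℝ (fun y => fderiv ℝ f y w) x v := by
  have hc := hf.contDiffAt (hΩ.mem_nhds hx)
  have hs := hc.isSymmSndFDerivAt (by simpa using WithTop.coe_le_coe.mpr (le_top : (2 : ℕ∞) ≤ ⊤))
  have hd : DifferentiableAt ℝ (fderiv ℝ f) x :=
    (hc.fderiv_right (m := ∞) (by simp)).differentiableAt (by simp)
  rw [fderiv_clm_apply hd (differentiableAt_const _), fderiv_clm_apply hd (differentiableAt_const _)]
  simpa using hs.eq w v

lemma fderiv_lor {f g : F → R41} {x : F} (hf : DifferentiableAt ℝ f x)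
    (hg : DifferentiableAt ℝ g x) (v : F) :
    fderiv ℝ (fun y => lor (f y) (g y)) x v
      = lor (fderiv ℝ f x v) (g x) + lor (f x) (fderiv ℝ g x v) := by
  have := (lorL.hasFDerivAt_of_bilinear hf.hasFDerivAt hg.hasFDerivAt).fderiv
  have h2 := congrArg (fun L => L v) this
  refine Eq.trans h2 ?_
  simp [lorL_apply]
  ring

lemma ContDiffOn.lor {f g : F → R41} (hf : ContDiffOn ℝ ∞ f Ω) (hg : ContDiffOn ℝ ∞ g Ω) :
    ContDiffOn ℝ ∞ (fun x => lor (f x) (g x)) Ω := by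
  unfold Laguerre.lor
  rw [contDiffOn_pi] at hf hg
  exact ((((hf 0).mul (hg 0)).add ((hf 1).mul (hg 1))).add ((hf 2).mul (hg 2))).sub
    ((hf 3).mul (hg 3))

end Flat

end Laguerre

namespace Laguerre

/-! ### The connection form of a Laguerre framing -/

section Connection

variable {M : Type*} [TopologicalSpace M] [ChartedSpace (EuclideanSpace ℝ (Fin 2)) M]
  {U : Set M} {S : M → R41} {a : Fin 4 → M → R41}

/-- The components in a Laguerre frame. -/
noncomputable def coords (a : Fin 4 → R41) (x : R41) : Fin 4 → ℝ :=
  ![-lor x (a 3), lor x (a 1), lor x (a 2), -lor x (a 0)]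

omit [TopologicalSpace M] [ChartedSpace (EuclideanSpace ℝ (Fin 2)) M] in
lemma frameMatrix_mulVec_coords {p : M} (ha : IsLaguerreFrame fun j => a j p) (x : R41) :
    frameMatrix a p *ᵥ coords (fun j => a j p) x = x := by
  conv_rhs => rw [ha.expand x]
  ext i
  simp [frameMatrix, coords, Matrix.mulVec, dotProduct, Fin.sum_univ_four]
  ring

omit [TopologicalSpace M] [ChartedSpace (EuclideanSpace ℝ (Fin 2)) M] in
lemma isUnit_det_frameMatrix {p : M} (ha : IsLaguerreFrame fun j => a j p) :
    IsUnit (frameMatrix a p).det := by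
  have : frameMatrix a p = (Matrix.of fun j => a j p)ᵀ := rfl
  rw [this, Matrix.det_transpose]
  exact ha.oriented.ne'.isUnit

omit [TopologicalSpace M] [ChartedSpace (EuclideanSpace ℝ (Fin 2)) M] in
lemma frameMatrix_inv_mulVec {p : M} (ha : IsLaguerreFrame fun j => a j p) (x : R41) :
    (frameMatrix a p)⁻¹ *ᵥ x = coords (fun j => a j p) x := by
  conv_lhs => rw [← frameMatrix_mulVec_coords ha x]
  rw [Matrix.mulVec_mulVec, Matrix.nonsing_inv_mul _ (isUnit_det_frameMatrix ha),
    Matrix.one_mulVec]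

lemma connLin_apply {p : M} (ha : IsLaguerreFrame fun j => a j p) (v : TangentSpace (𝓡 2) p)
    (i j : Fin 4) : connLin a p v i j = coords (fun j => a j p) (diff (a j) p v) i := by
  rw [← frameMatrix_inv_mulVec ha]
  rfl

lemma mdifferentiableAt_of_contMDiffOn {V : Type*} [NormedAddCommGroup V] [NormedSpace ℝ V]
    {f : M → V} (hU : IsOpen U) (hf : ContMDiffOn (𝓡 2) 𝓘(ℝ, V) ∞ f U) {p : M} (hp : p ∈ U) :
    MDifferentiableAt (𝓡 2) 𝓘(ℝ, V) f p :=
  (hf.contMDiffAt (hU.mem_nhds hp)).mdifferentiableAt (by simp)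

lemma lor_diff_frame (hU : IsOpen U) (hs : ∀ j, ContMDiffOn (𝓡 2) 𝓘(ℝ, R41) ∞ (a j) U)
    (ha : ∀ p ∈ U, IsLaguerreFrame fun j => a j p) {p : M} (hp : p ∈ U)
    (v : TangentSpace (𝓡 2) p) (i j : Fin 4) :
    lor (diff (a j) p v) (a i p) = -lor (diff (a i) p v) (a j p) := by
  have h1 := diff_lor (mdifferentiableAt_of_contMDiffOn hU (hs i) hp)
    (mdifferentiableAt_of_contMDiffOn hU (hs j) hp) v
  have h2 : (fun q => lor (a i q) (a j q)) =ᶠ[nhds p] fun _ => gram i j :=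
    Filter.eventuallyEq_of_mem (hU.mem_nhds hp) fun q hq => (ha q hq).gram_eq i j
  rw [diff_congr h2, diff_const, lor_comm (a i p)] at h1
  linarith

/-- The component `⟨da_i, a_j⟩` of the connection form. -/
noncomputable def conn (a : Fin 4 → M → R41) (i j : Fin 4) (p : M) (v : TangentSpace (𝓡 2) p) : ℝ :=
  lor (diff (a i) p v) (a j p)

lemma conn_add (i j : Fin 4) (p : M) (v w : TangentSpace (𝓡 2) p) :
    conn a i j p (v + w) = conn a i j p v + conn a i j p w := by
  unfold conn; rw [map_add]; exact lor_add_left _ _ _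

lemma conn_smul (i j : Fin 4) (p : M) (t : ℝ) (v : TangentSpace (𝓡 2) p) :
    conn a i j p (t • v) = t * conn a i j p v := by
  unfold conn; rw [map_smul]; exact lor_smul_left _ _ _

/-- The two real equations equivalent to `α'_𝔪 ∧ α'_𝔪 = 0`. -/
def FlatAt (a : Fin 4 → M → R41) (p : M) (v w : TangentSpace (𝓡 2) p) : Prop :=
  conn a 0 1 p v * conn a 3 1 p w + conn a 0 2 p v * conn a 3 2 p w
    = conn a 0 1 p w * conn a 3 1 p v + conn a 0 2 p w * conn a 3 2 p v ∧
  conn a 0 1 p v * conn a 3 2 p w - conn a 0 2 p v * conn a 3 1 p w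
    = conn a 0 1 p w * conn a 3 2 p v - conn a 0 2 p w * conn a 3 1 p v

/-- Skewness of the connection form with respect to the Gram matrix leaves four independent entries
in 𝔪: the real and imaginary parts of φ and ψ. -/
lemma mPart_connLin (hU : IsOpen U) (hs : ∀ j, ContMDiffOn (𝓡 2) 𝓘(ℝ, R41) ∞ (a j) U)
    (ha : ∀ p ∈ U, IsLaguerreFrame fun j => a j p) {p : M} (hp : p ∈ U)
    (v : TangentSpace (𝓡 2) p) :
    mPart (connLin a p v) = !![0, conn a 3 1 p v, conn a 3 2 p v, 0;
      conn a 0 1 p v, 0, 0, conn a 3 1 p v; conn a 0 2 p v, 0, 0, conn a 3 2 p v;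
      0, conn a 0 1 p v, conn a 0 2 p v, 0] := by
  have hr := lor_diff_frame hU hs ha hp v
  have h31 := hr 3 1
  have h32 := hr 3 2
  have h01 := hr 0 1
  have h02 := hr 0 2
  ext i j
  fin_cases i <;> fin_cases j <;>
    simp [mPart, connLin_apply (ha p hp), coords, conn, h31, h32, h01, h02]

/-- A commutator of elements of 𝔪 lies in the two-dimensional algebra 𝔨, so two entries decide it:
(0,0) for the boost part and (1,2) for the rotation part. -/
lemma mPart_comm_iff (hU : IsOpen U) (hs : ∀ j, ContMDiffOn (𝓡 2) 𝓘(ℝ, R41) ∞ (a j) U)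
    (ha : ∀ p ∈ U, IsLaguerreFrame fun j => a j p) {p : M} (hp : p ∈ U)
    (v w : TangentSpace (𝓡 2) p) :
    mPart (connLin a p v) * mPart (connLin a p w)
      - mPart (connLin a p w) * mPart (connLin a p v) = 0 ↔ FlatAt a p v w := by
  rw [mPart_connLin hU hs ha hp, mPart_connLin hU hs ha hp]
  unfold FlatAt
  constructor
  · intro h
    have h0 := congrFun (congrFun h 0) 0
    have h1 := congrFun (congrFun h 1) 2
    simp at h0 h1
    constructor <;> linarith
  · rintro ⟨h1, h2⟩
    ext i j
    fin_cases i <;> fin_cases j <;> simp <;> linarith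

/-- A Laguerre framing of `S` that is a curved flat framing, in terms of the components of the
connection form. -/
structure IsFlatFrameOn (U : Set M) (S : M → R41) (a : Fin 4 → M → R41) : Prop where
  smooth_origin : ContMDiffOn (𝓡 2) 𝓘(ℝ, R41) ∞ S U
  smooth_frame : ∀ j, ContMDiffOn (𝓡 2) 𝓘(ℝ, R41) ∞ (a j) U
  frame : ∀ p ∈ U, IsLaguerreFrame fun j => a j p
  lor_fst : ∀ p ∈ U, ∀ v : TangentSpace (𝓡 2) p, lor (diff S p v) (a 0 p) = 0
  lor_lst : ∀ p ∈ U, ∀ v : TangentSpace (𝓡 2) p, lor (diff S p v) (a 3 p) = 0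
  flat : ∀ p ∈ U, ∀ v w : TangentSpace (𝓡 2) p, FlatAt a p v w

lemma isCurvedFlatFramingOn_iff (hU : IsOpen U) :
    IsCurvedFlatFramingOn U S a ↔ IsFlatFrameOn U S a := by
  constructor
  · rintro ⟨h1, h2, h3, h4, h5, h6⟩
    refine ⟨h1, h2, h3, fun p hp v => ?_, fun p hp v => ?_, fun p hp v w => ?_⟩
    -- The indices cross: the component along `a_4` is minus the product with `a_1`, and conversely.
    · have := h5 p hp v
      unfold connTrans at this
      rw [frameMatrix_inv_mulVec (h3 p hp)] at this
      simpa [coords] using this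
    · have := h4 p hp v
      unfold connTrans at this
      rw [frameMatrix_inv_mulVec (h3 p hp)] at this
      simpa [coords] using this
    · exact (mPart_comm_iff hU h2 h3 hp v w).mp (h6 p hp v w)
  · rintro ⟨h1, h2, h3, h4, h5, h6⟩
    refine ⟨h1, h2, h3, fun p hp v => ?_, fun p hp v => ?_, fun p hp v w => ?_⟩
    · unfold connTrans
      rw [frameMatrix_inv_mulVec (h3 p hp)]
      simp [coords, h5 p hp v]
    · unfold connTrans
      rw [frameMatrix_inv_mulVec (h3 p hp)]
      simp [coords, h4 p hp v]
    · exact (mPart_comm_iff hU h2 h3 hp v w).mpr (h6 p hp v w)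

/-- The symmetry that transfers every statement about the first envelope to the second. -/
lemma IsFlatFrameOn.reverse (h : IsFlatFrameOn U S a) :
    IsFlatFrameOn U S fun j => a (Fin.rev j) where
  smooth_origin := h.smooth_origin
  smooth_frame j := h.smooth_frame _
  frame p hp := (h.frame p hp).reverse
  lor_fst := h.lor_lst
  lor_lst := h.lor_fst
  flat p hp v w := by
    obtain ⟨h1, h2⟩ := h.flat p hp v w
    constructor
    · change conn a 3 2 p v * conn a 0 2 p w + conn a 3 1 p v * conn a 0 1 p w
        = conn a 3 2 p w * conn a 0 2 p v + conn a 3 1 p w * conn a 0 1 p v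
      linarith
    · change conn a 3 2 p v * conn a 0 1 p w - conn a 3 1 p v * conn a 0 2 p w
        = conn a 3 2 p w * conn a 0 1 p v - conn a 3 1 p w * conn a 0 2 p v
      linarith

end Connection
end Laguerre

namespace Laguerre

/-! ### Legendre surfaces in Minkowski space -/

/-- Euclidean space as the hyperplane of spheres of radius zero. -/
noncomputable def pointL : R3 →L[ℝ] R41 :=
  LinearMap.toContinuousLinearMap
    { toFun := fun x => orientedSphere x 0
      map_add' := fun x y => by ext i; fin_cases i <;> simp [orientedSphere]
      map_smul' := fun t x => by ext i; fin_cases i <;> simp [orientedSphere] }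

lemma pointL_apply (x : R3) : pointL x = orientedSphere x 0 := rfl

lemma pointL_three (x : R3) : pointL x 3 = 0 := rfl

lemma pointL_injective : Function.Injective pointL := by
  intro x y h
  have h' := congrFun h
  ext i
  fin_cases i
  · exact h' 0
  · exact h' 1
  · exact h' 2

lemma lor_pointL (x y : R3) : lor (pointL x) (pointL y) = x ⬝ᵥ y := by
  simp [pointL_apply, lor, orientedSphere, dotProduct, Fin.sum_univ_three]

lemma lor_pointL_orientedSphere (x n : R3) (t : ℝ) :
    lor (pointL x) (orientedSphere (-n) t) = -(x ⬝ᵥ n) := by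
  simp [pointL_apply, lor, orientedSphere, dotProduct, Fin.sum_univ_three]
  ring

lemma orientedSphere_neg_one (n : R3) : orientedSphere (-n) 1 = orientedSphere 0 1 - pointL n := by
  ext i; fin_cases i <;> simp [orientedSphere, pointL_apply]

lemma orientedSphere_sub_smul (x n : R3) (t : ℝ) :
    orientedSphere (x - t • n) t = pointL x + t • orientedSphere (-n) 1 := by
  ext i; fin_cases i <;> simp [orientedSphere, pointL_apply] <;> ring

lemma nullLine_eq_lineThrough {x n : R3} {y : R41} (h : y ∈ nullLine x n) {t : ℝ} (ht : t ≠ 0) :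
    lineThrough y (t • orientedSphere (-n) 1) = nullLine x n := by
  obtain ⟨r, rfl⟩ := h
  ext z
  simp only [lineThrough, nullLine, Set.mem_ofPred_eq, orientedSphere_sub_smul]
  constructor
  · rintro ⟨s, rfl⟩
    exact ⟨r + s * t, by module⟩
  · rintro ⟨s, rfl⟩
    refine ⟨(s - r) / t, ?_⟩
    rw [smul_smul, div_mul_cancel₀ _ ht]
    module

section Legendre

variable {M : Type*} [TopologicalSpace M] [ChartedSpace (EuclideanSpace ℝ (Fin 2)) M]

/-- The null vector `(-n, 1)` in the direction of the null line of a contact element. -/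
def nullVec (n : M → R3) (p : M) : R41 := orientedSphere (-(n p)) 1

omit [TopologicalSpace M] [ChartedSpace (EuclideanSpace ℝ (Fin 2)) M] in
lemma Envelopes.eq {f n : M → R3} {S : M → R41} (h : Envelopes f n S) (p : M) :
    S p = pointL (f p) + S p 3 • nullVec n p := by
  obtain ⟨t, ht⟩ := h p
  have : S p 3 = t := by rw [ht]; rfl
  rw [this, ht, orientedSphere_sub_smul]; rfl

variable {f n : M → R3} {S : M → R41} {p : M}

omit [TopologicalSpace M] [ChartedSpace (EuclideanSpace ℝ (Fin 2)) M] in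
lemma lor_nullVec_self (hn : n p ⬝ᵥ n p = 1) : lor (nullVec n p) (nullVec n p) = 0 := by
  simp [nullVec, lor, orientedSphere, dotProduct, Fin.sum_univ_three] at hn ⊢
  linarith

lemma diff_nullVec (hn : MDifferentiableAt (𝓡 2) 𝓘(ℝ, R3) n p) (v : TangentSpace (𝓡 2) p) :
    diff (nullVec n) p v = -pointL (diff n p v) := by
  have h0 : nullVec n = fun q => orientedSphere 0 1 + (-pointL) (n q) := by
    funext q
    rw [nullVec, orientedSphere_neg_one, sub_eq_add_neg]; rfl
  have h1 : MDifferentiableAt (𝓡 2) 𝓘(ℝ, R41) (fun q => (-pointL) (n q)) p :=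
    (-pointL).differentiableAt.comp_mdifferentiableAt hn
  rw [h0, diff_add mdifferentiableAt_const h1, diff_const, diff_clm _ hn, zero_add]
  rfl

lemma mdifferentiableAt_nullVec (hn : MDifferentiableAt (𝓡 2) 𝓘(ℝ, R3) n p) :
    MDifferentiableAt (𝓡 2) 𝓘(ℝ, R41) (nullVec n) p := by
  have h0 : nullVec n = fun q => orientedSphere 0 1 + (-pointL) (n q) := by
    funext q
    rw [nullVec, orientedSphere_neg_one, sub_eq_add_neg]; rfl
  rw [h0]
  exact mdifferentiableAt_const.add ((-pointL).differentiableAt.comp_mdifferentiableAt hn)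

lemma contMDiff_nullVec (hn : ContMDiff (𝓡 2) 𝓘(ℝ, R3) ∞ n) :
    ContMDiff (𝓡 2) 𝓘(ℝ, R41) ∞ (nullVec n) := by
  have h0 : nullVec n = fun q => orientedSphere 0 1 + (-pointL) (n q) := by
    funext q
    rw [nullVec, orientedSphere_neg_one, sub_eq_add_neg]; rfl
  rw [h0]
  exact contMDiff_const.add ((-pointL).contDiff.comp_contMDiff hn)

lemma third_eq_lor (hn : MDifferentiableAt (𝓡 2) 𝓘(ℝ, R3) n p) (v w : TangentSpace (𝓡 2) p) :
    third n p v w = lor (diff (nullVec n) p v) (diff (nullVec n) p w) := by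
  rw [diff_nullVec hn, diff_nullVec hn, lor_neg_left, lor_neg_right, neg_neg, lor_pointL]; rfl

lemma lor_diff_nullVec (hn : MDifferentiableAt (𝓡 2) 𝓘(ℝ, R3) n p)
    (h1 : ∀ q, n q ⬝ᵥ n q = 1) (v : TangentSpace (𝓡 2) p) :
    lor (diff (nullVec n) p v) (nullVec n p) = 0 := by
  have h2 := diff_lor (mdifferentiableAt_nullVec hn) (mdifferentiableAt_nullVec hn) v
  have h3 : (fun q => lor (nullVec n q) (nullVec n q)) = fun _ => 0 :=
    funext fun q => lor_nullVec_self (h1 q)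
  rw [h3, diff_const, lor_comm (nullVec n p)] at h2
  linarith

lemma dot_diff_unit (hn : MDifferentiableAt (𝓡 2) 𝓘(ℝ, R3) n p)
    (h1 : ∀ q, n q ⬝ᵥ n q = 1) (v : TangentSpace (𝓡 2) p) : n p ⬝ᵥ diff n p v = 0 := by
  have := lor_diff_nullVec hn h1 v
  rw [diff_nullVec hn, lor_neg_left, nullVec, lor_pointL_orientedSphere, neg_neg] at this
  rw [dotProduct_comm]; exact this

lemma diff_envelope (hf : MDifferentiableAt (𝓡 2) 𝓘(ℝ, R3) f p)
    (hn : MDifferentiableAt (𝓡 2) 𝓘(ℝ, R3) n p) (hS : MDifferentiableAt (𝓡 2) 𝓘(ℝ, R41) S p)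
    (h : Envelopes f n S) (v : TangentSpace (𝓡 2) p) :
    diff S p v = pointL (diff f p v) + (diff S p v : R41) 3 • nullVec n p
      + S p 3 • diff (nullVec n) p v := by
  have h3 : MDifferentiableAt (𝓡 2) 𝓘(ℝ, ℝ) (fun q => S q 3) p :=
    (ContinuousLinearMap.proj (R := ℝ) (φ := fun _ : Fin 4 => ℝ) 3).differentiableAt.comp_mdifferentiableAt hS
  have e3 : diff (fun q => S q 3) p v = (diff S p v : R41) 3 :=
    diff_clm (ContinuousLinearMap.proj (R := ℝ) (φ := fun _ : Fin 4 => ℝ) 3) hS v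
  have e : S = fun q => pointL (f q) + S q 3 • nullVec n q := funext h.eq
  have h4 : MDifferentiableAt (𝓡 2) 𝓘(ℝ, R41) (fun q => pointL (f q)) p :=
    pointL.differentiableAt.comp_mdifferentiableAt hf
  have h5 : MDifferentiableAt (𝓡 2) 𝓘(ℝ, R41) (fun q => S q 3 • nullVec n q) p :=
    h3.smul (mdifferentiableAt_nullVec hn)
  have := diff_add h4 h5 v
  rw [diff_clm _ hf, diff_smul h3 (mdifferentiableAt_nullVec hn), e3] at this
  rw [add_assoc, ← this]
  exact congrArg (fun T => diff T p v) e

/-- The contact condition on `(f, n)` is thus orthogonality of `dS` to the null vector of `n`. -/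
lemma lor_diff_envelope (hf : MDifferentiableAt (𝓡 2) 𝓘(ℝ, R3) f p)
    (hn : MDifferentiableAt (𝓡 2) 𝓘(ℝ, R3) n p) (hS : MDifferentiableAt (𝓡 2) 𝓘(ℝ, R41) S p)
    (h : Envelopes f n S) (h1 : ∀ q, n q ⬝ᵥ n q = 1) (v : TangentSpace (𝓡 2) p) :
    lor (diff S p v) (nullVec n p) = -(diff f p v ⬝ᵥ n p) := by
  rw [diff_envelope hf hn hS h, lor_add_left, lor_add_left, lor_smul_left, lor_smul_left,
    lor_diff_nullVec hn h1, lor_nullVec_self (h1 p), nullVec, lor_pointL_orientedSphere]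
  ring

lemma second_eq_lor (hf : MDifferentiableAt (𝓡 2) 𝓘(ℝ, R3) f p)
    (hn : MDifferentiableAt (𝓡 2) 𝓘(ℝ, R3) n p) (hS : MDifferentiableAt (𝓡 2) 𝓘(ℝ, R41) S p)
    (h : Envelopes f n S) (h1 : ∀ q, n q ⬝ᵥ n q = 1) (v w : TangentSpace (𝓡 2) p) :
    second f n p v w = lor (diff S p v) (diff (nullVec n) p w) - S p 3 * third n p v w := by
  have h2 := lor_diff_nullVec hn h1 w
  rw [lor_comm] at h2
  rw [diff_envelope hf hn hS h, lor_add_left, lor_add_left, lor_smul_left, lor_smul_left, h2,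
    third_eq_lor hn, diff_nullVec hn w, lor_neg_right, lor_pointL, second]
  ring

/-- Replacing `f` by another point of its null line changes the differential only by multiples of
`dN` and `N`, so principality can be read off from any enveloped `S`; a curvature value k becomes r
= S₄ - k. -/
lemma isPrincipal_iff (hf : MDifferentiableAt (𝓡 2) 𝓘(ℝ, R3) f p)
    (hn : MDifferentiableAt (𝓡 2) 𝓘(ℝ, R3) n p) (hS : MDifferentiableAt (𝓡 2) 𝓘(ℝ, R41) S p)
    (h : Envelopes f n S) (v : TangentSpace (𝓡 2) p) :
    IsPrincipal f n p v ↔ v ≠ 0 ∧ ∃ r s : ℝ,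
      diff S p v = (r • diff (nullVec n) p v : R41) + s • nullVec n p := by
  have hd := diff_envelope hf hn hS h v
  unfold IsPrincipal
  refine and_congr_right fun _ => ⟨?_, ?_⟩
  · rintro ⟨k, hk⟩
    refine ⟨S p 3 - k, (diff S p v : R41) 3, ?_⟩
    have e : pointL (diff f p v) = -(k • diff (nullVec n) p v : R41) := by
      rw [hk, diff_nullVec hn]
      simp only [map_smul, smul_neg, neg_neg]
    rw [e] at hd
    rw [sub_smul]
    refine hd.trans ?_
    module
  · rintro ⟨r, s, hrs⟩
    -- The time coordinate isolates `s`: it is 0 on `dN` and 1 on `N`.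
    have hrs3 : (diff S p v : R41) 3 = s := by
      rw [hrs, diff_nullVec hn]
      simp [pointL_three, nullVec, orientedSphere]
    refine ⟨S p 3 - r, ?_⟩
    apply pointL_injective
    rw [hrs3, hrs] at hd
    rw [diff_nullVec hn] at hd
    have hd' : pointL (diff f p v) = (S p 3 - r) • pointL (diff n p v) := by
      have : (pointL (diff f p v) : R41) = r • -pointL (diff n p v) + s • nullVec n p
        - s • nullVec n p - S p 3 • -pointL (diff n p v) := by
        rw [hd]; abel
      rw [this]; module
    rw [hd', map_smul]

/-- Principal directions in terms of the components in a Laguerre frame. -/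
lemma isPrincipal_iff_frame (hf : MDifferentiableAt (𝓡 2) 𝓘(ℝ, R3) f p)
    (hn : MDifferentiableAt (𝓡 2) 𝓘(ℝ, R3) n p) (hS : MDifferentiableAt (𝓡 2) 𝓘(ℝ, R41) S p)
    (h : Envelopes f n S) (h1 : ∀ q, n q ⬝ᵥ n q = 1) {a : Fin 4 → R41} (ha : IsLaguerreFrame a)
    {l : ℝ} (h0 : a 0 = l • nullVec n p) (v : TangentSpace (𝓡 2) p)
    (hSv : lor (diff S p v) (a 0) = 0) :
    IsPrincipal f n p v ↔ v ≠ 0 ∧ ∃ r : ℝ,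
      lor (diff S p v) (a 1) = r * lor (diff (nullVec n) p v) (a 1) ∧
      lor (diff S p v) (a 2) = r * lor (diff (nullVec n) p v) (a 2) := by
  rw [isPrincipal_iff hf hn hS h]
  have hl : l ≠ 0 := by
    rintro rfl
    have := ha.lor03
    rw [h0, zero_smul, lor_zero_left] at this
    norm_num at this
  have hN : nullVec n p = l⁻¹ • a 0 := by rw [h0, smul_smul, inv_mul_cancel₀ hl, one_smul]
  refine and_congr_right fun _ => ⟨?_, ?_⟩
  · rintro ⟨r, s, hrs⟩
    refine ⟨r, ?_, ?_⟩
    · rw [hrs, lor_add_left, lor_smul_left, lor_smul_left, hN, lor_smul_left, ha.lor01]; ring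
    · rw [hrs, lor_add_left, lor_smul_left, lor_smul_left, hN, lor_smul_left, ha.lor02]; ring
  · rintro ⟨r, e1, e2⟩
    have e0 : lor (diff (nullVec n) p v) (a 0) = 0 := by
      rw [h0, lor_smul_right, lor_diff_nullVec hn h1, mul_zero]
    have := ha.eq_smul_of_lor (x := (diff S p v : R41) - r • (diff (nullVec n) p v : R41))
      (by rw [lor_sub_left, lor_smul_left, e0, hSv]; ring)
      (by rw [lor_sub_left, lor_smul_left, e1]; ring)
      (by rw [lor_sub_left, lor_smul_left, e2]; ring)
    refine ⟨r, -lor ((diff S p v : R41) - r • (diff (nullVec n) p v : R41)) (a 3) * l, ?_⟩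
    rw [mul_smul, ← h0, ← this]
    exact (add_sub_cancel _ _).symm

/-- The complex structure in terms of the components in a Laguerre frame. -/
lemma isJ_iff_frame (hn : MDifferentiableAt (𝓡 2) 𝓘(ℝ, R3) n p) (h1 : ∀ q, n q ⬝ᵥ n q = 1)
    {a : Fin 4 → R41} (ha : IsLaguerreFrame a) {l : ℝ} (h0 : a 0 = l • nullVec n p)
    (v w : TangentSpace (𝓡 2) p) :
    IsJ n p v w ↔
      lor (diff (nullVec n) p w) (a 1) = lor (diff (nullVec n) p v) (a 2) ∧
      lor (diff (nullVec n) p w) (a 2) = -lor (diff (nullVec n) p v) (a 1) := by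
  rw [IsJ, ha.turn_iff (h1 p) h0 (dot_diff_unit hn h1 v) (dot_diff_unit hn h1 w),
    diff_nullVec hn, diff_nullVec hn]
  simp only [lor_neg_left, pointL_apply, neg_inj]

end Legendre
end Laguerre

namespace Laguerre

/-! ### Linear algebra of the forms of a curved flat -/

section ComplexForms

variable {T : Type*} [AddCommGroup T] [Module ℝ T] [FiniteDimensional ℝ T]

lemma surjective_of_injective_finrank_two (hT : Module.finrank ℝ T = 2) {φ : T →ₗ[ℝ] ℂ}
    (hφ : Function.Injective φ) : Function.Surjective φ :=
  (LinearMap.injective_iff_surjective_of_finrank_eq_finrank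
    (hT.trans Complex.finrank_real_complex.symm)).mp hφ

open ComplexConjugate in
/-- The normal form of the forms `φ`, `ψ`, `θ` of a curved flat framing. -/
lemma exists_normal_form (hT : Module.finrank ℝ T = 2) {φ ψ θ : T →ₗ[ℝ] ℂ}
    (hφ : Function.Injective φ) (hψ : Function.Injective ψ)
    (flat : ∀ v w, conj (φ v) * ψ w = conj (φ w) * ψ v)
    (symφ : ∀ v w, (θ v * conj (φ w)).re = (θ w * conj (φ v)).re)
    (symψ : ∀ v w, (θ v * conj (ψ w)).re = (θ w * conj (ψ v)).re) :
    ∃ (h : ℂ) (a r : ℝ), h ≠ 0 ∧ (∀ v, ψ v = h * conj (φ v)) ∧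
      ∀ v, θ v = a * φ v + r * h * conj (φ v) := by
  have hs := surjective_of_injective_finrank_two hT hφ
  obtain ⟨e, he⟩ := hs 1
  obtain ⟨e', he'⟩ := hs Complex.I
  have hv : ∀ v, v = (φ v).re • e + (φ v).im • e' := by
    intro v
    apply hφ
    simp only [map_add, map_smul, he, he', Complex.real_smul, mul_one]
    exact (Complex.re_add_im _).symm
  have hψ' : ∀ v, ψ v = ψ e * conj (φ v) := by
    intro v
    have := flat v e
    rw [he, map_one, one_mul] at this
    rw [← this, mul_comm]
  have hh : ψ e ≠ 0 := by
    intro h0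
    have : e = 0 := hψ (by rw [h0, map_zero])
    rw [this, map_zero] at he
    exact zero_ne_one he
  have s1 := symφ e e'
  have s2 := symψ e e'
  have hψe' : ψ e' = -(ψ e * Complex.I) := by
    rw [hψ' e', he', Complex.conj_I, mul_neg]
  rw [he, he'] at s1
  rw [hψe'] at s2
  simp at s1 s2
  set h := ψ e
  set s := θ e
  set t := θ e'
  have hn : Complex.normSq h ≠ 0 := by simpa using hh
  rw [Complex.normSq_apply] at hn
  -- Writing θ = Aφ + B conj φ, the values at `e`, `e'` give A = (s - it)/2 and B = (s + it)/2. The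
  -- two symmetries say that A and B conj h are real, so the witnesses are Re A and Re(B conj
  -- h)/|h|².
  refine ⟨h, (s.re + t.im) / 2,
    ((s.re - t.im) * h.re + (s.im + t.re) * h.im) / (2 * (h.re * h.re + h.im * h.im)), hh, hψ', ?_⟩
  intro v
  conv_lhs => rw [hv v]
  simp only [map_add, map_smul]
  change (φ v).re • s + (φ v).im • t = _
  have k1 : ((s.re - t.im) * h.re + (s.im + t.re) * h.im)
      / (2 * (h.re * h.re + h.im * h.im)) * h.re = (s.re - t.im) / 2 := by
    rw [div_mul_eq_mul_div, div_eq_div_iff (mul_ne_zero two_ne_zero hn) two_ne_zero]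
    linear_combination (-2 * h.im) * s2
  have k2 : ((s.re - t.im) * h.re + (s.im + t.re) * h.im)
      / (2 * (h.re * h.re + h.im * h.im)) * h.im = (s.im + t.re) / 2 := by
    rw [div_mul_eq_mul_div, div_eq_div_iff (mul_ne_zero two_ne_zero hn) two_ne_zero]
    linear_combination (2 * h.re) * s2
  set r := ((s.re - t.im) * h.re + (s.im + t.re) * h.im) / (2 * (h.re * h.re + h.im * h.im))
  apply Complex.ext
  · simp
    linear_combination (-(φ v).re) * k1 - (φ v).im * k2 - ((φ v).im / 2) * s1
  · simp
    linear_combination (-(φ v).re) * k2 + (φ v).im * k1 + ((φ v).re / 2) * s1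

end ComplexForms

/-! ### Holomorphic functions from curved flats -/

section Holomorphy

variable {A : Fin 4 → ℂ → R41} {D : Set ℂ}

lemma fderiv_lor_frame (hD : IsOpen D) (hA : ∀ j, ContDiffOn ℝ ∞ (A j) D)
    (ha : ∀ ζ ∈ D, IsLaguerreFrame fun j => A j ζ) {ζ : ℂ} (hζ : ζ ∈ D) (v : ℂ) (i j : Fin 4) :
    lor (fderiv ℝ (A i) ζ v) (A j ζ) = -lor (fderiv ℝ (A j) ζ v) (A i ζ) := by
  have h1 := fderiv_lor (differentiableAt_of_contDiffOn hD (hA i) hζ)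
    (differentiableAt_of_contDiffOn hD (hA j) hζ) v
  have h2 : (fun q => lor (A i q) (A j q)) =ᶠ[nhds ζ] fun _ => gram i j :=
    Filter.eventuallyEq_of_mem (hD.mem_nhds hζ) fun q hq => (ha q hq).gram_eq i j
  rw [h2.fderiv_eq, fderiv_const_apply, lor_comm (A i ζ)] at h1
  simp at h1
  linarith

/-- The structure equations of a null vector field with conformal differential. -/
lemma twisted_cauchyRiemann (hD : IsOpen D) (hA : ∀ j, ContDiffOn ℝ ∞ (A j) D)
    (ha : ∀ ζ ∈ D, IsLaguerreFrame fun j => A j ζ)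
    (h1 : ∀ ζ ∈ D, lor (fderiv ℝ (A 0) ζ Complex.I) (A 1 ζ) = lor (fderiv ℝ (A 0) ζ 1) (A 2 ζ))
    (h2 : ∀ ζ ∈ D, lor (fderiv ℝ (A 0) ζ Complex.I) (A 2 ζ) = -lor (fderiv ℝ (A 0) ζ 1) (A 1 ζ))
    {ζ : ℂ} (hζ : ζ ∈ D) {s t : ℝ}
    (hs : s = lor (fderiv ℝ (A 1) ζ Complex.I) (A 2 ζ) + lor (fderiv ℝ (A 0) ζ 1) (A 3 ζ))
    (ht : t = lor (fderiv ℝ (A 1) ζ 1) (A 2 ζ) - lor (fderiv ℝ (A 0) ζ Complex.I) (A 3 ζ)) :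
    fderiv ℝ (fun y => lor (fderiv ℝ (A 0) y 1) (A 1 y)) ζ Complex.I
      - fderiv ℝ (fun y => lor (fderiv ℝ (A 0) y 1) (A 2 y)) ζ 1
      = s * lor (fderiv ℝ (A 0) ζ 1) (A 2 ζ) + t * lor (fderiv ℝ (A 0) ζ 1) (A 1 ζ) ∧
    fderiv ℝ (fun y => lor (fderiv ℝ (A 0) y 1) (A 2 y)) ζ Complex.I
      + fderiv ℝ (fun y => lor (fderiv ℝ (A 0) y 1) (A 1 y)) ζ 1
      = -s * lor (fderiv ℝ (A 0) ζ 1) (A 1 ζ) + t * lor (fderiv ℝ (A 0) ζ 1) (A 2 ζ) := by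
  have dA := fun j => differentiableAt_of_contDiffOn hD (hA j) hζ
  have d1 := differentiableAt_of_contDiffOn hD (contDiffOn_fderiv_apply hD (hA 0) 1) hζ
  have dI := differentiableAt_of_contDiffOn hD (contDiffOn_fderiv_apply hD (hA 0) Complex.I) hζ
  -- The type condition φ(i) = -iφ(1) holds on an open set and may therefore be differentiated.
  have e1 : (fun y => lor (fderiv ℝ (A 0) y Complex.I) (A 1 y))
      =ᶠ[nhds ζ] fun y => lor (fderiv ℝ (A 0) y 1) (A 2 y) :=
    Filter.eventuallyEq_of_mem (hD.mem_nhds hζ) h1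
  have e2 : (fun y => lor (fderiv ℝ (A 0) y Complex.I) (A 2 y))
      =ᶠ[nhds ζ] fun y => -lor (fderiv ℝ (A 0) y 1) (A 1 y) :=
    Filter.eventuallyEq_of_mem (hD.mem_nhds hζ) h2
  have f1 := fderiv_lor d1 (dA 1) Complex.I
  have f2 := fderiv_lor dI (dA 1) 1
  have f3 := fderiv_lor d1 (dA 2) Complex.I
  have f4 := fderiv_lor dI (dA 2) 1
  rw [e1.fderiv_eq] at f2
  rw [e2.fderiv_eq, fderiv_fun_neg] at f4
  -- Equality of mixed derivatives matches the second-order terms of `f1`, `f3` with those of `f2`,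
  -- `f4`; their differences are of first order and expand in the frame.
  rw [fderiv_fderiv_comm hD (hA 0) hζ] at f1 f3
  simp only [neg_apply] at f4
  have hf := ha ζ hζ
  have sk := fderiv_lor_frame hD hA ha hζ
  have x1 := hf.lor_eq (fderiv ℝ (A 0) ζ 1) (fderiv ℝ (A 1) ζ Complex.I)
  have x2 := hf.lor_eq (fderiv ℝ (A 0) ζ Complex.I) (fderiv ℝ (A 1) ζ 1)
  have x3 := hf.lor_eq (fderiv ℝ (A 0) ζ 1) (fderiv ℝ (A 2) ζ Complex.I)
  have x4 := hf.lor_eq (fderiv ℝ (A 0) ζ Complex.I) (fderiv ℝ (A 2) ζ 1)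
  have g1 := h1 ζ hζ
  have g2 := h2 ζ hζ
  have z00 : ∀ v, lor (fderiv ℝ (A 0) ζ v) (A 0 ζ) = 0 := fun v => by linarith [sk v 0 0]
  have z11 : ∀ v, lor (fderiv ℝ (A 1) ζ v) (A 1 ζ) = 0 := fun v => by linarith [sk v 1 1]
  have z22 : ∀ v, lor (fderiv ℝ (A 2) ζ v) (A 2 ζ) = 0 := fun v => by linarith [sk v 2 2]
  rw [z00, z11, g1, g2, sk _ 1 0] at x2
  rw [z00, z22, g1, g2, sk _ 2 0, sk _ 2 1] at x4
  rw [z00, z11, sk _ 1 0, g1] at x1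
  rw [z00, z22, sk _ 2 0, sk _ 2 1, g2] at x3
  constructor
  · rw [hs, ht]; linear_combination f1 - f2 + x1 - x2
  · rw [hs, ht]; linear_combination f3 - f4 + x3 - x4

lemma differentiableAt_complex_of_cauchyRiemann {g k : ℂ → ℝ} {ζ : ℂ}
    (hg : DifferentiableAt ℝ g ζ) (hk : DifferentiableAt ℝ k ζ)
    (h1 : fderiv ℝ g ζ Complex.I = -fderiv ℝ k ζ 1)
    (h2 : fderiv ℝ k ζ Complex.I = fderiv ℝ g ζ 1) :
    DifferentiableAt ℂ (fun y => (⟨g y, k y⟩ : ℂ)) ζ := by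
  have e : (fun y => (⟨g y, k y⟩ : ℂ)) = fun y => Complex.ofRealCLM (g y)
      + Complex.I * Complex.ofRealCLM (k y) := by
    funext y
    apply Complex.ext <;> simp
  have hd : HasFDerivAt (fun y => Complex.ofRealCLM (g y) + Complex.I * Complex.ofRealCLM (k y))
      _ ζ := (Complex.ofRealCLM.hasFDerivAt.comp ζ hg.hasFDerivAt).add
        ((Complex.ofRealCLM.hasFDerivAt.comp ζ hk.hasFDerivAt).const_mul Complex.I)
  rw [e, differentiableAt_complex_iff_differentiableAt_real]
  refine ⟨hd.differentiableAt, ?_⟩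
  rw [hd.fderiv]
  apply Complex.ext <;> simp [h1, h2]

/-- The function `conj φ(∂) ψ(∂)` of a curved flat framing over a plane domain is holomorphic. -/
lemma differentiableOn_of_flat (hD : IsOpen D) (hA : ∀ j, ContDiffOn ℝ ∞ (A j) D)
    (ha : ∀ ζ ∈ D, IsLaguerreFrame fun j => A j ζ)
    (h1 : ∀ ζ ∈ D, lor (fderiv ℝ (A 0) ζ Complex.I) (A 1 ζ) = lor (fderiv ℝ (A 0) ζ 1) (A 2 ζ))
    (h2 : ∀ ζ ∈ D, lor (fderiv ℝ (A 0) ζ Complex.I) (A 2 ζ) = -lor (fderiv ℝ (A 0) ζ 1) (A 1 ζ))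
    (h3 : ∀ ζ ∈ D, lor (fderiv ℝ (A 3) ζ Complex.I) (A 1 ζ) = -lor (fderiv ℝ (A 3) ζ 1) (A 2 ζ))
    (h4 : ∀ ζ ∈ D, lor (fderiv ℝ (A 3) ζ Complex.I) (A 2 ζ) = lor (fderiv ℝ (A 3) ζ 1) (A 1 ζ)) :
    DifferentiableOn ℂ (fun ζ =>
      (⟨lor (fderiv ℝ (A 0) ζ 1) (A 1 ζ) * lor (fderiv ℝ (A 3) ζ 1) (A 1 ζ)
        + lor (fderiv ℝ (A 0) ζ 1) (A 2 ζ) * lor (fderiv ℝ (A 3) ζ 1) (A 2 ζ),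
        lor (fderiv ℝ (A 0) ζ 1) (A 1 ζ) * lor (fderiv ℝ (A 3) ζ 1) (A 2 ζ)
        - lor (fderiv ℝ (A 0) ζ 1) (A 2 ζ) * lor (fderiv ℝ (A 3) ζ 1) (A 1 ζ)⟩ : ℂ)) D := by
  intro ζ hζ
  have sm : ∀ i j, DifferentiableAt ℝ (fun y => lor (fderiv ℝ (A i) y 1) (A j y)) ζ := fun i j =>
    differentiableAt_of_contDiffOn hD (ContDiffOn.lor (contDiffOn_fderiv_apply hD (hA i) 1) (hA j)) hζ
  obtain ⟨c1, c2⟩ := twisted_cauchyRiemann hD hA ha h1 h2 hζ rfl rfl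
  -- Reversing the frame exchanges the two screen axes. This conjugation turns the (1,0) condition
  -- on ψ into the (0,1) condition required, which is why `h4` precedes `h3`.
  obtain ⟨c3, c4⟩ := twisted_cauchyRiemann (A := fun j => A (Fin.rev j)) hD (fun j => hA _)
    (fun ζ hζ => (ha ζ hζ).reverse) h4 h3 hζ rfl rfl
  change fderiv ℝ (fun y => lor (fderiv ℝ (A 3) y 1) (A 2 y)) ζ Complex.I
      - fderiv ℝ (fun y => lor (fderiv ℝ (A 3) y 1) (A 1 y)) ζ 1
      = (lor (fderiv ℝ (A 2) ζ Complex.I) (A 1 ζ) + lor (fderiv ℝ (A 3) ζ 1) (A 0 ζ))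
        * lor (fderiv ℝ (A 3) ζ 1) (A 1 ζ) +
        (lor (fderiv ℝ (A 2) ζ 1) (A 1 ζ) - lor (fderiv ℝ (A 3) ζ Complex.I) (A 0 ζ))
        * lor (fderiv ℝ (A 3) ζ 1) (A 2 ζ) at c3
  change fderiv ℝ (fun y => lor (fderiv ℝ (A 3) y 1) (A 1 y)) ζ Complex.I
      + fderiv ℝ (fun y => lor (fderiv ℝ (A 3) y 1) (A 2 y)) ζ 1
      = -(lor (fderiv ℝ (A 2) ζ Complex.I) (A 1 ζ) + lor (fderiv ℝ (A 3) ζ 1) (A 0 ζ))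
        * lor (fderiv ℝ (A 3) ζ 1) (A 2 ζ) +
        (lor (fderiv ℝ (A 2) ζ 1) (A 1 ζ) - lor (fderiv ℝ (A 3) ζ Complex.I) (A 0 ζ))
        * lor (fderiv ℝ (A 3) ζ 1) (A 1 ζ) at c4
  have sk := fderiv_lor_frame hD hA ha hζ
  -- By skewness the twist coefficients for ψ are the negatives of those for φ, so they cancel in
  -- the Cauchy–Riemann equations of the product.
  rw [sk _ 2 1, sk _ 2 1, sk _ 3 0, sk _ 3 0] at c3 c4
  apply DifferentiableAt.differentiableWithinAt
  have m : ∀ i j k l, ∀ v : ℂ, fderiv ℝ (fun y => lor (fderiv ℝ (A i) y 1) (A j y)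
      * lor (fderiv ℝ (A k) y 1) (A l y)) ζ v
      = lor (fderiv ℝ (A i) ζ 1) (A j ζ)
          * fderiv ℝ (fun y => lor (fderiv ℝ (A k) y 1) (A l y)) ζ v
        + lor (fderiv ℝ (A k) ζ 1) (A l ζ)
          * fderiv ℝ (fun y => lor (fderiv ℝ (A i) y 1) (A j y)) ζ v := by
    intro i j k l v
    rw [fderiv_fun_mul (sm i j) (sm k l)]; rfl
  refine differentiableAt_complex_of_cauchyRiemann (((sm 0 1).fun_mul (sm 3 1)).add
    ((sm 0 2).fun_mul (sm 3 2))) (((sm 0 1).fun_mul (sm 3 2)).sub ((sm 0 2).fun_mul (sm 3 1))) ?_ ?_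
  · rw [fderiv_fun_add ((sm 0 1).fun_mul (sm 3 1)) ((sm 0 2).fun_mul (sm 3 2)),
      fderiv_fun_sub ((sm 0 1).fun_mul (sm 3 2)) ((sm 0 2).fun_mul (sm 3 1))]
    simp only [add_apply, sub_apply, m]
    linear_combination lor (fderiv ℝ (A 3) ζ 1) (A 1 ζ) * c1
      + lor (fderiv ℝ (A 3) ζ 1) (A 2 ζ) * c2 + lor (fderiv ℝ (A 0) ζ 1) (A 1 ζ) * c4
      + lor (fderiv ℝ (A 0) ζ 1) (A 2 ζ) * c3
  · rw [fderiv_fun_add ((sm 0 1).fun_mul (sm 3 1)) ((sm 0 2).fun_mul (sm 3 2)),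
      fderiv_fun_sub ((sm 0 1).fun_mul (sm 3 2)) ((sm 0 2).fun_mul (sm 3 1))]
    simp only [add_apply, sub_apply, m]
    linear_combination lor (fderiv ℝ (A 3) ζ 1) (A 2 ζ) * c1
      - lor (fderiv ℝ (A 3) ζ 1) (A 1 ζ) * c2 + lor (fderiv ℝ (A 0) ζ 1) (A 1 ζ) * c3
      - lor (fderiv ℝ (A 0) ζ 1) (A 2 ζ) * c4

end Holomorphy
end Laguerre

namespace Laguerre

/-! ### Holomorphic coordinates from the Gauss map -/

section Stereographic

/-- The numerator of the stereographic projection. -/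
noncomputable def stereoNum (e : ℝ) : R3 →L[ℝ] ℂ :=
  LinearMap.toContinuousLinearMap
    { toFun := fun x => ⟨x 0, -e * x 1⟩
      map_add' := fun x y => by apply Complex.ext <;> simp; ring
      map_smul' := fun t x => by apply Complex.ext <;> simp; ring }

/-- The third coordinate. -/
noncomputable def thirdCoord : R3 →L[ℝ] ℝ := ContinuousLinearMap.proj (R := ℝ) (φ := fun _ : Fin 3 => ℝ) 2

/-- Stereographic projection of the unit sphere from the pole `(0, 0, e)`, `e = ± 1`, composed
with a reflection for `e = 1`. -/
noncomputable def stereo (e : ℝ) (x : R3) : ℂ := (1 - e * x 2)⁻¹ • stereoNum e x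

lemma hasFDerivAt_stereo {e : ℝ} {x : R3} (hx : 1 - e * x 2 ≠ 0) :
    HasFDerivAt (stereo e) ((1 - e * x 2)⁻¹ • stereoNum e
      + ((-((1 - e * x 2) ^ 2)⁻¹) • ((-e) • thirdCoord)).smulRight (stereoNum e x)) x := by
  have h1 : HasFDerivAt (fun y : R3 => 1 - e * y 2) ((-e) • thirdCoord) x := by
    have := ((thirdCoord.hasFDerivAt (x := x)).const_mul e).const_sub 1
    exact this.congr_fderiv (by ext; simp)
  have h2 := (hasDerivAt_inv hx).comp_hasFDerivAt x h1
  exact h2.smul (stereoNum e).hasFDerivAt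

lemma contDiffAt_stereo {e : ℝ} {x : R3} (hx : 1 - e * x 2 ≠ 0) : ContDiffAt ℝ ∞ (stereo e) x := by
  have h1 : ContDiffAt ℝ ∞ (fun y : R3 => 1 - e * y 2) x :=
    contDiffAt_const.sub (contDiffAt_const.mul (thirdCoord.contDiff.contDiffAt))
  exact (h1.inv hx).smul (stereoNum e).contDiff.contDiffAt

/-- Denominators are cleared so that conformality and injectivity become polynomial identities
modulo x·x = 1 and x·X = 0. -/
lemma fderiv_stereo_apply {e : ℝ} {x : R3} (hx : 1 - e * x 2 ≠ 0) (X : R3) :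
    ((1 - e * x 2) ^ 2) • fderiv ℝ (stereo e) x X
      = (1 - e * x 2) • stereoNum e X + (e * X 2) • stereoNum e x := by
  rw [(hasFDerivAt_stereo hx).fderiv]
  have h3 : thirdCoord X = X 2 := rfl
  simp only [add_apply, smul_apply, ContinuousLinearMap.smulRight_apply, h3, smul_add, smul_smul,
    smul_eq_mul]
  congr 2
  · field_simp
  · field_simp

lemma fderiv_stereo_turn {e : ℝ} (he : e = 1 ∨ e = -1) {x : R3} (hx : 1 - e * x 2 ≠ 0)
    (h1 : x ⬝ᵥ x = 1) {X : R3} (hX : x ⬝ᵥ X = 0) :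
    fderiv ℝ (stereo e) x (x ⨯₃ X) = Complex.I * fderiv ℝ (stereo e) x X := by
  have h2 : ((1 - e * x 2) ^ 2) ≠ 0 := pow_ne_zero 2 hx
  apply smul_right_injective ℂ h2
  change (1 - e * x 2) ^ 2 • fderiv ℝ (stereo e) x (x ⨯₃ X)
    = (1 - e * x 2) ^ 2 • (Complex.I * fderiv ℝ (stereo e) x X)
  rw [← mul_smul_comm, fderiv_stereo_apply hx, fderiv_stereo_apply hx]
  have hnum : ∀ y, stereoNum e y = ⟨y 0, -e * y 1⟩ := fun y => rfl
  simp only [dotProduct, Fin.sum_univ_three] at h1 hX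
  rcases he with rfl | rfl
  · apply Complex.ext
    · simp [hnum, cross_apply]
      linear_combination X 1 * h1 - x 1 * hX
    · simp [hnum, cross_apply]
      linear_combination X 0 * h1 - x 0 * hX
  · apply Complex.ext
    · simp [hnum, cross_apply]
      linear_combination -X 1 * h1 + x 1 * hX
    · simp [hnum, cross_apply]
      linear_combination X 0 * h1 - x 0 * hX

lemma fderiv_stereo_ne_zero {e : ℝ} (he : e = 1 ∨ e = -1) {x : R3} (hx : 1 - e * x 2 ≠ 0)
    (h1 : x ⬝ᵥ x = 1) {X : R3} (hX : x ⬝ᵥ X = 0) (hX0 : X ≠ 0) :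
    fderiv ℝ (stereo e) x X ≠ 0 := by
  intro h0
  have h2 := fderiv_stereo_apply hx X
  rw [h0, smul_zero] at h2
  have hnum : ∀ y, stereoNum e y = ⟨y 0, -e * y 1⟩ := fun y => rfl
  have hr := congrArg Complex.re h2
  have hi := congrArg Complex.im h2
  simp [hnum] at hr hi
  simp only [dotProduct, Fin.sum_univ_three] at h1 hX
  apply hX0
  have he2 : e * e = 1 := by rcases he with rfl | rfl <;> norm_num
  have k2 : X 2 = 0 := by
    have : (1 - e * x 2) * X 2 = 0 := by
      rcases he with rfl | rfl
      · linear_combination -x 0 * hr + x 1 * hi - (1 - 1 * x 2) * hX - X 2 * h1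
      · linear_combination x 0 * hr + x 1 * hi + (1 - (-1) * x 2) * hX - X 2 * h1
    exact (mul_eq_zero.mp this).resolve_left hx
  rw [k2] at hr hi
  have k0 : X 0 = 0 := by
    have : (1 - e * x 2) * X 0 = 0 := by linear_combination -hr
    exact (mul_eq_zero.mp this).resolve_left hx
  have k1 : X 1 = 0 := by
    have : (1 - e * x 2) * X 1 = 0 := by linear_combination e * hi - (1 - e * x 2) * X 1 * he2
    exact (mul_eq_zero.mp this).resolve_left hx
  ext i
  fin_cases i
  · exact k0
  · exact k1
  · exact k2

variable {M : Type*} [TopologicalSpace M] [ChartedSpace (EuclideanSpace ℝ (Fin 2)) M]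

lemma IsParam.restrict {F : Type*} [NormedAddCommGroup F] [NormedSpace ℝ F] {Φ : F → M} {χ : M → F}
    {Ω : Set F} {U : Set M} (h : IsParam Φ χ Ω U) {U' : Set M} (hU' : IsOpen U') :
    IsParam Φ χ (Ω ∩ Φ ⁻¹' U') (U ∩ U') where
  isOpen_dom := h.smooth.continuousOn.isOpen_inter_preimage h.isOpen_dom hU'
  isOpen_ran := h.isOpen_ran.inter hU'
  mapsTo x hx := ⟨h.mapsTo x hx.1, hx.2⟩
  mapsTo_inv p hp := ⟨h.mapsTo_inv p hp.1, by
    rw [Set.mem_preimage, h.right_inv p hp.1]; exact hp.2⟩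
  left_inv x hx := h.left_inv x hx.1
  right_inv p hp := h.right_inv p hp.1
  smooth := h.smooth.mono Set.inter_subset_left
  smooth_inv := h.smooth_inv.mono Set.inter_subset_left

/-- The Gauss map of a Legendre immersion gives local holomorphic coordinates. -/
lemma exists_holomorphic_param [IsManifold (𝓡 2) ∞ M] {n : M → R3}
    (hn : ContMDiff (𝓡 2) 𝓘(ℝ, R3) ∞ n) (h1 : ∀ p, n p ⬝ᵥ n p = 1)
    (h3 : ∀ p, ∀ v : TangentSpace (𝓡 2) p, v ≠ 0 → diff n p v ≠ 0) (p₀ : M) :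
    ∃ (Ψ : ℂ → M) (z : M → ℂ) (D : Set ℂ) (U : Set M), IsParam Ψ z D U ∧ p₀ ∈ U ∧
      ∀ p ∈ U, ∀ v w : TangentSpace (𝓡 2) p, IsJ n p v w →
        diff z p w = Complex.I * diff z p v := by
  -- Project from a pole different from `n p₀`.
  obtain ⟨e, he, hp₀⟩ : ∃ e : ℝ, (e = 1 ∨ e = -1) ∧ 1 - e * n p₀ 2 ≠ 0 := by
    by_cases h : n p₀ 2 = 1
    · exact ⟨-1, Or.inr rfl, by rw [h]; norm_num⟩
    · exact ⟨1, Or.inl rfl, fun h' => h (by linarith)⟩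
  obtain ⟨Φ, χ, Ω, U, hΦ, hpU⟩ := exists_isParam p₀
  have hnd : ∀ p, MDifferentiableAt (𝓡 2) 𝓘(ℝ, R3) n p := fun p => hn.mdifferentiableAt (by simp)
  have hopen : IsOpen {p | 1 - e * n p 2 ≠ 0} := by
    have hc : Continuous fun p => 1 - e * n p 2 :=
      continuous_const.sub (continuous_const.mul ((continuous_apply 2).comp hn.continuous))
    exact isOpen_ne_fun hc continuous_const
  have hR := hΦ.restrict hopen
  set Ω' := Ω ∩ Φ ⁻¹' {p | 1 - e * n p 2 ≠ 0}
  set U' := U ∩ {p | 1 - e * n p 2 ≠ 0} with hU'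
  have hcomp : ContDiffOn ℝ ∞ (fun x => n (Φ x)) Ω' :=
    hR.contDiffOn_comp hn.contMDiffOn (Set.subset_univ _)
  have hden : ∀ x ∈ Ω', 1 - e * n (Φ x) 2 ≠ 0 := fun x hx => hx.2
  have hζ : ContDiffOn ℝ ∞ (fun x => stereo e (n (Φ x))) Ω' := fun x hx =>
    ContDiffAt.comp_contDiffWithinAt (g := stereo e) x (contDiffAt_stereo (hden x hx)) (hcomp x hx)
  have hdz : ∀ x ∈ Ω', ∀ w, fderiv ℝ (fun x => stereo e (n (Φ x))) x w
      = fderiv ℝ (stereo e) (n (Φ x)) (diff n (Φ x) (paramDiff Φ x w)) := by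
    intro x hx w
    rw [← hR.fderiv_comp hx (hnd _)]
    have := fderiv_comp x ((contDiffAt_stereo (hden x hx)).differentiableAt (by simp))
      (differentiableAt_of_contDiffOn hR.isOpen_dom hcomp hx)
    exact congrArg (fun L => L w) this
  -- The inverse function theorem applies: `dn` is injective, stereographic projection is injective
  -- on tangent vectors of the sphere, and both sides have real dimension two.
  have hinv : ∀ x ∈ Ω', ∃ L : EuclideanSpace ℝ (Fin 2) ≃L[ℝ] ℂ,
      fderiv ℝ (fun x => stereo e (n (Φ x))) x = L := by
    intro x hx
    have hinj : Function.Injective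
        (fderiv ℝ (fun x => stereo e (n (Φ x))) x : EuclideanSpace ℝ (Fin 2) →ₗ[ℝ] ℂ) := by
      rw [injective_iff_map_eq_zero]
      intro w hw
      by_contra hw0
      have hpw : paramDiff Φ x w ≠ 0 := fun h0 =>
        hw0 (hR.paramDiff_injective hx (by rw [h0, map_zero]))
      refine fderiv_stereo_ne_zero he (hden x hx) (h1 _) (dot_diff_unit (hnd _) h1 _)
        (h3 _ _ hpw) ?_
      rw [← hdz x hx]
      exact hw
    have hfin : Module.finrank ℝ (EuclideanSpace ℝ (Fin 2)) = Module.finrank ℝ ℂ := by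
      rw [Complex.finrank_real_complex]; simp
    refine ⟨(LinearEquiv.ofInjectiveOfFinrankEq _ hinj hfin).toContinuousLinearEquiv, ?_⟩
    ext w
    rfl
  have hx₀ : χ p₀ ∈ Ω' := hR.mapsTo_inv p₀ ⟨hpU, hp₀⟩
  obtain ⟨Ψ, D, V, hΨ, hV, hVU⟩ := hR.change hζ hx₀ hinv
  rw [hR.right_inv p₀ ⟨hpU, hp₀⟩] at hV
  refine ⟨Ψ, _, D, V, hΨ, hV, ?_⟩
  intro p hp v w hJ
  have hev : (fun q => stereo e (n (Φ (χ q)))) =ᶠ[nhds p] fun q => stereo e (n q) :=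
    Filter.eventuallyEq_of_mem (hΨ.isOpen_ran.mem_nhds hp) fun q hq => by
      simp only [hR.right_inv q (hVU hq)]
  have hdp : 1 - e * n p 2 ≠ 0 := (hVU hp).2
  have hds : DifferentiableAt ℝ (stereo e) (n p) := (hasFDerivAt_stereo hdp).differentiableAt
  rw [diff_congr hev, diff_congr hev, diff_comp hds (hnd p), diff_comp hds (hnd p)]
  rw [IsJ] at hJ
  rw [hJ]
  exact fderiv_stereo_turn he hdp (h1 p) (dot_diff_unit (hnd p) h1 v)

end Stereographic
end Laguerre

namespace Laguerre

/-! ### The envelopes of a curved flat -/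

section Envelope

variable {M : Type*} [TopologicalSpace M] [ChartedSpace (EuclideanSpace ℝ (Fin 2)) M]

/-- The unit normal determined by a field of future directed null vectors. -/
noncomputable def legN (b : M → R41) (p : M) : R3 := fun i => -(b p 3)⁻¹ * b p i.castSucc

/-- The point on the null line `[S, b]` that represents a sphere of radius zero. -/
noncomputable def legF (S b : M → R41) (p : M) : R3 := fun i => S p i.castSucc + S p 3 * legN b p i

variable {S b : M → R41}

omit [TopologicalSpace M] [ChartedSpace (EuclideanSpace ℝ (Fin 2)) M] in
lemma nullVec_legN (hb : ∀ p, 0 < b p 3) (p : M) : nullVec (legN b) p = (b p 3)⁻¹ • b p := by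
  ext i
  have := (hb p).ne'
  fin_cases i <;> simp [nullVec, legN, orientedSphere]
  field_simp

omit [TopologicalSpace M] [ChartedSpace (EuclideanSpace ℝ (Fin 2)) M] in
lemma smul_nullVec_legN (hb : ∀ p, 0 < b p 3) (p : M) :
    b p = b p 3 • nullVec (legN b) p := by
  rw [nullVec_legN hb, smul_smul, mul_inv_cancel₀ (hb p).ne', one_smul]

omit [TopologicalSpace M] [ChartedSpace (EuclideanSpace ℝ (Fin 2)) M] in
lemma legN_unit (hb : ∀ p, 0 < b p 3) (h0 : ∀ p, lor (b p) (b p) = 0) (p : M) :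
    legN b p ⬝ᵥ legN b p = 1 := by
  have h1 := h0 p
  have h2 := (hb p).ne'
  simp only [lor] at h1
  simp [legN, dotProduct, Fin.sum_univ_three]
  field_simp
  linarith

omit [TopologicalSpace M] [ChartedSpace (EuclideanSpace ℝ (Fin 2)) M] in
lemma envelopes_leg : Envelopes (legF S b) (legN b) S := by
  intro p
  refine ⟨S p 3, ?_⟩
  ext i
  fin_cases i <;> simp [orientedSphere, legF]

omit [TopologicalSpace M] [ChartedSpace (EuclideanSpace ℝ (Fin 2)) M] in
lemma nullLine_leg (hb : ∀ p, 0 < b p 3) (p : M) :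
    nullLine (legF S b p) (legN b p) = lineThrough (S p) (b p) := by
  rw [smul_nullVec_legN hb p]
  exact (nullLine_eq_lineThrough (envelopes_leg p) (hb p).ne').symm

lemma contMDiff_legN (hb : ∀ p, 0 < b p 3) (hs : ContMDiff (𝓡 2) 𝓘(ℝ, R41) ∞ b) :
    ContMDiff (𝓡 2) 𝓘(ℝ, R3) ∞ (legN b) := by
  rw [contMDiff_pi_space] at hs ⊢
  exact fun i => ((hs 3).inv₀ fun p => (hb p).ne').neg.mul (hs _)

lemma contMDiff_legF (hb : ∀ p, 0 < b p 3) (hs : ContMDiff (𝓡 2) 𝓘(ℝ, R41) ∞ b)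
    (hS : ContMDiff (𝓡 2) 𝓘(ℝ, R41) ∞ S) : ContMDiff (𝓡 2) 𝓘(ℝ, R3) ∞ (legF S b) := by
  have hN := contMDiff_legN hb hs
  rw [contMDiff_pi_space] at hN hS ⊢
  exact fun i => (hS _).add ((hS 3).mul (hN i))

lemma lor_diff_nullVec_legN (hb : ∀ p, 0 < b p 3) (hs : ContMDiff (𝓡 2) 𝓘(ℝ, R41) ∞ b) {p : M}
    {y : R41} (hy : lor (b p) y = 0) (v : TangentSpace (𝓡 2) p) :
    lor (diff (nullVec (legN b)) p v) y = (b p 3)⁻¹ * lor (diff b p v) y := by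
  have e : nullVec (legN b) = fun q => (b q 3)⁻¹ • b q := funext (nullVec_legN hb)
  have hs' := contMDiff_pi_space.mp hs
  have hd : MDifferentiableAt (𝓡 2) 𝓘(ℝ, ℝ) (fun q => (b q 3)⁻¹) p :=
    ((hs' 3).inv₀ fun p => (hb p).ne').mdifferentiableAt (by simp)
  rw [e, diff_smul hd (hs.mdifferentiableAt (by simp)), lor_add_left, lor_smul_left, lor_smul_left,
    hy, mul_zero, zero_add]

/-- The second derivatives of a map are symmetric with respect to a normal vector field. -/
lemma lor_diff_symm [IsManifold (𝓡 2) ∞ M] (hS : ContMDiff (𝓡 2) 𝓘(ℝ, R41) ∞ S)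
    (hs : ContMDiff (𝓡 2) 𝓘(ℝ, R41) ∞ b)
    (h : ∀ p, ∀ v : TangentSpace (𝓡 2) p, lor (diff S p v) (b p) = 0) (p : M)
    (v w : TangentSpace (𝓡 2) p) :
    lor (diff S p v) (diff b p w) = lor (diff S p w) (diff b p v) := by
  obtain ⟨Φ, χ, Ω, U, hΦ, hpU⟩ := exists_isParam p
  obtain ⟨x, hx, rfl⟩ : ∃ x ∈ Ω, Φ x = p := ⟨χ p, hΦ.mapsTo_inv p hpU, hΦ.right_inv p hpU⟩
  have hF := hΦ.contDiffOn_comp hS.contMDiffOn (Set.subset_univ _)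
  have hG := hΦ.contDiffOn_comp hs.contMDiffOn (Set.subset_univ _)
  -- Differentiating the orthogonality relation once more produces the second derivatives of S,
  -- whose symmetry gives the claim.
  have key : ∀ v' w', fderiv ℝ (fun y => lor (fderiv ℝ (fun y => S (Φ y)) y v') (b (Φ y))) x w'
      = 0 := by
    intro v' w'
    have : (fun y => lor (fderiv ℝ (fun y => S (Φ y)) y v') (b (Φ y))) =ᶠ[nhds x] fun _ => 0 :=
      Filter.eventuallyEq_of_mem (hΦ.isOpen_dom.mem_nhds hx) fun y hy => by
        rw [hΦ.fderiv_comp hy (hS.mdifferentiableAt (by simp))]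
        exact h _ _
    rw [this.fderiv_eq]; simp
  obtain ⟨v', rfl⟩ := hΦ.paramDiff_surjective hx v
  obtain ⟨w', rfl⟩ := hΦ.paramDiff_surjective hx w
  have dG := differentiableAt_of_contDiffOn hΦ.isOpen_dom hG hx
  have dF := fun u => differentiableAt_of_contDiffOn hΦ.isOpen_dom
    (contDiffOn_fderiv_apply hΦ.isOpen_dom hF u) hx
  have k1 := key v' w'
  have k2 := key w' v'
  rw [fderiv_lor (dF _) dG] at k1 k2
  rw [fderiv_fderiv_comm hΦ.isOpen_dom hF hx] at k1
  rw [hΦ.fderiv_comp hx (hS.mdifferentiableAt (by simp)),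
    hΦ.fderiv_comp hx (hs.mdifferentiableAt (by simp))] at k1 k2
  linarith

end Envelope

/-! ### The complex forms φ, ψ, θ of a curved flat and the fundamental forms of its envelope -/

section CurvedFlat

open ComplexConjugate

/-- The components of a vector in the screen plane `span {a_2, a_3}`. -/
noncomputable def screen (a : Fin 4 → R41) : R41 →ₗ[ℝ] ℂ where
  toFun x := ⟨lor x (a 1), lor x (a 2)⟩
  map_add' x y := by apply Complex.ext <;> simp [lor_add_left]
  map_smul' t x := by apply Complex.ext <;> simp [lor_smul_left]

lemma IsLaguerreFrame.lor_eq_screen {a : Fin 4 → R41} (ha : IsLaguerreFrame a) {x y : R41}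
    (h : lor x (a 0) * lor y (a 3) + lor x (a 3) * lor y (a 0) = 0) :
    lor x y = (screen a x * conj (screen a y)).re := by
  rw [ha.lor_eq x y]
  simp [screen]
  linarith

variable {M : Type*} [TopologicalSpace M] [ChartedSpace (EuclideanSpace ℝ (Fin 2)) M]
  {S : M → R41} {a : Fin 4 → M → R41}

/-- The components of the differential of `b` in the screen plane. -/
noncomputable def formC (a : Fin 4 → M → R41) (b : M → R41) (p : M) :
    TangentSpace (𝓡 2) p →ₗ[ℝ] ℂ :=
  (screen fun j => a j p).comp (diff b p : TangentSpace (𝓡 2) p →ₗ[ℝ] R41)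

lemma formC_apply (b : M → R41) (p : M) (v : TangentSpace (𝓡 2) p) :
    formC a b p v = ⟨lor (diff b p v) (a 1 p), lor (diff b p v) (a 2 p)⟩ := rfl

lemma finrank_tangentSpace (p : M) : Module.finrank ℝ (TangentSpace (𝓡 2) p) = 2 :=
  finrank_euclideanSpace_fin

instance (p : M) : FiniteDimensional ℝ (TangentSpace (𝓡 2) p) :=
  inferInstanceAs (FiniteDimensional ℝ (EuclideanSpace ℝ (Fin 2)))

namespace IsFlatFrameOn

variable (h : IsFlatFrameOn Set.univ S a)
include h

lemma contMDiff_origin : ContMDiff (𝓡 2) 𝓘(ℝ, R41) ∞ S := contMDiffOn_univ.mp h.smooth_origin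

lemma contMDiff_frame (j : Fin 4) : ContMDiff (𝓡 2) 𝓘(ℝ, R41) ∞ (a j) :=
  contMDiffOn_univ.mp (h.smooth_frame j)

lemma isFrame (p : M) : IsLaguerreFrame fun j => a j p := h.frame p trivial

lemma lor_diff_self (p : M) (v : TangentSpace (𝓡 2) p) (i : Fin 4) :
    lor (diff (a i) p v) (a i p) = 0 := by
  have := lor_diff_frame isOpen_univ h.smooth_frame h.frame (p := p) trivial v i i
  linarith

/-- The two equations of `FlatAt` are the real and imaginary parts of conj φ ∧ ψ = 0. -/
lemma formC_flat (p : M) (v w : TangentSpace (𝓡 2) p) :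
    conj (formC a (a 0) p v) * formC a (a 3) p w = conj (formC a (a 0) p w) * formC a (a 3) p v := by
  obtain ⟨h1, h2⟩ := h.flat p trivial v w
  simp only [conn] at h1 h2
  apply Complex.ext
  · simp [formC_apply]; linarith
  · simp [formC_apply]; linarith

/-- On the kernel of φ the vector `da_1` is orthogonal to `a_1`, `a_2`, `a_3`, hence a multiple of
`a_1`; the null direction would then be stationary. -/
lemma formC_fst_injective (h0 : IsImmersedDirection (a 0)) (p : M) :
    Function.Injective (formC a (a 0) p) := by
  rw [injective_iff_map_eq_zero]
  intro v hv
  by_contra hv0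
  rw [formC_apply] at hv
  refine h0 p v hv0 _ ((h.isFrame p).eq_smul_of_lor (h.lor_diff_self p v 0) ?_ ?_)
  · simpa using congrArg Complex.re hv
  · simpa using congrArg Complex.im hv

lemma formC_lst_injective (h3 : IsImmersedDirection (a 3)) (p : M) :
    Function.Injective (formC a (a 3) p) := by
  have hi := h.reverse.formC_fst_injective h3 p
  rw [injective_iff_map_eq_zero] at hi ⊢
  intro v hv
  apply hi v
  rw [formC_apply] at hv ⊢
  apply Complex.ext
  · simpa using congrArg Complex.im hv
  · simpa using congrArg Complex.re hv

lemma normal_form [IsManifold (𝓡 2) ∞ M] (h0 : IsImmersedDirection (a 0))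
    (h3 : IsImmersedDirection (a 3)) (p : M) :
    ∃ (k : ℂ) (s r : ℝ), k ≠ 0 ∧
      (∀ v, formC a (a 3) p v = k * conj (formC a (a 0) p v)) ∧
      ∀ v, formC a S p v = s * formC a (a 0) p v + r * k * conj (formC a (a 0) p v) := by
  have sym : ∀ i, (∀ p, ∀ v : TangentSpace (𝓡 2) p, lor (diff S p v) (a i p) = 0) →
      ∀ v w, (formC a S p v * conj (formC a (a i) p w)).re
        = (formC a S p w * conj (formC a (a i) p v)).re := by
    intro i hi v w
    have e := lor_diff_symm h.contMDiff_origin (h.contMDiff_frame i) hi p v w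
    have z : ∀ v w : TangentSpace (𝓡 2) p, lor (diff S p v) (a 0 p) * lor (diff (a i) p w) (a 3 p)
        + lor (diff S p v) (a 3 p) * lor (diff (a i) p w) (a 0 p) = 0 := fun v w => by
      rw [h.lor_fst p trivial, h.lor_lst p trivial]; ring
    rw [(h.isFrame p).lor_eq_screen (z v w), (h.isFrame p).lor_eq_screen (z w v)] at e
    exact e
  exact exists_normal_form (finrank_tangentSpace p) (h.formC_fst_injective h0 p)
    (h.formC_lst_injective h3 p) (h.formC_flat p) (sym 0 fun p => h.lor_fst p trivial)
    (sym 3 fun p => h.lor_lst p trivial)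

lemma fst_pos (p : M) : 0 < a 0 p 3 := (h.isFrame p).fst_pos

lemma lor_fst_self (p : M) : lor (a 0 p) (a 0 p) = 0 := (h.isFrame p).lor00

lemma mdifferentiableAt_legN (p : M) : MDifferentiableAt (𝓡 2) 𝓘(ℝ, R3) (legN (a 0)) p :=
  (contMDiff_legN h.fst_pos (h.contMDiff_frame 0)).mdifferentiableAt (by simp)

lemma mdifferentiableAt_legF (p : M) : MDifferentiableAt (𝓡 2) 𝓘(ℝ, R3) (legF S (a 0)) p :=
  (contMDiff_legF h.fst_pos (h.contMDiff_frame 0) h.contMDiff_origin).mdifferentiableAt (by simp)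

lemma mdifferentiableAt_origin (p : M) : MDifferentiableAt (𝓡 2) 𝓘(ℝ, R41) S p :=
  h.contMDiff_origin.mdifferentiableAt (by simp)

lemma unit_legN (p : M) : legN (a 0) p ⬝ᵥ legN (a 0) p = 1 := legN_unit h.fst_pos h.lor_fst_self p

/-- The differential of the normal in the screen plane. -/
lemma screen_nullVec (p : M) (v : TangentSpace (𝓡 2) p) :
    screen (fun j => a j p) (diff (nullVec (legN (a 0))) p v)
      = ((a 0 p 3)⁻¹ : ℝ) * formC a (a 0) p v := by
  have e1 := lor_diff_nullVec_legN h.fst_pos (h.contMDiff_frame 0) (h.isFrame p).lor01 v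
  have e2 := lor_diff_nullVec_legN h.fst_pos (h.contMDiff_frame 0) (h.isFrame p).lor02 v
  apply Complex.ext
  · simpa [screen, formC_apply] using e1
  · simpa [screen, formC_apply] using e2

lemma lor_nullVec_fst (p : M) (v : TangentSpace (𝓡 2) p) :
    lor (diff (nullVec (legN (a 0))) p v) (a 0 p) = 0 := by
  rw [smul_nullVec_legN h.fst_pos p, lor_smul_right,
    lor_diff_nullVec (h.mdifferentiableAt_legN p) h.unit_legN, mul_zero]

lemma third_eq (p : M) (v w : TangentSpace (𝓡 2) p) :
    third (legN (a 0)) p v w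
      = ((a 0 p 3)⁻¹) ^ 2 * (formC a (a 0) p v * conj (formC a (a 0) p w)).re := by
  rw [third_eq_lor (h.mdifferentiableAt_legN p),
    (h.isFrame p).lor_eq_screen (by rw [h.lor_nullVec_fst, h.lor_nullVec_fst]; ring),
    h.screen_nullVec, h.screen_nullVec]
  simp [Complex.mul_re, Complex.mul_im]
  ring

lemma second_eq (p : M) (v w : TangentSpace (𝓡 2) p) :
    second (legF S (a 0)) (legN (a 0)) p v w
      = (a 0 p 3)⁻¹ * (formC a S p v * conj (formC a (a 0) p w)).re
        - S p 3 * third (legN (a 0)) p v w := by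
  have e := (h.isFrame p).lor_eq_screen (x := diff S p v) (y := diff (nullVec (legN (a 0))) p w)
    (by rw [h.lor_fst p trivial, h.lor_lst p trivial]; ring)
  rw [second_eq_lor (h.mdifferentiableAt_legF p) (h.mdifferentiableAt_legN p)
    (h.mdifferentiableAt_origin p) envelopes_leg h.unit_legN, e, h.screen_nullVec]
  change (formC a S p v * _).re - _ = _
  simp [Complex.mul_re, Complex.mul_im]
  ring

/-- Hence φ has type (0,1), while conj φ, and with it ψ = k conj φ, has type (1,0). -/
lemma isJ_iff (p : M) (v w : TangentSpace (𝓡 2) p) :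
    IsJ (legN (a 0)) p v w ↔ formC a (a 0) p w = -Complex.I * formC a (a 0) p v := by
  have hl : (a 0 p 3)⁻¹ ≠ 0 := inv_ne_zero (h.fst_pos p).ne'
  have e1 := fun v => lor_diff_nullVec_legN h.fst_pos (h.contMDiff_frame 0) (h.isFrame p).lor01 v
  have e2 := fun v => lor_diff_nullVec_legN h.fst_pos (h.contMDiff_frame 0) (h.isFrame p).lor02 v
  rw [isJ_iff_frame (h.mdifferentiableAt_legN p) h.unit_legN (h.isFrame p)
    (smul_nullVec_legN h.fst_pos p), e1, e1, e2, e2, mul_right_inj' hl, ← mul_neg,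
    mul_right_inj' hl]
  constructor
  · rintro ⟨k1, k2⟩
    apply Complex.ext
    · simpa [formC_apply] using k1
    · simpa [formC_apply] using k2
  · intro k
    have k1 := congrArg Complex.re k
    have k2 := congrArg Complex.im k
    simp [formC_apply] at k1 k2
    exact ⟨k1, k2⟩

lemma isPrincipal_of_real (p : M) {v : TangentSpace (𝓡 2) p} (hv : v ≠ 0) {r : ℝ}
    (hr : formC a S p v = r * formC a (a 0) p v) :
    IsPrincipal (legF S (a 0)) (legN (a 0)) p v := by
  have e1 := lor_diff_nullVec_legN h.fst_pos (h.contMDiff_frame 0) (h.isFrame p).lor01 v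
  have e2 := lor_diff_nullVec_legN h.fst_pos (h.contMDiff_frame 0) (h.isFrame p).lor02 v
  have hl := (h.fst_pos p).ne'
  rw [isPrincipal_iff_frame (h.mdifferentiableAt_legF p) (h.mdifferentiableAt_legN p)
    (h.mdifferentiableAt_origin p) envelopes_leg h.unit_legN (h.isFrame p)
    (smul_nullVec_legN h.fst_pos p) v (h.lor_fst p trivial v)]
  refine ⟨hv, r * a 0 p 3, ?_, ?_⟩
  · rw [e1]
    have := congrArg Complex.re hr
    simp [formC_apply] at this
    rw [this]; field_simp
  · rw [e2]
    have := congrArg Complex.im hr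
    simp [formC_apply] at this
    rw [this]; field_simp

lemma isLegendre (h0 : IsImmersedDirection (a 0)) :
    IsLegendreImmersion (legF S (a 0)) (legN (a 0)) where
  smooth_f := contMDiff_legF h.fst_pos (h.contMDiff_frame 0) h.contMDiff_origin
  smooth_n := contMDiff_legN h.fst_pos (h.contMDiff_frame 0)
  unit := h.unit_legN
  contact p v := by
    have e := lor_diff_envelope (h.mdifferentiableAt_legF p) (h.mdifferentiableAt_legN p)
      (h.mdifferentiableAt_origin p) envelopes_leg h.unit_legN v
    rw [nullVec_legN h.fst_pos, lor_smul_right, h.lor_fst p trivial, mul_zero] at e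
    linarith
  third_pos p v hv := by
    change 0 < third (legN (a 0)) p v v
    rw [h.third_eq, Complex.mul_conj, Complex.ofReal_re]
    have : formC a (a 0) p v ≠ 0 := fun hz =>
      hv (h.formC_fst_injective h0 p (by rw [hz, map_zero]))
    have := Complex.normSq_pos.mpr this
    have := h.fst_pos p
    positivity

end IsFlatFrameOn
end CurvedFlat
end Laguerre

namespace Laguerre

/-! ### The holomorphic differential conj φ · ψ, and the Darboux property -/

section Isothermic

open ComplexConjugate

variable {M : Type*} [TopologicalSpace M] [ChartedSpace (EuclideanSpace ℝ (Fin 2)) M]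
  [IsManifold (𝓡 2) ∞ M] {S : M → R41} {a : Fin 4 → M → R41}

namespace IsFlatFrameOn

variable (h : IsFlatFrameOn Set.univ S a)
include h

omit [IsManifold (𝓡 2) ∞ M] in
lemma diff_legN_ne_zero (h0 : IsImmersedDirection (a 0)) (p : M) (v : TangentSpace (𝓡 2) p)
    (hv : v ≠ 0) : diff (legN (a 0)) p v ≠ 0 := by
  intro hz
  have := (h.isLegendre h0).third_pos p v hv
  rw [hz] at this
  simp at this

/-- Holomorphic coordinates adapted to the first envelope, in which the forms of the curved flat
framing are of type `(1, 0)`. -/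
lemma exists_adapted_param (h0 : IsImmersedDirection (a 0)) (p₀ : M) :
    ∃ (Ψ : ℂ → M) (z : M → ℂ) (D : Set ℂ) (U : Set M), IsParam Ψ z D U ∧ p₀ ∈ U ∧
      (∀ p ∈ U, ∀ v w : TangentSpace (𝓡 2) p, IsJ (legN (a 0)) p v w →
        diff z p w = Complex.I * diff z p v) ∧
      ∀ ζ ∈ D, formC a (a 0) (Ψ ζ) (paramDiff Ψ ζ Complex.I)
        = -Complex.I * formC a (a 0) (Ψ ζ) (paramDiff Ψ ζ 1) := by
  have hL := h.isLegendre h0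
  obtain ⟨Ψ, z, D, U, hΨ, hp, hz⟩ := exists_holomorphic_param hL.smooth_n hL.unit
    (h.diff_legN_ne_zero h0) p₀
  refine ⟨Ψ, z, D, U, hΨ, hp, hz, fun ζ hζ => ?_⟩
  -- This `w` is J applied to the first coordinate vector. Holomorphy of the coordinate gives dz(w)
  -- = i, so `w` is the second coordinate vector.
  obtain ⟨w, hw⟩ := surjective_of_injective_finrank_two (finrank_tangentSpace (Ψ ζ))
    (h.formC_fst_injective h0 (Ψ ζ)) (-Complex.I * formC a (a 0) (Ψ ζ) (paramDiff Ψ ζ 1))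
  have hJ := hz _ (hΨ.mapsTo ζ hζ) _ _ ((h.isJ_iff (Ψ ζ) (paramDiff Ψ ζ 1) w).mpr hw)
  rw [hΨ.diff_inv_paramDiff hζ, mul_one] at hJ
  rw [← hw, ← hΨ.paramDiff_diff_inv hζ w, hJ]

/-- The quadratic differential of a curved flat framing. -/
lemma isHolomorphicQuadraticDifferential (h0 : IsImmersedDirection (a 0))
    (h3 : IsImmersedDirection (a 3)) :
    IsHolomorphicQuadraticDifferential (legN (a 0))
      fun p v => conj (formC a (a 0) p v) * formC a (a 3) p v := by
  intro p₀
  obtain ⟨Ψ, z, D, U, hΨ, hp₀, hz, hI⟩ := h.exists_adapted_param h0 p₀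
  have hψI : ∀ ζ ∈ D, formC a (a 3) (Ψ ζ) (paramDiff Ψ ζ Complex.I)
      = Complex.I * formC a (a 3) (Ψ ζ) (paramDiff Ψ ζ 1) := by
    intro ζ hζ
    obtain ⟨k, s, r, hk, e1, -⟩ := h.normal_form h0 h3 (Ψ ζ)
    rw [e1, e1, hI ζ hζ]
    simp
    ring
  have hA : ∀ j, ContDiffOn ℝ ∞ (fun ζ => a j (Ψ ζ)) D := fun j =>
    hΨ.contDiffOn_comp (h.smooth_frame j) (Set.subset_univ _)
  have hd : ∀ i j, ∀ ζ ∈ D, ∀ v, lor (fderiv ℝ (fun ζ => a i (Ψ ζ)) ζ v) (a j (Ψ ζ))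
      = lor (diff (a i) (Ψ ζ) (paramDiff Ψ ζ v)) (a j (Ψ ζ)) := by
    intro i j ζ hζ v
    rw [hΨ.fderiv_comp hζ ((h.contMDiff_frame i).mdifferentiableAt (by simp))]
  have hol := differentiableOn_of_flat (A := fun j ζ => a j (Ψ ζ)) hΨ.isOpen_dom hA
    (fun ζ _ => h.isFrame (Ψ ζ))
    (fun ζ hζ => by
      have := congrArg Complex.re (hI ζ hζ)
      simp [formC_apply] at this
      rw [hd _ _ ζ hζ, hd _ _ ζ hζ]; exact this)
    (fun ζ hζ => by
      have := congrArg Complex.im (hI ζ hζ)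
      simp [formC_apply] at this
      rw [hd _ _ ζ hζ, hd _ _ ζ hζ]; exact this)
    (fun ζ hζ => by
      have := congrArg Complex.re (hψI ζ hζ)
      simp [formC_apply] at this
      rw [hd _ _ ζ hζ, hd _ _ ζ hζ]; exact this)
    (fun ζ hζ => by
      have := congrArg Complex.im (hψI ζ hζ)
      simp [formC_apply] at this
      rw [hd _ _ ζ hζ, hd _ _ ζ hζ]; exact this)
  have hsub : z '' U ⊆ D := by
    rintro _ ⟨p, hp, rfl⟩
    exact hΨ.mapsTo_inv p hp
  refine ⟨U, z, fun ζ => conj (formC a (a 0) (Ψ ζ) (paramDiff Ψ ζ 1))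
    * formC a (a 3) (Ψ ζ) (paramDiff Ψ ζ 1), hΨ.isOpen_ran, hp₀, hΨ.smooth_inv, ?_,
    fun p hp v hv => hΨ.diff_inv_ne_zero hp hv, hz, ?_, ?_⟩
  · intro p hp q hq e
    rw [← hΨ.right_inv p hp, ← hΨ.right_inv q hq, e]
  · refine (hol.mono hsub).congr fun ζ hζ => ?_
    have hζ' := hsub hζ
    rw [hd _ _ ζ hζ', hd _ _ ζ hζ', hd _ _ ζ hζ', hd _ _ ζ hζ']
    apply Complex.ext
    · simp [formC_apply]
    · simp [formC_apply]; ring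
  · intro p hp v
    obtain ⟨ζ, hζ, rfl⟩ : ∃ ζ ∈ D, Ψ ζ = p := ⟨z p, hΨ.mapsTo_inv p hp, hΨ.right_inv p hp⟩
    rw [hΨ.left_inv ζ hζ]
    set c : ℂ := diff z (Ψ ζ) v with hc
    have hv : v = c.re • paramDiff Ψ ζ 1 + c.im • paramDiff Ψ ζ Complex.I := by
      rw [← map_smul, ← map_smul, ← map_add]
      rw [← hΨ.paramDiff_diff_inv hζ v, ← hc]
      congr 1
      apply Complex.ext <;> simp
    have e1 : conj (formC a (a 0) (Ψ ζ) v) = c * conj (formC a (a 0) (Ψ ζ) (paramDiff Ψ ζ 1)) := by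
      conv_lhs => rw [hv]
      rw [map_add, map_smul, map_smul, hI ζ hζ]
      simp only [Complex.real_smul, map_add, map_mul, map_neg, Complex.conj_ofReal, Complex.conj_I]
      linear_combination conj (formC a (a 0) (Ψ ζ) (paramDiff Ψ ζ 1)) * Complex.re_add_im c
    have e2 : formC a (a 3) (Ψ ζ) v = c * formC a (a 3) (Ψ ζ) (paramDiff Ψ ζ 1) := by
      conv_lhs => rw [hv]
      rw [map_add, map_smul, map_smul, hψI ζ hζ]
      simp only [Complex.real_smul]
      linear_combination formC a (a 3) (Ψ ζ) (paramDiff Ψ ζ 1) * Complex.re_add_im c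
    change conj (formC a (a 0) (Ψ ζ) v) * formC a (a 3) (Ψ ζ) v
      = conj (formC a (a 0) (Ψ ζ) (paramDiff Ψ ζ 1)) * formC a (a 3) (Ψ ζ) (paramDiff Ψ ζ 1) * c ^ 2
    rw [e1, e2]
    ring

/-- The first envelope of a curved flat is `L`-isothermic. -/
lemma isLIsothermic (h0 : IsImmersedDirection (a 0)) (h3 : IsImmersedDirection (a 3)) :
    IsLIsothermic (legF S (a 0)) (legN (a 0)) := by
  refine ⟨h.isLegendre h0, _, h.isHolomorphicQuadraticDifferential h0 h3, ?_⟩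
  choose k s r hk hψ hθ using h.normal_form h0 h3
  refine ⟨fun p => (a 0 p 3)⁻¹ * r p / 2, ?_, ?_⟩
  · have hr : ContMDiff (𝓡 2) 𝓘(ℝ, ℝ) ∞ r := by
      intro p₀
      obtain ⟨Ψ, z, D, U, hΨ, hp₀, hz, hI⟩ := h.exists_adapted_param h0 p₀
      refine (hΨ.contMDiffOn_of_comp ?_).contMDiffAt (hΨ.isOpen_ran.mem_nhds hp₀)
      have hA : ∀ j, ContDiffOn ℝ ∞ (fun ζ => a j (Ψ ζ)) D := fun j =>
        hΨ.contDiffOn_comp (h.smooth_frame j) (Set.subset_univ _)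
      have hS : ContDiffOn ℝ ∞ (fun ζ => S (Ψ ζ)) D :=
        hΨ.contDiffOn_comp h.smooth_origin (Set.subset_univ _)
      have hsm : ∀ (b : M → R41), ContDiffOn ℝ ∞ (fun ζ => b (Ψ ζ)) D → ∀ v j, ContDiffOn ℝ ∞
          (fun ζ => lor (fderiv ℝ (fun ζ => b (Ψ ζ)) ζ v) (a j (Ψ ζ))) D := fun b hb v j =>
        ContDiffOn.lor (contDiffOn_fderiv_apply hΨ.isOpen_dom hb v) (hA j)
      have hfd : ∀ ζ ∈ D, ∀ b : M → R41, MDifferentiableAt (𝓡 2) 𝓘(ℝ, R41) b (Ψ ζ) → ∀ v,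
          formC a b (Ψ ζ) (paramDiff Ψ ζ v) = ⟨lor (fderiv ℝ (fun ζ => b (Ψ ζ)) ζ v) (a 1 (Ψ ζ)),
            lor (fderiv ℝ (fun ζ => b (Ψ ζ)) ζ v) (a 2 (Ψ ζ))⟩ := by
        intro ζ hζ b hb v
        rw [hΨ.fderiv_comp hζ hb]; rfl
      have hne : ∀ ζ ∈ D, formC a (a 3) (Ψ ζ) (paramDiff Ψ ζ 1) ≠ 0 := by
        intro ζ hζ hz
        have h1 : (1 : ℂ) = 0 := hΨ.paramDiff_injective hζ
          (h.formC_lst_injective h3 _ (by rw [hz, map_zero, map_zero]))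
        exact one_ne_zero h1
      set T : ℂ → Fin 4 → ℂ → ℝ := fun v j ζ =>
        lor (fderiv ℝ (fun ζ => S (Ψ ζ)) ζ v) (a j (Ψ ζ)) with hT
      set W : Fin 4 → ℂ → ℝ := fun j ζ =>
        lor (fderiv ℝ (fun ζ => a 3 (Ψ ζ)) ζ 1) (a j (Ψ ζ)) with hW
      have hformula : ∀ ζ ∈ D, r (Ψ ζ) = ((T 1 1 ζ + T Complex.I 2 ζ) * W 1 ζ
          + (T 1 2 ζ - T Complex.I 1 ζ) * W 2 ζ) / (2 * (W 1 ζ * W 1 ζ + W 2 ζ * W 2 ζ)) := by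
        intro ζ hζ
        have q1 := hθ (Ψ ζ) (paramDiff Ψ ζ 1)
        have q2 := hθ (Ψ ζ) (paramDiff Ψ ζ Complex.I)
        have q3 := hψ (Ψ ζ) (paramDiff Ψ ζ 1)
        have q0 := hne ζ hζ
        rw [hI ζ hζ] at q2
        -- This combination removes the (0,1)-part sφ of θ and doubles the (1,0)-part rψ. Since ψ
        -- has no zeros on the coordinate vector, it determines `r`.
        have q4 : formC a S (Ψ ζ) (paramDiff Ψ ζ 1)
            - Complex.I * formC a S (Ψ ζ) (paramDiff Ψ ζ Complex.I)
            = 2 * r (Ψ ζ) * formC a (a 3) (Ψ ζ) (paramDiff Ψ ζ 1) := by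
          rw [q1, q2, q3, map_mul, map_neg, Complex.conj_I]
          linear_combination (s (Ψ ζ) * formC a (a 0) (Ψ ζ) (paramDiff Ψ ζ 1)
            - r (Ψ ζ) * k (Ψ ζ) * conj (formC a (a 0) (Ψ ζ) (paramDiff Ψ ζ 1))) * Complex.I_sq
        rw [hfd ζ hζ S (h.mdifferentiableAt_origin _), hfd ζ hζ S (h.mdifferentiableAt_origin _),
          hfd ζ hζ (a 3) ((h.contMDiff_frame 3).mdifferentiableAt (by simp))] at q4
        rw [hfd ζ hζ (a 3) ((h.contMDiff_frame 3).mdifferentiableAt (by simp))] at q0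
        have q5 : W 1 ζ * W 1 ζ + W 2 ζ * W 2 ζ ≠ 0 := by
          have := Complex.normSq_eq_zero.not.mpr q0
          rwa [Complex.normSq_apply] at this
        have q6 := congrArg Complex.re q4
        have q7 := congrArg Complex.im q4
        simp at q6 q7
        change T 1 1 ζ + T Complex.I 2 ζ = 2 * r (Ψ ζ) * W 1 ζ at q6
        change T 1 2 ζ - T Complex.I 1 ζ = 2 * r (Ψ ζ) * W 2 ζ at q7
        rw [q6, q7, eq_div_iff (mul_ne_zero two_ne_zero q5)]
        ring
      refine ContDiffOn.congr ?_ hformula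
      have cS := hsm S hS
      have cA := hsm (a 3) (hA 3)
      refine ContDiffOn.div ?_ ?_ ?_
      · exact (((cS 1 1).add (cS Complex.I 2)).mul (cA 1 1)).add
          (((cS 1 2).sub (cS Complex.I 1)).mul (cA 1 2))
      · exact contDiffOn_const.mul (((cA 1 1).mul (cA 1 1)).add ((cA 1 2).mul (cA 1 2)))
      · intro ζ hζ
        have q0 := hne ζ hζ
        rw [hfd ζ hζ (a 3) ((h.contMDiff_frame 3).mdifferentiableAt (by simp))] at q0
        have := Complex.normSq_eq_zero.not.mpr q0
        rw [Complex.normSq_apply] at this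
        exact mul_ne_zero two_ne_zero this
    have hl := ((contMDiff_pi_space.mp (h.contMDiff_frame 0)) 3).inv₀ fun p => (h.fst_pos p).ne'
    exact (hl.mul hr).div_const 2
  · intro p v Jv hJ
    rw [h.isJ_iff] at hJ
    simp only [h.second_eq, h.third_eq]
    rw [hψ, hθ, hθ, hJ]
    -- After substituting φ(Jv) = -iφ(v), the terms in |φ|², from s and from III, drop out of the
    -- (2,0)-part and only r k (conj φ)² remains.
    set φ := formC a (a 0) p v
    apply Complex.ext
    · simp [Complex.mul_re, Complex.mul_im]
      ring
    · simp [Complex.mul_re, Complex.mul_im]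
      ring

/-- The origin of a curved flat framing is a Darboux congruence. -/
lemma isDarboux (hS : ∀ p, ∀ v : TangentSpace (𝓡 2) p, v ≠ 0 → diff S p v ≠ 0)
    (h0 : IsImmersedDirection (a 0)) (h3 : IsImmersedDirection (a 3)) :
    IsDarboux S (legF S (a 0)) (legN (a 0)) (legF S (a 3)) (legN (a 3)) where
  spacelike := by
    refine ⟨h.contMDiff_origin, fun p v hv => ?_⟩
    have e := (h.isFrame p).lor_eq_screen (x := diff S p v) (y := diff S p v)
      (by rw [h.lor_fst p trivial, h.lor_lst p trivial]; ring)
    rw [e, Complex.mul_conj, Complex.ofReal_re]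
    apply Complex.normSq_pos.mpr
    intro hz
    apply hS p v hv
    refine ((h.isFrame p).eq_smul_of_lor (h.lor_fst p trivial v) ?_ ?_).trans ?_
    · simpa [screen] using congrArg Complex.re hz
    · simpa [screen] using congrArg Complex.im hz
    · rw [h.lor_lst p trivial]; simp
  legendre := h.isLegendre h0
  legendre' := h.reverse.isLegendre h3
  envelopes := envelopes_leg
  envelopes' := envelopes_leg
  distinct p e := by
    have e1 : nullVec (legN (a 0)) p = nullVec (legN (a 3)) p := by unfold nullVec; rw [e]
    have e2 := (h.isFrame p).lor03
    have e3 : a 3 p = a 3 p 3 • nullVec (legN (a 3)) p :=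
      smul_nullVec_legN (b := a 3) h.reverse.fst_pos p
    rw [e3, ← e1, nullVec_legN h.fst_pos, lor_smul_right, lor_smul_right,
      h.lor_fst_self] at e2
    norm_num at e2
  ribaucour p := by
    obtain ⟨k, s, r, hk, hψ, hθ⟩ := h.normal_form h0 h3 p
    have hsurj := surjective_of_injective_finrank_two (finrank_tangentSpace p)
      (h.formC_fst_injective h0 p)
    -- With c² = k, conjugation followed by multiplication by k has eigenvectors c and ic with real
    -- eigenvalues |c|² and -|c|². Their preimages under φ are principal for both envelopes.
    obtain ⟨c, hc⟩ := IsAlgClosed.exists_pow_nat_eq k (n := 2) (by norm_num)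
    have hc0 : c ≠ 0 := by rintro rfl; exact hk (by rw [← hc]; ring)
    have hcn := Complex.normSq_pos.mpr hc0
    have hcc := Complex.mul_conj c
    obtain ⟨v, hv⟩ := hsurj c
    obtain ⟨w, hw⟩ := hsurj (Complex.I * c)
    have hv0 : v ≠ 0 := by rintro rfl; rw [map_zero] at hv; exact hc0 hv.symm
    have hw0 : w ≠ 0 := by
      rintro rfl
      rw [map_zero] at hw
      exact mul_ne_zero Complex.I_ne_zero hc0 hw.symm
    set m := Complex.normSq c with hm
    have ev : formC a S p v = ((s + r * m : ℝ) : ℂ) * c := by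
      rw [hθ, hv, ← hc]; push_cast; rw [← hcc]; ring
    have ew : formC a S p w = ((s - r * m : ℝ) : ℂ) * (Complex.I * c) := by
      rw [hθ, hw, ← hc, map_mul, Complex.conj_I]; push_cast; rw [← hcc]; ring
    have fv : formC a (a 3) p v = (m : ℂ) * c := by
      rw [hψ, hv, ← hc, ← hcc]; ring
    have fw : formC a (a 3) p w = ((-m : ℝ) : ℂ) * (Complex.I * c) := by
      rw [hψ, hw, ← hc, map_mul, Complex.conj_I]; push_cast; rw [← hcc]; ring
    -- Reversing the frame acts on screen components by z ↦ i conj z, which respects real multiples.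
    have hrev : ∀ b u (t : ℝ), formC a S p u = t * formC a b p u →
        formC (fun j => a (Fin.rev j)) S p u = t * formC (fun j => a (Fin.rev j)) b p u := by
      intro b u t e
      have k1 := congrArg Complex.re e
      have k2 := congrArg Complex.im e
      simp [formC_apply] at k1 k2
      apply Complex.ext
      · simp [formC_apply]; exact k2
      · simp [formC_apply]; exact k1
    refine ⟨v, w, ?_, h.isPrincipal_of_real p hv0 (r := s + r * m) (by rw [ev, hv]),
      h.reverse.isPrincipal_of_real p hv0 (r := (s + r * m) / m) (hrev (a 3) v _ ?_),
      h.isPrincipal_of_real p hw0 (r := s - r * m) (by rw [ew, hw]),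
      h.reverse.isPrincipal_of_real p hw0 (r := (s - r * m) / -m) (hrev (a 3) w _ ?_)⟩
    · rw [LinearIndependent.pair_iff]
      intro x y hxy
      have := congrArg (formC a (a 0) p) hxy
      rw [map_add, map_smul, map_smul, hv, hw, map_zero] at this
      have h2 : ((x : ℂ) + y * Complex.I) * c = 0 := by
        rw [← this]; simp only [Complex.real_smul]; ring
      have h4 := (mul_eq_zero.mp h2).resolve_right hc0
      have k1 := congrArg Complex.re h4
      have k2 := congrArg Complex.im h4
      simp at k1 k2
      exact ⟨k1, k2⟩
    · rw [ev, fv, ← mul_assoc, ← Complex.ofReal_mul, div_mul_cancel₀ _ hcn.ne']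
    · rw [ew, fw, ← mul_assoc (Complex.ofReal _) (Complex.ofReal _), ← Complex.ofReal_mul, div_mul_cancel₀ _ (neg_ne_zero.mpr hcn.ne')]
  conformal p := by
    obtain ⟨k, s, r, hk, hψ, hθ⟩ := h.normal_form h0 h3 p
    have hl := h.fst_pos p
    have hl' : 0 < a 3 p 3 := h.reverse.fst_pos p
    have hkn := Complex.normSq_pos.mpr hk
    -- |ψ|² = |k|²|φ|², corrected by the time components that normalize the null vectors to (-n, 1).
    refine ⟨Complex.normSq k * (a 0 p 3) ^ 2 * ((a 3 p 3)⁻¹) ^ 2, by positivity, fun v w => ?_⟩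
    have e1 : third (legN (a 3)) p v w = ((a 3 p 3)⁻¹) ^ 2 *
        (formC (fun j => a (Fin.rev j)) (a 3) p v
          * conj (formC (fun j => a (Fin.rev j)) (a 3) p w)).re := h.reverse.third_eq p v w
    have e2 : (formC (fun j => a (Fin.rev j)) (a 3) p v
          * conj (formC (fun j => a (Fin.rev j)) (a 3) p w)).re
        = (formC a (a 3) p v * conj (formC a (a 3) p w)).re := by
      simp [formC_apply]
      change lor _ (a 2 p) * lor _ (a 2 p) + lor _ (a 1 p) * lor _ (a 1 p) = _
      ring
    rw [e1, e2, h.third_eq, hψ, hψ]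
    simp [Complex.normSq_apply]
    field_simp
    ring

end IsFlatFrameOn
end Isothermic

theorem darboux_of_curvedFlat {M : Type*} [TopologicalSpace M]
    [ChartedSpace (EuclideanSpace ℝ (Fin 2)) M] [IsManifold (𝓡 2) ∞ M]
    {S : M → R41} {a : Fin 4 → M → R41} (h : IsCurvedFlatFramingOn Set.univ S a)
    (hS : ∀ p, ∀ v : TangentSpace (𝓡 2) p, v ≠ 0 → diff S p v ≠ 0)
    (h0 : IsImmersedDirection (a 0)) (h3 : IsImmersedDirection (a 3)) :
    ∃ f n f' n' : M → R3,
      (∀ p, nullLine (f p) (n p) = lineThrough (S p) (a 0 p)) ∧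
      (∀ p, nullLine (f' p) (n' p) = lineThrough (S p) (a 3 p)) ∧
      IsDarboux S f n f' n' ∧ IsLIsothermic f n ∧ IsLIsothermic f' n' := by
  have hf := (isCurvedFlatFramingOn_iff isOpen_univ).mp h
  exact ⟨legF S (a 0), legN (a 0), legF S (a 3), legN (a 3), nullLine_leg hf.fst_pos,
    nullLine_leg (b := a 3) hf.reverse.fst_pos, hf.isDarboux hS h0 h3, hf.isLIsothermic h0 h3,
    hf.reverse.isLIsothermic h3 h0⟩

end Laguerre

namespace Laguerre

/-! ### Surfaces with proportional second fundamental forms -/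

section Parallel

variable {F : Type*} [NormedAddCommGroup F] [NormedSpace ℝ F] {B : Set F}

/-- A surface in Minkowski space whose second fundamental forms with respect to two null normal
fields are proportional has a normal field of constant direction, so lies in a hyperplane. -/
lemma constant_normal_of_proportional (hB : IsOpen B) (hBc : IsPreconnected B)
    {s n n' : F → R41} {k : F → ℝ} (hs : ContDiffOn ℝ ∞ s B) (hn : ContDiffOn ℝ ∞ n B)
    (hn' : ContDiffOn ℝ ∞ n' B) (hk : ContDiffOn ℝ ∞ k B)
    (nn : ∀ x ∈ B, lor (n x) (n x) = 0) (nn' : ∀ x ∈ B, lor (n' x) (n' x) = 0)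
    (ng : ∀ x ∈ B, lor (n x) (n' x) ≠ 0)
    (sn : ∀ x ∈ B, ∀ u, lor (fderiv ℝ s x u) (n x) = 0)
    (sn' : ∀ x ∈ B, ∀ u, lor (fderiv ℝ s x u) (n' x) = 0)
    (normal : ∀ x ∈ B, ∀ y, (∀ u, lor y (fderiv ℝ s x u) = 0) → ∃ α β : ℝ, y = α • n x + β • n' x)
    (k0 : ∀ x ∈ B, k x ≠ 0)
    (prop : ∀ x ∈ B, ∀ u w, lor (fderiv ℝ n' x u) (fderiv ℝ s x w)
      = k x * lor (fderiv ℝ n x u) (fderiv ℝ s x w))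
    (nondeg : ∀ x ∈ B, ∀ u, (∀ w, lor (fderiv ℝ n x u) (fderiv ℝ s x w) = 0) → u = 0)
    {e₁ e₂ : F} (he : LinearIndependent ℝ ![e₁, e₂]) (hspan : Submodule.span ℝ {e₁, e₂} = ⊤)
    {x₀ x : F} (hx₀ : x₀ ∈ B) (hx : x ∈ B) :
    (∃ σ : ℝ, σ ≠ 0 ∧ n' x₀ - k x₀ • n x₀ = σ • (n' x - k x • n x)) ∧
      lor (n' x₀ - k x₀ • n x₀) (s x) = lor (n' x₀ - k x₀ • n x₀) (s x₀) := by
  -- `W` is the normal whose second fundamental form vanishes and `V` spans its orthogonal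
  -- complement in the normal plane; both are non-null because `k` has no zeros.
  set W : F → R41 := fun x => n' x - k x • n x with hW
  set V : F → R41 := fun x => n' x + k x • n x with hV
  have cW : ContDiffOn ℝ ∞ W B := hn'.sub (hk.smul hn)
  have cV : ContDiffOn ℝ ∞ V B := hn'.add (hk.smul hn)
  have df : ∀ {f : F → R41}, ContDiffOn ℝ ∞ f B → ∀ x ∈ B, DifferentiableAt ℝ f x :=
    fun hf x hx => differentiableAt_of_contDiffOn hB hf hx
  have dk : ∀ x ∈ B, DifferentiableAt ℝ k x := fun x hx => differentiableAt_of_contDiffOn hB hk hx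
  have fkn : ∀ x ∈ B, ∀ u, fderiv ℝ (fun y => k y • n y) x u
      = k x • fderiv ℝ n x u + fderiv ℝ k x u • n x := by
    intro x hx u
    rw [fderiv_fun_smul (dk x hx) (df hn x hx)]
    rfl
  have dkn : ∀ x ∈ B, DifferentiableAt ℝ (fun y => k y • n y) x := fun x hx =>
    (dk x hx).smul (df hn x hx)
  have fW : ∀ x ∈ B, ∀ u, fderiv ℝ W x u
      = fderiv ℝ n' x u - (k x • fderiv ℝ n x u + fderiv ℝ k x u • n x) := by
    intro x hx u
    rw [← fkn x hx, hW, fderiv_fun_sub (df hn' x hx) (dkn x hx)]; rfl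
  have fV : ∀ x ∈ B, ∀ u, fderiv ℝ V x u
      = fderiv ℝ n' x u + (k x • fderiv ℝ n x u + fderiv ℝ k x u • n x) := by
    intro x hx u
    rw [← fkn x hx, hV, fderiv_fun_add (df hn' x hx) (dkn x hx)]; rfl
  have Ws : ∀ x ∈ B, ∀ u, lor (fderiv ℝ s x u) (W x) = 0 := by
    intro x hx u
    rw [hW]; simp only [lor_sub_right, lor_smul_right, sn x hx, sn' x hx]; ring
  have Vs : ∀ x ∈ B, ∀ u, lor (fderiv ℝ s x u) (V x) = 0 := by
    intro x hx u
    rw [hV]; simp only [lor_add_right, lor_smul_right, sn x hx, sn' x hx]; ring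
  have dWs : ∀ x ∈ B, ∀ u w, lor (fderiv ℝ W x u) (fderiv ℝ s x w) = 0 := by
    intro x hx u w
    rw [fW x hx, lor_sub_left, lor_add_left, lor_smul_left, lor_smul_left, prop x hx,
      lor_comm (n x), sn x hx]
    ring
  have dVs : ∀ x ∈ B, ∀ u w, lor (fderiv ℝ V x u) (fderiv ℝ s x w)
      = 2 * k x * lor (fderiv ℝ n x u) (fderiv ℝ s x w) := by
    intro x hx u w
    rw [fV x hx, lor_add_left, lor_add_left, lor_smul_left, lor_smul_left, prop x hx,
      lor_comm (n x), sn x hx]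
    ring
  have WW : ∀ x ∈ B, lor (W x) (W x) = -2 * k x * lor (n x) (n' x) := by
    intro x hx
    simp only [hW, lor_sub_left, lor_sub_right, lor_smul_left, lor_smul_right, nn x hx, nn' x hx,
      lor_comm (n' x) (n x)]
    ring
  have VV : ∀ x ∈ B, lor (V x) (V x) = 2 * k x * lor (n x) (n' x) := by
    intro x hx
    simp only [hV, lor_add_left, lor_add_right, lor_smul_left, lor_smul_right, nn x hx, nn' x hx,
      lor_comm (n' x) (n x)]
    ring
  have WV : ∀ x ∈ B, lor (W x) (V x) = 0 := by
    intro x hx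
    simp only [hW, hV, lor_sub_left, lor_add_right, lor_smul_left, lor_smul_right, nn x hx,
      nn' x hx, lor_comm (n' x) (n x)]
    ring
  have VV0 : ∀ x ∈ B, lor (V x) (V x) ≠ 0 := fun x hx => by
    rw [VV x hx]; exact mul_ne_zero (mul_ne_zero two_ne_zero (k0 x hx)) (ng x hx)
  have WW0 : ∀ x ∈ B, lor (W x) (W x) ≠ 0 := fun x hx => by
    rw [WW x hx]; exact mul_ne_zero (mul_ne_zero (by norm_num) (k0 x hx)) (ng x hx)
  -- a normal vector is a combination of `W` and `V`
  have dec : ∀ x ∈ B, ∀ y, (∀ u, lor y (fderiv ℝ s x u) = 0) →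
      y = (lor y (W x) / lor (W x) (W x)) • W x + (lor y (V x) / lor (V x) (V x)) • V x := by
    intro x hx y hy
    obtain ⟨α, β, rfl⟩ := normal x hx y hy
    have hk0 := k0 x hx
    have e : α • n x + β • n' x = ((β - α / k x) / 2) • W x + ((β + α / k x) / 2) • V x := by
      simp only [hW, hV]
      have : α = (α / k x) * k x := by field_simp
      conv_lhs => rw [this]
      module
    rw [e, lor_add_left, lor_add_left, lor_smul_left, lor_smul_left, lor_smul_left,
      lor_smul_left, WV x hx, lor_comm (V x) (W x), WV x hx, mul_zero, mul_zero, add_zero, zero_add,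
      mul_div_cancel_right₀ _ (WW0 x hx), mul_div_cancel_right₀ _ (VV0 x hx)]
  -- the normal connection form of the pair `W`, `V` vanishes
  have eta : ∀ x ∈ B, ∀ u, lor (fderiv ℝ W x u) (V x) = 0 := by
    intro x hx
    have nhds_eq : ∀ {g : F → ℝ}, (∀ y ∈ B, g y = 0) → ∀ u, fderiv ℝ g x u = 0 := by
      intro g hg u
      have : g =ᶠ[nhds x] fun _ => 0 := Filter.eventuallyEq_of_mem (hB.mem_nhds hx) hg
      rw [this.fderiv_eq]; simp
    have ds := fun w => df (contDiffOn_fderiv_apply hB hs w) x hx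
    have dW' := fun w => df (contDiffOn_fderiv_apply hB cW w) x hx
    -- A Codazzi equation: differentiate ⟨∂W, ∂s⟩ = 0 and use that the second derivatives of `W`
    -- commute.
    have c1 : ∀ u w z, lor (fderiv ℝ W x u) (fderiv ℝ (fun y => fderiv ℝ s y w) x z)
        = lor (fderiv ℝ W x z) (fderiv ℝ (fun y => fderiv ℝ s y w) x u) := by
      intro u w z
      have a1 := nhds_eq (fun y hy => dWs y hy u w) z
      have a2 := nhds_eq (fun y hy => dWs y hy z w) u
      rw [fderiv_lor (dW' _) (ds _)] at a1 a2
      rw [fderiv_fderiv_comm hB cW hx] at a1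
      linarith
    have c2 : ∀ w z, lor (W x) (fderiv ℝ (fun y => fderiv ℝ s y w) x z) = 0 := by
      intro w z
      have a1 := nhds_eq (fun y hy => Ws y hy w) z
      rw [fderiv_lor (ds _) (df cW x hx), lor_comm (fderiv ℝ s x w), dWs x hx, lor_comm] at a1
      linarith
    have c3 : ∀ w z, lor (V x) (fderiv ℝ (fun y => fderiv ℝ s y w) x z)
        = -(2 * k x * lor (fderiv ℝ n x z) (fderiv ℝ s x w)) := by
      intro w z
      have a1 := nhds_eq (fun y hy => Vs y hy w) z
      rw [fderiv_lor (ds _) (df cV x hx), lor_comm (fderiv ℝ s x w), dVs x hx, lor_comm] at a1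
      linarith
    have c4 : ∀ u w z, lor (fderiv ℝ W x u) (fderiv ℝ (fun y => fderiv ℝ s y w) x z)
        = lor (fderiv ℝ W x u) (V x) / lor (V x) (V x)
          * -(2 * k x * lor (fderiv ℝ n x z) (fderiv ℝ s x w)) := by
      intro u w z
      conv_lhs => rw [dec x hx _ (dWs x hx u)]
      rw [lor_add_left, lor_smul_left, lor_smul_left, c2, c3, mul_zero, zero_add]
    have c5 : ∀ u z w, lor (fderiv ℝ W x u) (V x) * lor (fderiv ℝ n x z) (fderiv ℝ s x w)
        = lor (fderiv ℝ W x z) (V x) * lor (fderiv ℝ n x u) (fderiv ℝ s x w) := by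
      intro u z w
      have := c1 u w z
      rw [c4, c4] at this
      have h1 := VV0 x hx
      have h2 := k0 x hx
      field_simp at this
      linarith
    -- With η(u) = ⟨∂_u W, V⟩, `c5` says that η(u)z - η(z)u lies in the kernel of the nondegenerate
    -- second fundamental form. For independent `e₁`, `e₂` this forces η = 0.
    have c6 : lor (fderiv ℝ W x e₁) (V x) • e₂ - lor (fderiv ℝ W x e₂) (V x) • e₁ = 0 := by
      apply nondeg x hx
      intro w
      rw [map_sub, map_smul, map_smul, lor_sub_left, lor_smul_left, lor_smul_left, c5]
      ring
    have c7 := LinearIndependent.pair_iff.mp he (-lor (fderiv ℝ W x e₂) (V x))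
      (lor (fderiv ℝ W x e₁) (V x)) (by rw [← c6]; module)
    intro u
    have hu : u ∈ Submodule.span ℝ {e₁, e₂} := by rw [hspan]; trivial
    obtain ⟨α, β, rfl⟩ := Submodule.mem_span_pair.mp hu
    rw [map_add, map_smul, map_smul, lor_add_left, lor_smul_left, lor_smul_left, c7.2,
      neg_eq_zero.mp c7.1]
    ring
  have par : ∀ x ∈ B, ∀ u, fderiv ℝ W x u
      = (lor (fderiv ℝ W x u) (W x) / lor (W x) (W x)) • W x := by
    intro x hx u
    conv_lhs => rw [dec x hx _ (dWs x hx u)]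
    rw [eta x hx]; simp
  set y := W x₀ with hy
  -- The projection of the fixed vector `y` to the line of `W` does not see rescalings of `W`, so it
  -- is constant as soon as `dW` is a multiple of `W`; no integrating factor is needed.
  have const : ∀ z ∈ B, (lor (W z) y / lor (W z) (W z)) • W z = y := by
    intro z hz
    have cs : ContDiffOn ℝ ∞ (fun z => lor (W z) y / lor (W z) (W z)) B :=
      (ContDiffOn.lor cW contDiffOn_const).div (ContDiffOn.lor cW cW) WW0
    have cZ : ContDiffOn ℝ ∞ (fun z => (lor (W z) y / lor (W z) (W z)) • W z) B := cs.smul cW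
    have hzero : B.EqOn (fderiv ℝ fun z => (lor (W z) y / lor (W z) (W z)) • W z) 0 := by
      intro z hz
      have d1 : DifferentiableAt ℝ (fun z => lor (W z) y) z :=
        differentiableAt_of_contDiffOn hB (ContDiffOn.lor cW contDiffOn_const) hz
      have d2 : DifferentiableAt ℝ (fun z => lor (W z) (W z)) z :=
        differentiableAt_of_contDiffOn hB (ContDiffOn.lor cW cW) hz
      have d3 : DifferentiableAt ℝ (fun z => lor (W z) y / lor (W z) (W z)) z :=
        differentiableAt_of_contDiffOn hB cs hz
      ext1 u
      rw [fderiv_fun_smul d3 (df cW z hz)]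
      have hp := par z hz u
      set ξ := lor (fderiv ℝ W z u) (W z) / lor (W z) (W z) with hξ
      have e0 : (fun z => lor (W z) y / lor (W z) (W z) * lor (W z) (W z)) =ᶠ[nhds z]
          fun z => lor (W z) y := Filter.eventuallyEq_of_mem (hB.mem_nhds hz) fun q hq =>
        div_mul_cancel₀ _ (WW0 q hq)
      have e1 : fderiv ℝ (fun z => lor (W z) y / lor (W z) (W z)) z u
          = -ξ * (lor (W z) y / lor (W z) (W z)) := by
        have e2 := congrArg (fun L : F →L[ℝ] ℝ => L u) (e0.fderiv_eq (𝕜 := ℝ))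
        rw [fderiv_fun_mul d3 d2] at e2
        have f1 := fderiv_lor (df cW z hz) (differentiableAt_const y) u
        have f2 := fderiv_lor (df cW z hz) (df cW z hz) u
        rw [hp, lor_smul_left, fderiv_const_apply] at f1
        rw [hp, lor_smul_left, lor_smul_right] at f2
        simp only [add_apply, smul_apply, smul_eq_mul, f1, f2, zero_apply, lor_zero_right] at e2
        have := WW0 z hz
        apply mul_right_cancel₀ this
        field_simp at e2 ⊢
        linarith
      simp only [add_apply, smul_apply, ContinuousLinearMap.smulRight_apply, e1, hp,
        Pi.zero_apply, zero_apply]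
      module
    have := hB.is_const_of_fderiv_eq_zero hBc (cZ.differentiableOn (by simp)) hzero hz hx₀
    rw [this, ← hy, div_self (WW0 x₀ hx₀), one_smul]
  have hyx := const x hx
  constructor
  · refine ⟨_, ?_, hyx.symm⟩
    intro h0
    rw [h0, zero_smul] at hyx
    have := WW0 x₀ hx₀
    rw [← hy, ← hyx, lor_zero_left] at this
    exact this rfl
  · have hzero : B.EqOn (fderiv ℝ fun z => lor y (s z)) 0 := by
      intro z hz
      ext1 u
      rw [fderiv_lor (differentiableAt_const y) (df hs z hz), fderiv_const_apply, lor_comm y,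
        ← const z hz, lor_smul_right, Ws z hz]
      simp [lor_zero_left]
    exact hB.is_const_of_fderiv_eq_zero hBc
      ((ContDiffOn.lor contDiffOn_const hs).differentiableOn (by simp)) hzero hx hx₀

end Parallel
end Laguerre

namespace Laguerre

/-! ### Adapted frames of a Darboux congruence -/

section AdaptedFrame

/-- The Lorentz cross product of three vectors. -/
def lcross (u v w : R41) : R41 :=
  ![-u 1 * (v 3 * w 2 - v 2 * w 3) + u 2 * (v 3 * w 1 - v 1 * w 3) - u 3 * (v 2 * w 1 - v 1 * w 2),
    u 0 * (v 3 * w 2 - v 2 * w 3) + u 2 * (v 0 * w 3 - v 3 * w 0) - u 3 * (v 0 * w 2 - v 2 * w 0),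
    u 0 * (v 1 * w 3 - v 3 * w 1) - u 1 * (v 0 * w 3 - v 3 * w 0) - u 3 * (v 1 * w 0 - v 0 * w 1),
    -(u 0 * (v 2 * w 1 - v 1 * w 2) - u 1 * (v 2 * w 0 - v 0 * w 2) + u 2 * (v 1 * w 0 - v 0 * w 1))]

/-- The argument sits in the third row, so inserting the cross product as `a_3` makes the
determinant of the frame its own square norm, which is positive. -/
lemma lor_lcross (u v w x : R41) : lor (lcross u v w) x = (Matrix.of ![u, v, x, w]).det := by
  rw [det_rows]
  simp [lor, lcross]
  ring

/-- Minus the Gram determinant of the three factors; the sign comes from the Lorentz signature. -/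
lemma lor_lcross_lcross (u v w : R41) : lor (lcross u v w) (lcross u v w) =
    -(lor u u * (lor v v * lor w w - lor v w ^ 2) - lor u v * (lor u v * lor w w - lor v w * lor u w)
      + lor u w * (lor u v * lor v w - lor v v * lor u w)) := by
  simp [lor, lcross]
  ring

lemma lor_lcross_fst (u v w : R41) : lor (lcross u v w) u = 0 := by
  rw [lor_lcross, det_rows]; ring

lemma lor_lcross_snd (u v w : R41) : lor (lcross u v w) v = 0 := by
  rw [lor_lcross, det_rows]; ring

lemma lor_lcross_trd (u v w : R41) : lor (lcross u v w) w = 0 := by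
  rw [lor_lcross, det_rows]; ring

lemma isLaguerreFrame_lcross {u v w : R41} (uu : lor u u = 0) (ww : lor w w = 0)
    (uw : lor u w = -1) (vv : lor v v = 1) (uv : lor u v = 0) (vw : lor v w = 0)
    (hf : 0 < u 3 + w 3) : IsLaguerreFrame ![u, v, lcross u v w, w] := by
  have cc : lor (lcross u v w) (lcross u v w) = 1 := by
    rw [lor_lcross_lcross, uu, ww, uw, vv, uv, vw]; norm_num
  have c1 := lor_lcross_fst u v w
  have c2 := lor_lcross_snd u v w
  have c3 := lor_lcross_trd u v w
  refine ⟨?_, ?_, hf⟩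
  · intro i j
    fin_cases i <;> fin_cases j <;> simp [gram] <;>
      first | assumption | (rw [lor_comm]; assumption)
  · rw [← lor_lcross, cc]; exact one_pos

/-- The Laguerre frame with the given null directions `N`, `N'` and space-like direction `b`. -/
noncomputable def adFrame (N N' b : R41) : Fin 4 → R41 :=
  ![N, (√(lor b b))⁻¹ • b, lcross N ((√(lor b b))⁻¹ • b) ((-lor N N')⁻¹ • N'), (-lor N N')⁻¹ • N']

lemma isLaguerreFrame_adFrame {N N' b : R41} (NN : lor N N = 0) (NN' : lor N' N' = 0)
    (neg : lor N N' < 0) (bN : lor b N = 0) (bN' : lor b N' = 0) (bb : 0 < lor b b)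
    (N3 : 0 < N 3) (N3' : 0 < N' 3) : IsLaguerreFrame (adFrame N N' b) := by
  have hs := Real.sqrt_pos.mpr bb
  have hs2 := Real.mul_self_sqrt bb.le
  refine isLaguerreFrame_lcross NN ?_ ?_ ?_ ?_ ?_ ?_
  · rw [lor_smul_left, lor_smul_right, NN', mul_zero, mul_zero]
  · rw [lor_smul_right, inv_neg, neg_mul, inv_mul_cancel₀ neg.ne]
  · rw [lor_smul_left, lor_smul_right]
    nth_rw 3 [← hs2]
    field_simp
  · rw [lor_smul_right, lor_comm N, bN, mul_zero]
  · rw [lor_smul_right, lor_smul_left, bN', mul_zero, mul_zero]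
  · have : 0 < (-lor N N')⁻¹ := inv_pos.mpr (neg_pos.mpr neg)
    have := mul_pos this N3'
    simp only [Pi.smul_apply, smul_eq_mul]
    linarith

lemma IsLaguerreFrame.range_eq_span {a : Fin 4 → R41} (ha : IsLaguerreFrame a) {T : Type*}
    [AddCommGroup T] [Module ℝ T] (hT : Module.finrank ℝ T = 2)
    (L : T →ₗ[ℝ] R41) (hL : Function.Injective L) (h0 : ∀ v, lor (L v) (a 0) = 0)
    (h3 : ∀ v, lor (L v) (a 3) = 0) : LinearMap.range L = Submodule.span ℝ {a 1, a 2} := by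
  apply Submodule.eq_of_le_of_finrank_le
  · rintro _ ⟨v, rfl⟩
    rw [Submodule.mem_span_pair]
    refine ⟨lor (L v) (a 1), lor (L v) (a 2), ?_⟩
    conv_rhs => rw [ha.expand (L v)]
    rw [h0, h3]
    simp
  · rw [LinearMap.finrank_range_of_inj hL, hT]
    have := finrank_span_le_card (R := ℝ) ({a 1, a 2} : Set R41)
    exact this.trans (by rw [Set.toFinset_insert, Set.toFinset_singleton]; exact Finset.card_le_two)

end AdaptedFrame

/-! ### Pointwise geometry of a Darboux congruence -/

section Darboux

variable {M : Type*} [TopologicalSpace M] [ChartedSpace (EuclideanSpace ℝ (Fin 2)) M]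
  {S : M → R41} {f n f' n' : M → R3}

namespace IsDarboux

variable (D : IsDarboux S f n f' n')
include D

lemma mdiff_n (p : M) : MDifferentiableAt (𝓡 2) 𝓘(ℝ, R3) n p :=
  D.legendre.smooth_n.mdifferentiableAt (by simp)
lemma mdiff_n' (p : M) : MDifferentiableAt (𝓡 2) 𝓘(ℝ, R3) n' p :=
  D.legendre'.smooth_n.mdifferentiableAt (by simp)
lemma mdiff_f (p : M) : MDifferentiableAt (𝓡 2) 𝓘(ℝ, R3) f p :=
  D.legendre.smooth_f.mdifferentiableAt (by simp)
lemma mdiff_f' (p : M) : MDifferentiableAt (𝓡 2) 𝓘(ℝ, R3) f' p :=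
  D.legendre'.smooth_f.mdifferentiableAt (by simp)
lemma mdiff_S (p : M) : MDifferentiableAt (𝓡 2) 𝓘(ℝ, R41) S p :=
  D.spacelike.smooth.mdifferentiableAt (by simp)

lemma lor_nullVec (p : M) : lor (nullVec n p) (nullVec n p) = 0 :=
  lor_nullVec_self (D.legendre.unit p)

lemma lor_nullVec' (p : M) : lor (nullVec n' p) (nullVec n' p) = 0 :=
  lor_nullVec_self (D.legendre'.unit p)

/-- The product equals n·n' - 1 = -|n - n'|²/2. -/
lemma lor_nullVec_neg (p : M) : lor (nullVec n p) (nullVec n' p) < 0 := by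
  have h1 := D.legendre.unit p
  have h2 := D.legendre'.unit p
  have h3 := D.distinct p
  simp [nullVec, lor, orientedSphere, dotProduct, Fin.sum_univ_three] at h1 h2 ⊢
  by_contra hneg
  push Not at hneg
  apply h3
  have h4 : (n p 0 - n' p 0) ^ 2 + (n p 1 - n' p 1) ^ 2 + (n p 2 - n' p 2) ^ 2 ≤ 0 := by
    nlinarith
  ext i
  fin_cases i
  · simp only [Fin.zero_eta]
    nlinarith [sq_nonneg (n p 0 - n' p 0), sq_nonneg (n p 1 - n' p 1), sq_nonneg (n p 2 - n' p 2)]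
  · simp only [Fin.mk_one]
    nlinarith [sq_nonneg (n p 0 - n' p 0), sq_nonneg (n p 1 - n' p 1), sq_nonneg (n p 2 - n' p 2)]
  · simp only [Fin.reduceFinMk]
    nlinarith [sq_nonneg (n p 0 - n' p 0), sq_nonneg (n p 1 - n' p 1), sq_nonneg (n p 2 - n' p 2)]

lemma lor_diff_fst (p : M) (v : TangentSpace (𝓡 2) p) : lor (diff S p v) (nullVec n p) = 0 := by
  rw [lor_diff_envelope (D.mdiff_f p) (D.mdiff_n p) (D.mdiff_S p) D.envelopes D.legendre.unit,
    D.legendre.contact, neg_zero]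

lemma lor_diff_snd (p : M) (v : TangentSpace (𝓡 2) p) : lor (diff S p v) (nullVec n' p) = 0 := by
  rw [lor_diff_envelope (D.mdiff_f' p) (D.mdiff_n' p) (D.mdiff_S p) D.envelopes' D.legendre'.unit,
    D.legendre'.contact, neg_zero]

lemma diff_injective (p : M) : Function.Injective (diff S p) := by
  rw [injective_iff_map_eq_zero]
  intro v hv
  by_contra hv0
  have := D.spacelike.pos p v hv0
  rw [hv] at this
  exact absurd this (by rw [show lor (0 : R41) 0 = 0 from lor_zero_left 0]; exact lt_irrefl _)

lemma isLaguerreFrame (p : M) {v : TangentSpace (𝓡 2) p} (hv : v ≠ 0) :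
    IsLaguerreFrame (adFrame (nullVec n p) (nullVec n' p) (diff S p v)) :=
  isLaguerreFrame_adFrame (D.lor_nullVec p) (D.lor_nullVec' p) (D.lor_nullVec_neg p)
    (D.lor_diff_fst p v) (D.lor_diff_snd p v) (D.spacelike.pos p v hv)
    (by simp [nullVec, orientedSphere]) (by simp [nullVec, orientedSphere])

lemma range_diff (p : M) {b : R41} (ha : IsLaguerreFrame (adFrame (nullVec n p) (nullVec n' p) b)) :
    LinearMap.range (diff S p : TangentSpace (𝓡 2) p →ₗ[ℝ] R41)
      = Submodule.span ℝ {adFrame (nullVec n p) (nullVec n' p) b 1,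
        adFrame (nullVec n p) (nullVec n' p) b 2} := by
  refine ha.range_eq_span (finrank_tangentSpace p) _ (D.diff_injective p) (D.lor_diff_fst p) ?_
  intro v
  have := D.lor_diff_snd p v
  change lor (diff S p v) ((-lor (nullVec n p) (nullVec n' p))⁻¹ • nullVec n' p) = 0
  rw [lor_smul_right, this, mul_zero]

/-- The normal space of the congruence is spanned by the two null vectors. -/
lemma normal_eq (p : M) (y : R41) (hy : ∀ u, lor y (diff S p u) = 0) :
    ∃ α β : ℝ, y = α • nullVec n p + β • nullVec n' p := by
  obtain ⟨v, hv⟩ : ∃ v : TangentSpace (𝓡 2) p, v ≠ 0 :=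
    haveI : Nontrivial (TangentSpace (𝓡 2) p) :=
      Module.nontrivial_of_finrank_pos (R := ℝ) (by rw [finrank_tangentSpace p]; norm_num)
    exists_ne 0
  have ha := D.isLaguerreFrame p hv
  have hr := D.range_diff p ha
  set a := adFrame (nullVec n p) (nullVec n' p) (diff S p v) with hadef
  have hmem : ∀ z ∈ ({a 1, a 2} : Set R41), lor y z = 0 := by
    intro z hz
    have : z ∈ LinearMap.range (diff S p : TangentSpace (𝓡 2) p →ₗ[ℝ] R41) := by
      rw [hr]; exact Submodule.subset_span hz
    obtain ⟨u, rfl⟩ := this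
    exact hy u
  refine ⟨-lor y (a 3), -lor y (a 0) * (-lor (nullVec n p) (nullVec n' p))⁻¹, ?_⟩
  conv_lhs => rw [ha.expand y, hmem (a 1) (by simp), hmem (a 2) (by simp)]
  rw [mul_smul]
  change (-lor y (a 3)) • nullVec n p + _ + _ + _ = _
  rw [zero_smul, zero_smul, add_zero, add_zero]
  rfl

/-- Two independent common principal directions, in terms of the null vectors. -/
lemma exists_principal (p : M) : ∃ v w : TangentSpace (𝓡 2) p, LinearIndependent ℝ ![v, w] ∧
    ∃ r s r' s' ρ σ ρ' σ' : ℝ,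
      diff S p v = (r • diff (nullVec n) p v : R41) + s • nullVec n p ∧
      diff S p v = (r' • diff (nullVec n') p v : R41) + s' • nullVec n' p ∧
      diff S p w = (ρ • diff (nullVec n) p w : R41) + σ • nullVec n p ∧
      diff S p w = (ρ' • diff (nullVec n') p w : R41) + σ' • nullVec n' p := by
  obtain ⟨v, w, hi, h1, h2, h3, h4⟩ := D.ribaucour p
  rw [isPrincipal_iff (D.mdiff_f p) (D.mdiff_n p) (D.mdiff_S p) D.envelopes] at h1 h3
  rw [isPrincipal_iff (D.mdiff_f' p) (D.mdiff_n' p) (D.mdiff_S p) D.envelopes'] at h2 h4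
  obtain ⟨-, r, s, e1⟩ := h1
  obtain ⟨-, r', s', e2⟩ := h2
  obtain ⟨-, ρ, σ, e3⟩ := h3
  obtain ⟨-, ρ', σ', e4⟩ := h4
  exact ⟨v, w, hi, r, s, r', s', ρ, σ, ρ', σ', e1, e2, e3, e4⟩

/-- Either the two second fundamental forms are proportional, or the third fundamental forms have
a common orthogonal eigenbasis with opposite eigenvalues. -/
lemma dichotomy (p : M) : ∃ (v w : TangentSpace (𝓡 2) p) (m m' r ρ : ℝ),
    LinearIndependent ℝ ![v, w] ∧ m ≠ 0 ∧ r ≠ 0 ∧ ρ ≠ 0 ∧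
    (∀ y, lor y (nullVec n p) = 0 → lor y (nullVec n' p) = 0 →
      lor (diff S p v) y = r * lor (diff (nullVec n) p v) y ∧
      lor (diff S p w) y = ρ * lor (diff (nullVec n) p w) y ∧
      lor (diff (nullVec n') p v) y = m * lor (diff (nullVec n) p v) y ∧
      lor (diff (nullVec n') p w) y = m' * lor (diff (nullVec n) p w) y) ∧
    (m' = m ∨ (m' = -m ∧ third n p v w = 0)) := by
  obtain ⟨v, w, hi, r, s, r', s', ρ, σ, ρ', σ', e1, e2, e3, e4⟩ := D.exists_principal p
  obtain ⟨c, hc, hconf⟩ := D.conformal p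
  have hv0 : v ≠ 0 := hi.ne_zero 0
  have hw0 : w ≠ 0 := hi.ne_zero 1
  -- the first fundamental form in terms of the third ones
  have I : ∀ {x y : TangentSpace (𝓡 2) p} {r s ρ σ : ℝ},
      diff S p x = (r • diff (nullVec n) p x : R41) + s • nullVec n p →
      diff S p y = (ρ • diff (nullVec n) p y : R41) + σ • nullVec n p →
      lor (diff S p x) (diff S p y) = r * ρ * third n p x y := by
    intro x y r s ρ σ hx hy
    have z := lor_diff_nullVec (D.mdiff_n p) D.legendre.unit
    rw [hx, hy, third_eq_lor (D.mdiff_n p), lor_add_left, lor_add_right, lor_add_right]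
    simp only [lor_smul_left, lor_smul_right]
    rw [z, lor_comm (nullVec n p), z, D.lor_nullVec]
    ring
  have I' : ∀ {x y : TangentSpace (𝓡 2) p} {r s ρ σ : ℝ},
      diff S p x = (r • diff (nullVec n') p x : R41) + s • nullVec n' p →
      diff S p y = (ρ • diff (nullVec n') p y : R41) + σ • nullVec n' p →
      lor (diff S p x) (diff S p y) = r * ρ * third n' p x y := by
    intro x y r s ρ σ hx hy
    have z := lor_diff_nullVec (D.mdiff_n' p) D.legendre'.unit
    rw [hx, hy, third_eq_lor (D.mdiff_n' p), lor_add_left, lor_add_right, lor_add_right]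
    simp only [lor_smul_left, lor_smul_right]
    rw [z, lor_comm (nullVec n' p), z, D.lor_nullVec']
    ring
  have pv := D.spacelike.pos p v hv0
  have pw := D.spacelike.pos p w hw0
  have tv : 0 < third n p v v := D.legendre.third_pos p v hv0
  have tw : 0 < third n p w w := D.legendre.third_pos p w hw0
  have a1 := I e1 e1
  have a2 := I' e2 e2
  have a3 := I e3 e3
  have a4 := I' e4 e4
  have a5 := I e1 e3
  have a6 := I' e2 e4
  rw [hconf] at a2 a4 a6
  have r0 : r ≠ 0 := by rintro rfl; rw [a1] at pv; simp at pv
  have r0' : r' ≠ 0 := by rintro rfl; rw [a2] at pv; simp at pv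
  have ρ0 : ρ ≠ 0 := by rintro rfl; rw [a3] at pw; simp at pw
  have ρ0' : ρ' ≠ 0 := by rintro rfl; rw [a4] at pw; simp at pw
  -- The induced metric on `v` is r² III = r'² III', and III' = c III; likewise for `w`.
  have m2 : (r / r') ^ 2 = c := by
    rw [div_pow, div_eq_iff (pow_ne_zero 2 r0')]
    apply mul_right_cancel₀ tv.ne'
    linarith
  have m2' : (ρ / ρ') ^ 2 = c := by
    rw [div_pow, div_eq_iff (pow_ne_zero 2 ρ0')]
    apply mul_right_cancel₀ tw.ne'
    linarith
  refine ⟨v, w, r / r', ρ / ρ', r, ρ, hi, div_ne_zero r0 r0', r0, ρ0, ?_, ?_⟩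
  · intro y hy hy'
    rw [lor_comm] at hy hy'
    have b1 : lor (diff S p v) y = r * lor (diff (nullVec n) p v) y := by
      rw [e1, lor_add_left, lor_smul_left, lor_smul_left, hy]; ring
    have b2 : lor (diff S p v) y = r' * lor (diff (nullVec n') p v) y := by
      rw [e2, lor_add_left, lor_smul_left, lor_smul_left, hy']; ring
    have b3 : lor (diff S p w) y = ρ * lor (diff (nullVec n) p w) y := by
      rw [e3, lor_add_left, lor_smul_left, lor_smul_left, hy]; ring
    have b4 : lor (diff S p w) y = ρ' * lor (diff (nullVec n') p w) y := by
      rw [e4, lor_add_left, lor_smul_left, lor_smul_left, hy']; ring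
    refine ⟨b1, b3, ?_, ?_⟩
    · field_simp; linarith
    · field_simp; linarith
  · rcases sq_eq_sq_iff_eq_or_eq_neg.mp (m2'.trans m2.symm) with e | e
    · exact Or.inl e
    · refine Or.inr ⟨e, ?_⟩
      -- Opposite factors give the mixed term of the induced metric two values of opposite sign, so
      -- III(v, w) = 0.
      have hmm : r * ρ = -(c * (r' * ρ')) := by
        rw [← m2]
        field_simp at e ⊢
        linear_combination e
      have : r * ρ * third n p v w = r' * ρ' * (c * third n p v w) := by rw [← a5, ← a6]
      have h2 : (r * ρ) * third n p v w = 0 := by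
        linear_combination (1 / 2 : ℝ) * this + (1 / 2 : ℝ) * third n p v w * hmm
      exact (mul_eq_zero.mp h2).resolve_left (mul_ne_zero r0 ρ0)

omit D in
lemma exists_comb (p : M) {v w : TangentSpace (𝓡 2) p} (hi : LinearIndependent ℝ ![v, w])
    (u : TangentSpace (𝓡 2) p) : ∃ α β : ℝ, u = α • v + β • w := by
  have hs := hi.span_eq_top_of_card_eq_finrank' (by rw [finrank_tangentSpace p]; rfl)
  have hu : u ∈ Submodule.span ℝ (Set.range ![v, w]) := by rw [hs]; trivial
  rw [Matrix.range_cons, Matrix.range_cons, Matrix.range_empty, Set.union_empty,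
    Set.singleton_union] at hu
  obtain ⟨α, β, h⟩ := Submodule.mem_span_pair.mp hu
  exact ⟨α, β, h.symm⟩

/-- The second fundamental form with respect to the first null normal is nondegenerate. -/
lemma nondeg (p : M) (u : TangentSpace (𝓡 2) p)
    (hu : ∀ x, lor (diff (nullVec n) p u) (diff S p x) = 0) : u = 0 := by
  obtain ⟨v, w, m, m', r, ρ, hi, -, r0, ρ0, hy, -⟩ := D.dichotomy p
  obtain ⟨α, β, rfl⟩ := exists_comb p hi u
  -- The test vector x is chosen so that `dS x` and `dN u` agree in the screen; then ⟨dN u, dS x⟩ is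
  -- the induced square norm of x.
  have h1 := hu ((α / r) • v + (β / ρ) • w)
  obtain ⟨e1, e2, -, -⟩ := hy _ (D.lor_diff_fst p ((α / r) • v + (β / ρ) • w)) (D.lor_diff_snd p _)
  have h2 : lor (diff S p ((α / r) • v + (β / ρ) • w)) (diff S p ((α / r) • v + (β / ρ) • w)) = 0 := by
    set x := (α / r) • v + (β / ρ) • w with hx
    have : (diff S p x : R41) = (α / r) • (diff S p v : R41) + (β / ρ) • (diff S p w : R41) := by
      rw [hx, map_add, map_smul, map_smul]
    rw [map_add, map_smul, map_smul, lor_add_left, lor_smul_left, lor_smul_left] at h1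
    conv_lhs => arg 1; rw [this]
    rw [lor_add_left, lor_smul_left, lor_smul_left, e1, e2, ← h1]
    field_simp
  have h3 : (α / r) • v + (β / ρ) • w = 0 := by
    by_contra h0
    exact (D.spacelike.pos p _ h0).ne' h2
  obtain ⟨k1, k2⟩ := LinearIndependent.pair_iff.mp hi _ _ h3
  have k3 : α = 0 := by simpa [r0] using k1
  have k4 : β = 0 := by simpa [ρ0] using k2
  rw [k3, k4]; simp

end IsDarboux
end Darboux
end Laguerre

namespace Laguerre

/-! ### Degenerate Darboux congruences -/

section Degenerate

variable {M : Type*} [TopologicalSpace M] [ChartedSpace (EuclideanSpace ℝ (Fin 2)) M]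
  {S : M → R41} {f n f' n' : M → R3}

/-- The second fundamental form of `S` with respect to the null normal of a contact element. -/
noncomputable def sff (S : M → R41) (n : M → R3) (p : M) (v x : TangentSpace (𝓡 2) p) : ℝ :=
  lor (diff (nullVec n) p v) (diff S p x)

lemma sff_comb (p : M) (α β : ℝ) (v w x : TangentSpace (𝓡 2) p) :
    sff S n p (α • v + β • w) x = α * sff S n p v x + β * sff S n p w x := by
  simp only [sff, map_add, map_smul]
  exact (lor_add_left _ _ _).trans (by rw [lor_smul_left, lor_smul_left])

/-- The determinant of the second fundamental form in a basis. -/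
noncomputable def sffDet (S : M → R41) (n : M → R3) (p : M) (v w : TangentSpace (𝓡 2) p) : ℝ :=
  sff S n p v v * sff S n p w w - sff S n p v w * sff S n p w v

/-- The second fundamental forms with respect to the two null normals are proportional. -/
def Proportional (S : M → R41) (n n' : M → R3) (p : M) (k : ℝ) : Prop :=
  ∀ v x : TangentSpace (𝓡 2) p, sff S n' p v x = k * sff S n p v x

lemma exists_basis_pair : ∃ e₁ e₂ : EuclideanSpace ℝ (Fin 2), LinearIndependent ℝ ![e₁, e₂] ∧
    Submodule.span ℝ {e₁, e₂} = ⊤ := by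
  let b := Module.finBasisOfFinrankEq ℝ (EuclideanSpace ℝ (Fin 2)) finrank_euclideanSpace_fin
  have hb : (![b 0, b 1] : Fin 2 → EuclideanSpace ℝ (Fin 2)) = b := by
    funext i; fin_cases i <;> rfl
  refine ⟨b 0, b 1, by rw [hb]; exact b.linearIndependent, ?_⟩
  rw [← b.span_eq, ← hb, Matrix.range_cons, Matrix.range_cons, Matrix.range_empty, Set.union_empty,
    Set.singleton_union]
  rfl

lemma IsParam.linearIndependent {F : Type*} [NormedAddCommGroup F] [NormedSpace ℝ F] {Φ : F → M}
    {χ : M → F} {Ω : Set F} {U : Set M} (h : IsParam Φ χ Ω U) {x : F} (hx : x ∈ Ω) {e₁ e₂ : F}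
    (he : LinearIndependent ℝ ![e₁, e₂]) :
    LinearIndependent ℝ ![paramDiff Φ x e₁, paramDiff Φ x e₂] := by
  rw [LinearIndependent.pair_iff] at he ⊢
  intro s t hst
  apply he
  apply h.paramDiff_injective hx
  rw [map_add, map_smul, map_smul, hst, map_zero]

namespace IsDarboux

variable (D : IsDarboux S f n f' n')
include D

lemma contMDiff_N : ContMDiff (𝓡 2) 𝓘(ℝ, R41) ∞ (nullVec n) := contMDiff_nullVec D.legendre.smooth_n
lemma contMDiff_N' : ContMDiff (𝓡 2) 𝓘(ℝ, R41) ∞ (nullVec n') :=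
  contMDiff_nullVec D.legendre'.smooth_n

lemma sffDet_ne_zero (p : M) {v w : TangentSpace (𝓡 2) p} (hi : LinearIndependent ℝ ![v, w]) :
    sffDet S n p v w ≠ 0 := by
  intro h0
  unfold sffDet at h0
  have ext : ∀ u, sff S n p u v = 0 → sff S n p u w = 0 → u = 0 := by
    intro u h1 h2
    refine D.nondeg p u fun x => ?_
    obtain ⟨α, β, rfl⟩ := exists_comb p hi x
    change lor _ _ = 0 at h1
    change lor _ _ = 0 at h2
    rw [map_add, map_smul, map_smul]
    exact (lor_add_right _ _ _).trans (by rw [lor_smul_right, lor_smul_right, h1, h2]; ring)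
  -- Cofactor combinations lie in the kernel when the determinant vanishes.
  have h1 := ext (sff S n p w v • v + (-sff S n p v v) • w)
    (by rw [sff_comb]; ring) (by rw [sff_comb]; linarith)
  have h2 := ext (sff S n p w w • v + (-sff S n p v w) • w)
    (by rw [sff_comb]; linarith) (by rw [sff_comb]; ring)
  obtain ⟨-, k1⟩ := LinearIndependent.pair_iff.mp hi _ _ h1
  obtain ⟨-, k2⟩ := LinearIndependent.pair_iff.mp hi _ _ h2
  exact hi.ne_zero 0 (ext v (neg_eq_zero.mp k1) (neg_eq_zero.mp k2))

lemma proportional_ne_zero {p : M} {k : ℝ} (h : Proportional S n n' p k) : k ≠ 0 := by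
  rintro rfl
  obtain ⟨v, w, m, m', r, ρ, hi, hm, -, -, hy, -⟩ := D.dichotomy p
  refine hi.ne_zero 0 (D.nondeg p v fun x => ?_)
  obtain ⟨-, -, e, -⟩ := hy _ (D.lor_diff_fst p x) (D.lor_diff_snd p x)
  have := h v x
  rw [zero_mul, sff, e] at this
  exact (mul_eq_zero.mp this).resolve_left hm

lemma proportional_unique {p : M} {k k' : ℝ} (h : Proportional S n n' p k)
    (h' : Proportional S n n' p k') : k = k' := by
  obtain ⟨v, w, -, -, -, -, hi, -⟩ := D.dichotomy p
  by_contra hne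
  refine hi.ne_zero 0 (D.nondeg p v fun x => ?_)
  have := (h v x).symm.trans (h' v x)
  exact (mul_eq_mul_right_iff.mp this).resolve_left hne

lemma sffDet_mul_pos {p : M} {k : ℝ} (h : Proportional S n n' p k) {v w : TangentSpace (𝓡 2) p}
    (hi : LinearIndependent ℝ ![v, w]) : 0 < sffDet S n p v w * sffDet S n' p v w := by
  have h1 : sffDet S n' p v w = k ^ 2 * sffDet S n p v w := by
    unfold sffDet; rw [h, h, h, h]; ring
  have h2 := D.sffDet_ne_zero p hi
  have h3 := D.proportional_ne_zero h
  rw [h1, show sffDet S n p v w * (k ^ 2 * sffDet S n p v w) = (k * sffDet S n p v w) ^ 2 by ring]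
  positivity

/-- The case of opposite orientations. -/
lemma opposite {p : M} (h : ¬∃ k, Proportional S n n' p k) :
    ∃ (v w : TangentSpace (𝓡 2) p) (m : ℝ), LinearIndependent ℝ ![v, w] ∧ m ≠ 0 ∧
      third n p v w = 0 ∧
      ∀ y, lor y (nullVec n p) = 0 → lor y (nullVec n' p) = 0 →
        lor (diff (nullVec n') p v) y = m * lor (diff (nullVec n) p v) y ∧
        lor (diff (nullVec n') p w) y = -m * lor (diff (nullVec n) p w) y := by
  obtain ⟨v, w, m, m', r, ρ, hi, hm, -, -, hy, hd⟩ := D.dichotomy p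
  rcases hd with rfl | ⟨rfl, ht⟩
  · refine absurd ⟨m', fun u x => ?_⟩ h
    obtain ⟨-, -, e1, e2⟩ := hy _ (D.lor_diff_fst p x) (D.lor_diff_snd p x)
    obtain ⟨α, β, rfl⟩ := exists_comb p hi u
    rw [sff_comb, sff_comb]
    simp only [sff]
    rw [e1, e2]
    ring
  · exact ⟨v, w, m, hi, hm, ht, fun y h1 h2 => ⟨(hy y h1 h2).2.2.1, (hy y h1 h2).2.2.2⟩⟩

lemma sffDet_mul_neg {p : M} (h : ¬∃ k, Proportional S n n' p k) {e₁ e₂ : TangentSpace (𝓡 2) p}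
    (he : LinearIndependent ℝ ![e₁, e₂]) : sffDet S n p e₁ e₂ * sffDet S n' p e₁ e₂ < 0 := by
  obtain ⟨v, w, m, hi, hm, -, hy⟩ := D.opposite h
  have h2 := D.sffDet_ne_zero p he
  have h1 : sffDet S n' p e₁ e₂ = -m ^ 2 * sffDet S n p e₁ e₂ := by
    obtain ⟨α, β, h1⟩ := exists_comb p hi e₁
    obtain ⟨γ, δ, h2⟩ := exists_comb p hi e₂
    have hv : ∀ x, sff S n' p v x = m * sff S n p v x := fun x =>
      (hy _ (D.lor_diff_fst p x) (D.lor_diff_snd p x)).1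
    have hw : ∀ x, sff S n' p w x = -m * sff S n p w x := fun x =>
      (hy _ (D.lor_diff_fst p x) (D.lor_diff_snd p x)).2
    have g1 : ∀ (n : M → R3) x, sff S n p e₁ x = α * sff S n p v x + β * sff S n p w x := fun n x => by
      rw [← sff_comb, ← h1]
    have g2 : ∀ (n : M → R3) x, sff S n p e₂ x = γ * sff S n p v x + δ * sff S n p w x := fun n x => by
      rw [← sff_comb, ← h2]
    unfold sffDet
    rw [g1, g1, g2, g2, g1 n, g1 n, g2 n, g2 n, hv, hv, hw, hw]
    ring
  rw [h1, show sffDet S n p e₁ e₂ * (-m ^ 2 * sffDet S n p e₁ e₂)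
    = -(m * sffDet S n p e₁ e₂) ^ 2 by ring]
  have := mul_ne_zero hm h2
  have : 0 < (m * sffDet S n p e₁ e₂) ^ 2 := by positivity
  linarith

lemma sff_param {Φ : EuclideanSpace ℝ (Fin 2) → M} {χ : M → EuclideanSpace ℝ (Fin 2)}
    {Ω : Set (EuclideanSpace ℝ (Fin 2))} {U : Set M} (hΦ : IsParam Φ χ Ω U) {x} (hx : x ∈ Ω)
    (u w : EuclideanSpace ℝ (Fin 2)) :
    sff S n (Φ x) (paramDiff Φ x u) (paramDiff Φ x w)
      = lor (fderiv ℝ (fun y => nullVec n (Φ y)) x u) (fderiv ℝ (fun y => S (Φ y)) x w) := by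
  rw [hΦ.fderiv_comp hx (D.contMDiff_N.mdifferentiableAt (by simp)),
    hΦ.fderiv_comp hx (D.mdiff_S _)]
  rfl

lemma sff_param' {Φ : EuclideanSpace ℝ (Fin 2) → M} {χ : M → EuclideanSpace ℝ (Fin 2)}
    {Ω : Set (EuclideanSpace ℝ (Fin 2))} {U : Set M} (hΦ : IsParam Φ χ Ω U) {x} (hx : x ∈ Ω)
    (u w : EuclideanSpace ℝ (Fin 2)) :
    sff S n' (Φ x) (paramDiff Φ x u) (paramDiff Φ x w)
      = lor (fderiv ℝ (fun y => nullVec n' (Φ y)) x u) (fderiv ℝ (fun y => S (Φ y)) x w) := by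
  rw [hΦ.fderiv_comp hx (D.contMDiff_N'.mdifferentiableAt (by simp)),
    hΦ.fderiv_comp hx (D.mdiff_S _)]
  rfl

variable [IsManifold (𝓡 2) ∞ M]

/-- In a coordinate basis the product of the determinants of the two second fundamental forms is
continuous and nowhere zero, positive in the proportional case and negative otherwise. -/
lemma isClopen_proportional : IsClopen {p | ∃ k, Proportional S n n' p k} := by
  obtain ⟨e₁, e₂, he, -⟩ := exists_basis_pair
  have key : ∀ p₀ : M, ∃ (U : Set M) (d : M → ℝ), IsOpen U ∧ p₀ ∈ U ∧ ContinuousOn d U ∧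
      ∀ q ∈ U, ((∃ k, Proportional S n n' q k) → 0 < d q) ∧
        ((¬∃ k, Proportional S n n' q k) → d q < 0) := by
    intro p₀
    obtain ⟨Φ, χ, Ω, U, hΦ, hpU⟩ := exists_isParam p₀
    have cs : ∀ (n : M → R3), ContMDiff (𝓡 2) 𝓘(ℝ, R41) ∞ (nullVec n) → ∀ u w,
        ContDiffOn ℝ ∞ (fun x => lor (fderiv ℝ (fun y => nullVec n (Φ y)) x u)
          (fderiv ℝ (fun y => S (Φ y)) x w)) Ω := fun n hn u w =>
      ContDiffOn.lor (contDiffOn_fderiv_apply hΦ.isOpen_dom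
        (hΦ.contDiffOn_comp hn.contMDiffOn (Set.subset_univ _)) u)
        (contDiffOn_fderiv_apply hΦ.isOpen_dom
          (hΦ.contDiffOn_comp D.spacelike.smooth.contMDiffOn (Set.subset_univ _)) w)
    have c1 := cs n D.contMDiff_N
    have c2 := cs n' D.contMDiff_N'
    set H : EuclideanSpace ℝ (Fin 2) → EuclideanSpace ℝ (Fin 2) → EuclideanSpace ℝ (Fin 2) → ℝ :=
      fun u w x => lor (fderiv ℝ (fun y => nullVec n (Φ y)) x u)
          (fderiv ℝ (fun y => S (Φ y)) x w) with hH
    set H' : EuclideanSpace ℝ (Fin 2) → EuclideanSpace ℝ (Fin 2) → EuclideanSpace ℝ (Fin 2) → ℝ :=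
      fun u w x => lor (fderiv ℝ (fun y => nullVec n' (Φ y)) x u)
          (fderiv ℝ (fun y => S (Φ y)) x w) with hH'
    have cd : ContinuousOn (fun x => (H e₁ e₁ x * H e₂ e₂ x - H e₁ e₂ x * H e₂ e₁ x)
        * (H' e₁ e₁ x * H' e₂ e₂ x - H' e₁ e₂ x * H' e₂ e₁ x)) Ω :=
      ((((c1 e₁ e₁).mul (c1 e₂ e₂)).sub ((c1 e₁ e₂).mul (c1 e₂ e₁))).mul
        (((c2 e₁ e₁).mul (c2 e₂ e₂)).sub ((c2 e₁ e₂).mul (c2 e₂ e₁)))).continuousOn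
    refine ⟨U, fun q => (fun x => (H e₁ e₁ x * H e₂ e₂ x - H e₁ e₂ x * H e₂ e₁ x)
        * (H' e₁ e₁ x * H' e₂ e₂ x - H' e₁ e₂ x * H' e₂ e₁ x)) (χ q), hΦ.isOpen_ran, hpU,
        cd.comp hΦ.smooth_inv.continuousOn hΦ.mapsTo_inv, ?_⟩
    intro q hq
    obtain ⟨x, hx, rfl⟩ : ∃ x ∈ Ω, Φ x = q := ⟨χ q, hΦ.mapsTo_inv q hq, hΦ.right_inv q hq⟩
    have hi := hΦ.linearIndependent hx he
    have e : (fun x => (H e₁ e₁ x * H e₂ e₂ x - H e₁ e₂ x * H e₂ e₁ x)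
        * (H' e₁ e₁ x * H' e₂ e₂ x - H' e₁ e₂ x * H' e₂ e₁ x)) (χ (Φ x))
        = sffDet S n (Φ x) (paramDiff Φ x e₁) (paramDiff Φ x e₂)
          * sffDet S n' (Φ x) (paramDiff Φ x e₁) (paramDiff Φ x e₂) := by
      rw [hΦ.left_inv x hx]
      simp only [sffDet, D.sff_param hΦ hx, D.sff_param' hΦ hx, hH, hH']
    simp only [] at e ⊢
    rw [e]
    exact ⟨fun ⟨k, hk⟩ => D.sffDet_mul_pos hk hi, fun hk => D.sffDet_mul_neg hk hi⟩
  constructor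
  · rw [← isOpen_compl_iff, isOpen_iff_mem_nhds]
    intro p hp
    obtain ⟨U, d, hU, hpU, hd, hs⟩ := key p
    have ho := hd.isOpen_inter_preimage hU (isOpen_Iio (a := (0 : ℝ)))
    refine Filter.mem_of_superset (ho.mem_nhds ⟨hpU, (hs p hpU).2 hp⟩) ?_
    rintro q ⟨hq, hq'⟩ hq2
    exact lt_asymm hq' ((hs q hq).1 hq2)
  · rw [isOpen_iff_mem_nhds]
    intro p hp
    obtain ⟨U, d, hU, hpU, hd, hs⟩ := key p
    have ho := hd.isOpen_inter_preimage hU (isOpen_Ioi (a := (0 : ℝ)))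
    refine Filter.mem_of_superset (ho.mem_nhds ⟨hpU, (hs p hpU).1 hp⟩) ?_
    rintro q ⟨hq, hq'⟩
    by_contra hq2
    exact lt_asymm hq' ((hs q hq).2 hq2)

omit D [IsManifold (𝓡 2) ∞ M] in
/-- `v` generates the normal line that is parallel where the second fundamental forms are
proportional. -/
def _root_.Laguerre.IsParallelNormal (S : M → R41) (n n' : M → R3) (p : M) (v : R41) : Prop :=
  ∃ k σ : ℝ, σ ≠ 0 ∧ Proportional S n n' p k ∧ v = σ • (nullVec n' p - k • nullVec n p)

/-- Where the second fundamental forms are proportional, a constant vector is a normal, and `S`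
lies locally in a sphere complex. -/
lemma exists_parallel {p : M} (hp : ∃ k, Proportional S n n' p k) :
    ∃ v : R41, ∀ᶠ q in nhds p, IsParallelNormal S n n' q v ∧ lor v (S q) = lor v (S p) := by
  obtain ⟨e₁, e₂, he, hspan⟩ := exists_basis_pair
  obtain ⟨Φ, χ, Ω, U, hΦ, hpU⟩ := exists_isParam p
  have hR := hΦ.restrict D.isClopen_proportional.isOpen
  set Ω' := Ω ∩ Φ ⁻¹' {p | ∃ k, Proportional S n n' p k}
  have hpU' : p ∈ U ∩ {p | ∃ k, Proportional S n n' p k} := ⟨hpU, hp⟩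
  have hx₀ : χ p ∈ Ω' := hR.mapsTo_inv p hpU'
  obtain ⟨ε, hε, hball⟩ := Metric.isOpen_iff.mp hR.isOpen_dom _ hx₀
  set B := Metric.ball (χ p) ε
  have hB : IsOpen B := Metric.isOpen_ball
  have hpB : χ p ∈ B := Metric.mem_ball_self hε
  have sm : ∀ {b : M → R41}, ContMDiff (𝓡 2) 𝓘(ℝ, R41) ∞ b → ContDiffOn ℝ ∞ (fun x => b (Φ x)) B :=
    fun hb => (hR.contDiffOn_comp hb.contMDiffOn (Set.subset_univ _)).mono hball
  have cS := sm D.spacelike.smooth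
  have cN := sm D.contMDiff_N
  have cN' := sm D.contMDiff_N'
  set s := fun x => S (Φ x) with hs
  set N := fun x => nullVec n (Φ x) with hN
  set N' := fun x => nullVec n' (Φ x) with hN'
  set H : EuclideanSpace ℝ (Fin 2) → EuclideanSpace ℝ (Fin 2) → EuclideanSpace ℝ (Fin 2) → ℝ :=
    fun u w x => lor (fderiv ℝ N x u) (fderiv ℝ s x w) with hH
  set H' : EuclideanSpace ℝ (Fin 2) → EuclideanSpace ℝ (Fin 2) → EuclideanSpace ℝ (Fin 2) → ℝ :=
    fun u w x => lor (fderiv ℝ N' x u) (fderiv ℝ s x w) with hH'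
  -- A determinant quotient, with the first row of H replaced by that of H', recovers the factor as
  -- a smooth function.
  set k : EuclideanSpace ℝ (Fin 2) → ℝ := fun x =>
    (H' e₁ e₁ x * H e₂ e₂ x - H' e₁ e₂ x * H e₂ e₁ x)
      / (H e₁ e₁ x * H e₂ e₂ x - H e₁ e₂ x * H e₂ e₁ x) with hk
  have cH : ∀ u w, ContDiffOn ℝ ∞ (H u w) B := fun u w =>
    ContDiffOn.lor (contDiffOn_fderiv_apply hB cN u) (contDiffOn_fderiv_apply hB cS w)
  have cH' : ∀ u w, ContDiffOn ℝ ∞ (H' u w) B := fun u w =>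
    ContDiffOn.lor (contDiffOn_fderiv_apply hB cN' u) (contDiffOn_fderiv_apply hB cS w)
  have eH : ∀ x ∈ B, ∀ u w, H u w x = sff S n (Φ x) (paramDiff Φ x u) (paramDiff Φ x w) :=
    fun x hx u w => (D.sff_param hR (hball hx) u w).symm
  have eH' : ∀ x ∈ B, ∀ u w, H' u w x = sff S n' (Φ x) (paramDiff Φ x u) (paramDiff Φ x w) :=
    fun x hx u w => (D.sff_param' hR (hball hx) u w).symm
  have hdet : ∀ x ∈ B, H e₁ e₁ x * H e₂ e₂ x - H e₁ e₂ x * H e₂ e₁ x ≠ 0 := by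
    intro x hx
    rw [eH x hx, eH x hx, eH x hx, eH x hx]
    exact D.sffDet_ne_zero _ (hR.linearIndependent (hball hx) he)
  have hprop : ∀ x ∈ B, Proportional S n n' (Φ x) (k x) := by
    intro x hx
    obtain ⟨κ, hκ⟩ : ∃ κ, Proportional S n n' (Φ x) κ := (hball hx).2
    have : k x = κ := by
      simp only [hk]
      rw [div_eq_iff (hdet x hx), eH' x hx, eH' x hx, hκ, hκ, ← eH x hx, ← eH x hx]
      ring
    rwa [this]
  have ds : ∀ x ∈ B, ∀ u, fderiv ℝ s x u = diff S (Φ x) (paramDiff Φ x u) := fun x hx u =>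
    hR.fderiv_comp (hball hx) (D.mdiff_S _) u
  have dN : ∀ x ∈ B, ∀ u, fderiv ℝ N x u = diff (nullVec n) (Φ x) (paramDiff Φ x u) :=
    fun x hx u => hR.fderiv_comp (hball hx) (D.contMDiff_N.mdifferentiableAt (by simp)) u
  have ck : ContDiffOn ℝ ∞ k B :=
    (((cH' e₁ e₁).mul (cH e₂ e₂)).sub ((cH' e₁ e₂).mul (cH e₂ e₁))).div
      (((cH e₁ e₁).mul (cH e₂ e₂)).sub ((cH e₁ e₂).mul (cH e₂ e₁))) hdet
  have main := fun x (hx : x ∈ B) => constant_normal_of_proportional (k := k) hB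
    (convex_ball (χ p) ε).isPreconnected cS cN cN'
    ck
    (fun x _ => D.lor_nullVec (Φ x)) (fun x _ => D.lor_nullVec' (Φ x))
    (fun x _ => (D.lor_nullVec_neg (Φ x)).ne)
    (fun x hx u => by rw [ds x hx]; exact D.lor_diff_fst _ _)
    (fun x hx u => by rw [ds x hx]; exact D.lor_diff_snd _ _)
    (fun x hx y hy => D.normal_eq (Φ x) y fun v => by
      obtain ⟨u, rfl⟩ := hR.paramDiff_surjective (hball hx) v
      rw [← ds x hx]; exact hy u)
    (fun x hx => D.proportional_ne_zero (hprop x hx))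
    (fun x hx u w => by
      have := hprop x hx (paramDiff Φ x u) (paramDiff Φ x w)
      rw [← eH x hx, ← eH' x hx] at this
      exact this)
    (fun x hx u hu => by
      have : paramDiff Φ x u = 0 := by
        refine D.nondeg (Φ x) _ fun v => ?_
        obtain ⟨w, rfl⟩ := hR.paramDiff_surjective (hball hx) v
        rw [← ds x hx, ← dN x hx]
        exact hu w
      exact hR.paramDiff_injective (hball hx) (by rw [this, map_zero]))
    he hspan hpB hx
  refine ⟨N' (χ p) - k (χ p) • N (χ p), ?_⟩
  have hopen : IsOpen ((U ∩ {p | ∃ k, Proportional S n n' p k}) ∩ χ ⁻¹' B) :=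
    hR.smooth_inv.continuousOn.isOpen_inter_preimage hR.isOpen_ran hB
  filter_upwards [hopen.mem_nhds ⟨hpU', hpB⟩] with q hq
  obtain ⟨⟨σ, hσ, e1⟩, e2⟩ := main (χ q) hq.2
  have hq' := hR.right_inv q hq.1
  constructor
  · refine ⟨k (χ q), σ, hσ, ?_, ?_⟩
    · have := hprop _ hq.2
      rwa [hq'] at this
    · rw [e1]; simp only [hN, hN', hq']
  · simp only [hs] at e2
    rw [hq', hR.right_inv p hpU'] at e2
    exact e2

omit [IsManifold (𝓡 2) ∞ M] in
lemma isParallelNormal_unique {p : M} {v v' : R41} (h : IsParallelNormal S n n' p v)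
    (h' : IsParallelNormal S n n' p v') : ∃ t : ℝ, t ≠ 0 ∧ v' = t • v := by
  obtain ⟨k, σ, hσ, hk, rfl⟩ := h
  obtain ⟨k', σ', hσ', hk', rfl⟩ := h'
  obtain rfl := D.proportional_unique hk hk'
  exact ⟨σ' / σ, div_ne_zero hσ' hσ, by rw [smul_smul, div_mul_cancel₀ _ hσ]⟩

omit D [IsManifold (𝓡 2) ∞ M] in
lemma _root_.Laguerre.IsParallelNormal.smul {p : M} {v : R41} (h : IsParallelNormal S n n' p v)
    {t : ℝ} (ht : t ≠ 0) : IsParallelNormal S n n' p (t • v) := by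
  obtain ⟨k, σ, hσ, hk, rfl⟩ := h
  exact ⟨k, t * σ, mul_ne_zero ht hσ, hk, by rw [smul_smul]⟩

/-- The second fundamental forms of a nondegenerate Darboux congruence with respect to the two null
normals are nowhere proportional. -/
lemma not_proportional (hnd : IsNondegenerate S) (p : M) : ¬∃ k, Proportional S n n' p k := by
  intro hp
  obtain ⟨v, hv⟩ := D.exists_parallel hp
  obtain ⟨hvp, -⟩ := hv.self_of_nhds
  have hclopen : IsClopen {q | IsParallelNormal S n n' q v ∧ lor v (S q) = lor v (S p)} := by
    constructor
    · rw [← isOpen_compl_iff, isOpen_iff_mem_nhds]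
      intro q hq
      -- Closedness: near a proportional point there is a local constant parallel normal `w`. If the
      -- set met that neighbourhood, `v` would be a multiple of `w`, and both conditions would hold
      -- at `q` itself.
      by_cases hqk : ∃ k, Proportional S n n' q k
      · obtain ⟨w, hw⟩ := D.exists_parallel hqk
        obtain ⟨hwq, -⟩ := hw.self_of_nhds
        filter_upwards [hw] with q' hq' hq2
        apply hq
        obtain ⟨t, ht, rfl⟩ := D.isParallelNormal_unique hq'.1 hq2.1
        refine ⟨hwq.smul ht, ?_⟩
        have h2 := hq2.2
        simp only [lor_smul_left] at h2 ⊢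
        rw [← h2, hq'.2]
      · filter_upwards [D.isClopen_proportional.compl.isOpen.mem_nhds hqk] with q' hq' hq2
        obtain ⟨k, σ, -, hk, -⟩ := hq2.1
        exact hq' ⟨k, hk⟩
    · rw [isOpen_iff_mem_nhds]
      rintro q ⟨hq1, hq2⟩
      obtain ⟨k, σ, -, hk, -⟩ := id hq1
      obtain ⟨w, hw⟩ := D.exists_parallel ⟨k, hk⟩
      obtain ⟨hwq, -⟩ := hw.self_of_nhds
      obtain ⟨t, ht, rfl⟩ := D.isParallelNormal_unique hwq hq1
      filter_upwards [hw] with q' hq'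
      refine ⟨hq'.1.smul ht, ?_⟩
      rw [← hq2, lor_smul_left, lor_smul_left, hq'.2]
  have hsub := hclopen.connectedComponent_subset (x := p) ⟨hvp, rfl⟩
  refine hnd p ⟨v, lor v (S p), ?_, fun q hq => ?_⟩
  · rintro rfl
    obtain ⟨k, σ, hσ, -, e⟩ := hvp
    have e' : nullVec n' p = k • nullVec n p := by
      rw [← sub_eq_zero]
      exact (smul_eq_zero.mp e.symm).resolve_left hσ
    have := D.lor_nullVec_neg p
    rw [e', lor_smul_right, D.lor_nullVec, mul_zero] at this
    exact lt_irrefl _ this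
  · rw [lor_comm]; exact (hsub hq).2

end IsDarboux
end Degenerate
end Laguerre

namespace Laguerre

/-! ### Existence of adapted curved flat framings -/

section Existence

variable {M : Type*} [TopologicalSpace M] [ChartedSpace (EuclideanSpace ℝ (Fin 2)) M]

section Smooth

variable {U : Set M} {x y z : M → R41}

lemma contMDiffOn_lor (hx : ContMDiffOn (𝓡 2) 𝓘(ℝ, R41) ∞ x U)
    (hy : ContMDiffOn (𝓡 2) 𝓘(ℝ, R41) ∞ y U) :
    ContMDiffOn (𝓡 2) 𝓘(ℝ, ℝ) ∞ (fun p => lor (x p) (y p)) U := by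
  have h : ContDiff ℝ ∞ fun u : R41 × R41 => lor u.1 u.2 := by
    unfold lor; fun_prop
  exact h.contMDiff.comp_contMDiffOn (hx.prodMk_space hy)

lemma contMDiffOn_lcross (hx : ContMDiffOn (𝓡 2) 𝓘(ℝ, R41) ∞ x U)
    (hy : ContMDiffOn (𝓡 2) 𝓘(ℝ, R41) ∞ y U) (hz : ContMDiffOn (𝓡 2) 𝓘(ℝ, R41) ∞ z U) :
    ContMDiffOn (𝓡 2) 𝓘(ℝ, R41) ∞ (fun p => lcross (x p) (y p) (z p)) U := by
  have h : ContDiff ℝ ∞ fun u : R41 × R41 × R41 => lcross u.1 u.2.1 u.2.2 := by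
    rw [contDiff_pi]
    intro i
    fin_cases i <;> simp only [lcross, Fin.zero_eta, Fin.mk_one, Fin.reduceFinMk, Matrix.cons_val] <;>
      fun_prop
  exact h.contMDiff.comp_contMDiffOn (hx.prodMk_space (hy.prodMk_space hz))

lemma contMDiffOn_adFrame (hx : ContMDiffOn (𝓡 2) 𝓘(ℝ, R41) ∞ x U)
    (hy : ContMDiffOn (𝓡 2) 𝓘(ℝ, R41) ∞ y U) (hz : ContMDiffOn (𝓡 2) 𝓘(ℝ, R41) ∞ z U)
    (hxy : ∀ p ∈ U, lor (x p) (y p) ≠ 0) (hzz : ∀ p ∈ U, 0 < lor (z p) (z p)) (j : Fin 4) :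
    ContMDiffOn (𝓡 2) 𝓘(ℝ, R41) ∞ (fun p => adFrame (x p) (y p) (z p) j) U := by
  have smul : ∀ {c : M → ℝ} {w : M → R41}, ContMDiffOn (𝓡 2) 𝓘(ℝ, ℝ) ∞ c U →
      ContMDiffOn (𝓡 2) 𝓘(ℝ, R41) ∞ w U → ContMDiffOn (𝓡 2) 𝓘(ℝ, R41) ∞ (fun p => c p • w p) U :=
    fun hc hw => hc.smul hw
  have h3 := smul (c := fun p => (-lor (x p) (y p))⁻¹) (fun p hp =>
    ContMDiffAt.comp_contMDiffWithinAt p (g := fun t : ℝ => (-t)⁻¹)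
      (contDiffAt_id.neg.inv (neg_ne_zero.mpr (hxy p hp))).contMDiffAt
      (contMDiffOn_lor hx hy p hp)) hy
  have h1 := smul (c := fun p => (√(lor (z p) (z p)))⁻¹) (fun p hp =>
    ContMDiffAt.comp_contMDiffWithinAt p (g := fun t : ℝ => (√t)⁻¹)
      ((contDiffAt_id.sqrt (hzz p hp).ne').inv (Real.sqrt_pos.mpr (hzz p hp)).ne').contMDiffAt
      (contMDiffOn_lor hz hz p hp)) hz
  fin_cases j
  · exact hx
  · exact h1
  · exact contMDiffOn_lcross hx h1 h3
  · exact h3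

end Smooth

/-- Both equations assert the vanishing of a 2-form, so on a surface one basis decides. -/
lemma FlatAt.of_basis {a : Fin 4 → M → R41} {p : M} {v w : TangentSpace (𝓡 2) p}
    (hi : LinearIndependent ℝ ![v, w]) (h : FlatAt a p v w) (u u' : TangentSpace (𝓡 2) p) :
    FlatAt a p u u' := by
  obtain ⟨α, β, rfl⟩ := IsDarboux.exists_comb p hi u
  obtain ⟨γ, δ, rfl⟩ := IsDarboux.exists_comb p hi u'
  obtain ⟨h1, h2⟩ := h
  unfold FlatAt
  simp only [conn_add, conn_smul]
  constructor
  · linear_combination (α * δ - β * γ) * h1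
  · linear_combination (α * δ - β * γ) * h2

namespace IsDarboux

variable {S : M → R41} {f n f' n' : M → R3} (D : IsDarboux S f n f' n')
include D

lemma flatAt {a : Fin 4 → M → R41} {p : M} (h : ¬∃ k, Proportional S n n' p k)
    (ha : IsLaguerreFrame fun j => a j p) (h0 : a 0 = nullVec n)
    (h3 : a 3 = fun q => (-lor (nullVec n q) (nullVec n' q))⁻¹ • nullVec n' q)
    (hd : MDifferentiableAt (𝓡 2) 𝓘(ℝ, ℝ)
      (fun q => (-lor (nullVec n q) (nullVec n' q))⁻¹) p)
    (u u' : TangentSpace (𝓡 2) p) : FlatAt a p u u' := by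
  obtain ⟨v, w, m, hi, -, ht, hy⟩ := D.opposite h
  refine FlatAt.of_basis hi ?_ u u'
  set c := (-lor (nullVec n p) (nullVec n' p))⁻¹ with hc
  have hc0 : c ≠ 0 := inv_ne_zero (neg_ne_zero.mpr (D.lor_nullVec_neg p).ne)
  have n0 : ∀ i, lor (a i p) (a 0 p) = 0 → lor (a i p) (nullVec n p) = 0 := by
    intro i hi; rwa [h0] at hi
  have n3 : ∀ i, lor (a i p) (a 3 p) = 0 → lor (a i p) (nullVec n' p) = 0 := by
    intro i hi
    rw [h3, lor_smul_right] at hi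
    exact (mul_eq_zero.mp hi).resolve_left hc0
  have y0 : ∀ i, i = 1 ∨ i = 2 → lor (a i p) (nullVec n p) = 0 := by
    rintro i (rfl | rfl)
    · exact n0 1 ((ha.gram_eq 1 0).trans (by simp [gram]))
    · exact n0 2 ((ha.gram_eq 2 0).trans (by simp [gram]))
  have y3 : ∀ i, i = 1 ∨ i = 2 → lor (a i p) (nullVec n' p) = 0 := by
    rintro i (rfl | rfl)
    · exact n3 1 ((ha.gram_eq 1 3).trans (by simp [gram]))
    · exact n3 2 ((ha.gram_eq 2 3).trans (by simp [gram]))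
  have c3 : ∀ i, i = 1 ∨ i = 2 → ∀ x : TangentSpace (𝓡 2) p,
      conn a 3 i p x = c * lor (diff (nullVec n') p x) (a i p) := by
    intro i hi x
    have z := y3 i hi
    rw [lor_comm] at z
    rw [conn, h3, diff_smul hd (mdifferentiableAt_nullVec (D.mdiff_n' p)), lor_add_left,
      lor_smul_left, lor_smul_left, z, mul_zero, zero_add]
  have c0 : ∀ i, ∀ x : TangentSpace (𝓡 2) p,
      conn a 0 i p x = lor (diff (nullVec n) p x) (a i p) := by
    intro i x; rw [conn, h0]
  -- Orthogonality of `v` and `w` for III, in screen components. Since ψ is cmφ on `v` and -cmφ on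
  -- `w`, this is the first flatness equation; the second holds identically.
  have key : conn a 0 1 p v * conn a 0 1 p w + conn a 0 2 p v * conn a 0 2 p w = 0 := by
    have z := lor_diff_nullVec (D.mdiff_n p) D.legendre.unit
    rw [third_eq_lor (D.mdiff_n p), ha.lor_eq, h0, z, z] at ht
    rw [c0, c0, c0, c0]
    linarith
  obtain ⟨p1, p2⟩ := hy (a 1 p) (y0 1 (by simp)) (y3 1 (by simp))
  obtain ⟨p3, p4⟩ := hy (a 2 p) (y0 2 (by simp)) (y3 2 (by simp))
  rw [← c0] at p1 p2 p3 p4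
  have q1 := c3 1 (by simp) v
  have q2 := c3 1 (by simp) w
  have q3 := c3 2 (by simp) v
  have q4 := c3 2 (by simp) w
  rw [p1] at q1
  rw [p2] at q2
  rw [p3] at q3
  rw [p4] at q4
  unfold FlatAt
  rw [q1, q2, q3, q4]
  constructor
  · linear_combination (-2 * c * m) * key
  · ring

lemma isAdaptedAt {a : Fin 4 → M → R41} {p : M} (ha : IsLaguerreFrame fun j => a j p)
    (h0 : ∀ v, lor (diff S p v) (a 0 p) = 0) (h3 : ∀ v, lor (diff S p v) (a 3 p) = 0) :
    IsAdaptedAt S a p := by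
  have hr := ha.range_eq_span (finrank_tangentSpace p)
    (diff S p : TangentSpace (𝓡 2) p →ₗ[ℝ] R41) (D.diff_injective p) h0 h3
  refine ⟨congrArg (fun V : Submodule ℝ R41 => (V : Set R41)) hr, fun y => ⟨?_, ?_⟩⟩
  · rintro ⟨h, hy⟩
    have hmem : ∀ z ∈ ({a 1 p, a 2 p} : Set R41), lor y z = 0 := by
      intro z hz
      have : z ∈ LinearMap.range (diff S p : TangentSpace (𝓡 2) p →ₗ[ℝ] R41) := by
        rw [hr]; exact Submodule.subset_span hz
      obtain ⟨u, rfl⟩ := this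
      exact hy u
    have e := ha.expand y
    rw [hmem (a 1 p) (by simp), hmem (a 2 p) (by simp), zero_smul, zero_smul, add_zero,
      add_zero] at e
    rw [ha.lor_eq, hmem (a 1 p) (by simp), hmem (a 2 p) (by simp)] at h
    have h' : lor y (a 0 p) * lor y (a 3 p) = 0 := by linarith
    rcases mul_eq_zero.mp h' with h' | h'
    · rw [h', neg_zero, zero_smul, add_zero] at e
      exact ⟨_, Or.inl e⟩
    · rw [h', neg_zero, zero_smul, zero_add] at e
      exact ⟨_, Or.inr e⟩
  · have z0 := (ha.gram_eq 0 0).trans (show gram 0 0 = 0 by simp [gram])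
    have z3 := (ha.gram_eq 3 3).trans (show gram 3 3 = 0 by simp [gram])
    rintro ⟨t, rfl | rfl⟩
    · refine ⟨by rw [lor_smul_left, lor_smul_right, z0, mul_zero, mul_zero], fun v => ?_⟩
      rw [lor_smul_left, lor_comm, h0, mul_zero]
    · refine ⟨by rw [lor_smul_left, lor_smul_right, z3, mul_zero, mul_zero], fun v => ?_⟩
      rw [lor_smul_left, lor_comm, h3, mul_zero]

variable [IsManifold (𝓡 2) ∞ M]

/-- A nowhere vanishing smooth section of the image of the tangent bundle determines an adapted
curved flat framing. -/
lemma hasAdaptedCurvedFlatFraming (hnd : IsNondegenerate S) {U : Set M} (hU : IsOpen U)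
    {b : M → R41} (hb : ContMDiffOn (𝓡 2) 𝓘(ℝ, R41) ∞ b U)
    (hbS : ∀ p ∈ U, ∃ v : TangentSpace (𝓡 2) p, v ≠ 0 ∧ b p = diff S p v) :
    HasAdaptedCurvedFlatFraming U S f n f' n' := by
  set a : Fin 4 → M → R41 := fun j p => adFrame (nullVec n p) (nullVec n' p) (b p) j with hadef
  have ha : ∀ p ∈ U, IsLaguerreFrame fun j => a j p := by
    intro p hp
    obtain ⟨v, hv, e⟩ := hbS p hp
    simp only [hadef, e]
    exact D.isLaguerreFrame p hv
  have hpos : ∀ p ∈ U, 0 < lor (b p) (b p) := by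
    intro p hp
    obtain ⟨v, hv, e⟩ := hbS p hp
    rw [e]
    exact D.spacelike.pos p v hv
  have hs := fun j => contMDiffOn_adFrame D.contMDiff_N.contMDiffOn D.contMDiff_N'.contMDiffOn hb
    (fun p _ => (D.lor_nullVec_neg p).ne) hpos j
  have h0 : ∀ p, ∀ v : TangentSpace (𝓡 2) p, lor (diff S p v) (a 0 p) = 0 := D.lor_diff_fst
  have h3 : ∀ p, ∀ v : TangentSpace (𝓡 2) p, lor (diff S p v) (a 3 p) = 0 := fun p v =>
    (lor_smul_right _ _ _).trans (by rw [D.lor_diff_snd, mul_zero])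
  have hd : ∀ p, MDifferentiableAt (𝓡 2) 𝓘(ℝ, ℝ)
      (fun q => (-lor (nullVec n q) (nullVec n' q))⁻¹) p := fun p =>
    MDifferentiableAt.comp (I' := 𝓘(ℝ, ℝ)) p (g := fun t : ℝ => (-t)⁻¹)
      (differentiableAt_id.neg.inv
        (neg_ne_zero.mpr (D.lor_nullVec_neg p).ne)).mdifferentiableAt
      (mdifferentiableAt_of_contMDiffOn isOpen_univ
        (contMDiffOn_lor D.contMDiff_N.contMDiffOn D.contMDiff_N'.contMDiffOn) trivial)
  refine ⟨a, (isCurvedFlatFramingOn_iff hU).mpr ⟨D.spacelike.smooth.contMDiffOn, hs, ha,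
    fun p _ => h0 p, fun p _ => h3 p, fun p hp => D.flatAt (D.not_proportional hnd p) (ha p hp)
      rfl rfl (hd p)⟩, fun p hp => ⟨D.isAdaptedAt (ha p hp) (h0 p) (h3 p), ?_, ?_⟩⟩
  · have := nullLine_eq_lineThrough (D.envelopes p) one_ne_zero
    rwa [one_smul] at this
  · exact nullLine_eq_lineThrough (D.envelopes' p)
      (inv_ne_zero (neg_ne_zero.mpr (D.lor_nullVec_neg p).ne))

/-- A coordinate vector field has no zeros on a parametrized neighbourhood. -/
lemma exists_local_framing (hnd : IsNondegenerate S) (p : M) :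
    ∃ U : Set M, IsOpen U ∧ p ∈ U ∧ HasAdaptedCurvedFlatFraming U S f n f' n' := by
  obtain ⟨e, _, he, -⟩ := exists_basis_pair
  obtain ⟨Φ, χ, Ω, U, hΦ, hpU⟩ := exists_isParam p
  have he0 : e ≠ 0 := he.ne_zero 0
  refine ⟨U, hΦ.isOpen_ran, hpU, D.hasAdaptedCurvedFlatFraming hnd hΦ.isOpen_ran
    (b := fun q => fderiv ℝ (fun x => S (Φ x)) (χ q) e) ?_ fun q hq => ?_⟩
  · exact (contDiffOn_fderiv_apply hΦ.isOpen_dom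
      (hΦ.contDiffOn_comp D.spacelike.smooth.contMDiffOn (Set.subset_univ _)) e).contMDiffOn.comp
      hΦ.smooth_inv hΦ.mapsTo_inv
  · obtain ⟨x, hx, rfl⟩ : ∃ x ∈ Ω, Φ x = q := ⟨χ q, hΦ.mapsTo_inv q hq, hΦ.right_inv q hq⟩
    refine ⟨paramDiff Φ x e, fun h => he0 (hΦ.paramDiff_injective hx (by rw [h, map_zero])), ?_⟩
    rw [hΦ.left_inv x hx]
    exact hΦ.fderiv_comp hx (D.mdiff_S _) e

lemma exists_framing_of_field (hnd : IsNondegenerate S) {U : Set M} (hU : IsOpen U)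
    (h : HasNonvanishingField U) : HasAdaptedCurvedFlatFraming U S f n f' n' := by
  obtain ⟨X, hX, hX0⟩ := h
  refine D.hasAdaptedCurvedFlatFraming hnd hU (b := fun q => diff S q (X q)) ?_
    fun q hq => ⟨X q, hX0 q hq, rfl⟩
  -- Smoothness of dS(X) is that of the tangent map composed with the section, followed by the fibre
  -- projection of the trivial tangent bundle of Minkowski space.
  have h1 : ContMDiff (𝓡 2).tangent 𝓘(ℝ, R41).tangent ∞ (tangentMap (𝓡 2) 𝓘(ℝ, R41) S) :=
    D.spacelike.smooth.contMDiff_tangentMap (by simp)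
  exact (contMDiff_snd_tangentBundle_modelSpace R41 𝓘(ℝ, R41)).comp_contMDiffOn
    (h1.comp_contMDiffOn hX)

end IsDarboux
end Existence
end Laguerre

theorem corollary1 {M : Type*} [TopologicalSpace M]
    [ChartedSpace (EuclideanSpace ℝ (Fin 2)) M] [IsManifold (𝓡 2) ∞ M] :
    (∀ (a₀ : M → Laguerre.R41) (a : Fin 4 → M → Laguerre.R41),
      Laguerre.IsCurvedFlatFramingOn Set.univ a₀ a →
      (∀ p, ∀ v : TangentSpace (𝓡 2) p, v ≠ 0 → Laguerre.diff a₀ p v ≠ 0) →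
      Laguerre.IsImmersedDirection (a 0) →
      Laguerre.IsImmersedDirection (a 3) →
      ∃ f n f' n' : M → Laguerre.R3,
        (∀ p, Laguerre.nullLine (f p) (n p) = Laguerre.lineThrough (a₀ p) (a 0 p)) ∧
        (∀ p, Laguerre.nullLine (f' p) (n' p) = Laguerre.lineThrough (a₀ p) (a 3 p)) ∧
        Laguerre.IsDarboux a₀ f n f' n' ∧
        Laguerre.IsLIsothermic f n ∧ Laguerre.IsLIsothermic f' n') ∧
    (∀ (S : M → Laguerre.R41) (f n f' n' : M → Laguerre.R3),
      Laguerre.IsDarboux S f n f' n' → Laguerre.IsNondegenerate S →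
      (∀ p : M, ∃ U : Set M, IsOpen U ∧ p ∈ U ∧
        Laguerre.HasAdaptedCurvedFlatFraming U S f n f' n') ∧
      (∀ U : Set M, IsOpen U → Laguerre.HasNonvanishingField U →
        Laguerre.HasAdaptedCurvedFlatFraming U S f n f' n')) := by
  exact ⟨fun a₀ a h hS h0 h3 => Laguerre.darboux_of_curvedFlat h hS h0 h3,
    fun S f n f' n' D hnd => ⟨D.exists_local_framing hnd,
      fun _ hU hX => D.exists_framing_of_field hnd hU hX⟩⟩
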